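/- For real $\gamma$ and $x$ let $$\mathrm{Ai}_\gamma(x)=\frac1\pi\int_0^\infty \sigma^\gamma\cos\big(\tfrac13\sigma^3+x\sigma-\tfrac{\gamma\pi}2\big)\,d\sigma,\qquad \mathrm{Gi}_\gamma(x)=\frac1\pi\int_0^\infty \sigma^\gamma\sin\big(\tfrac13\sigma^3+x\sigma-\tfrac{\gamma\pi}2\big)\,d\sigma \quad(-1<\gamma<2)$$ (improper integrals, $\lim_{R\to\infty}\int_0^R$) and $$\mathrm{Hi}_\gamma(x)=\frac1\pi\int_0^\infty\sigma^\gamma e^{-\frac13\sigma^3+\sigma x}\,d\sigma \quad(\gamma>-1).$$ For $a>0$ put $\hat x=a^{1/3}(x+a^{-1})$, $\hat y=a^{1/3}(y+a^{-1})$ and $$\frac{a^{1/3}}{\pi}K^a_\gamma(x,y)=\begin{cases}\mathrm{Ai}_{-\gamma}(\hat y)\,\mathrm{Hi}_\gamma(\hat x), & x<y,\\[1mm] \mathrm{Hi}_{-\gamma}(\hat y)\mathrm{Ai}_\gamma(\hat x)-\sin(\gamma\pi)\big(\mathrm{Gi}_{-\gamma}(\hat y)\mathrm{Gi}_\gamma(\hat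 x)+\mathrm{Ai}_{-\gamma}(\hat y)\mathrm{Ai}_\gamma(\hat x)\big)\\ \quad-\cos(\gamma\pi)\big(\mathrm{Ai}_{-\gamma}(\hat y)\mathrm{Gi}_\gamma(\hat x)-\mathrm{Gi}_{-\gamma}(\hat y)\mathrm{Ai}_\gamma(\hat x)\big), & x\ge y,\end{cases}$$ and let $K^0_\gamma(x,y)=\frac12e^{-|x-y|}$. Let $T^a_\gamma f(x)=\int_{\mathbb R}K^a_\gamma(x,y)f(y)\,dy$; this is the rescaled Green's operator for $a((1+\gamma)u+xu_x)-u_{xxx}+u_x=\partial_xf$. For $k\ge0$ and $a>0$ define the weights $$w^a(x)=\begin{cases}e^{-\frac1{3a}}(1+a^{-2/3}|1+ax|)^{-\frac38}, & x\le-a^{-1},\\ \exp\big(\frac1{3a}[(1+ax)^{3/2}-1]\big), & -a^{-1}\le x\le0,\\ (1+x)^k(1+ax)^{-1-\gamma-k}, & x\ge0,\end{cases}$$ $$w_i^a(x)=\begin{cases}e^{-\frac1{2a}}(1+a^{-2/3}|1+ax|)^{-\frac32}, & x\le-a^{-1},\\ \exp\big(\frac1{2a}[(1+ax)^{3/2}-1]\big),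 & -a^{-1}\le x\le0,\\ (1+x)^k(1+ax)^{-1-\gamma-k}, & x\ge0,\end{cases}$$ and let $w^0(x)=e^{-|x|/2}$, $w^0_i(x)=e^{-3|x|/4}$ for $x<0$ and $w^0(x)=w_i^0(x)=1$ for $x\ge0$. Let $k\ge0$ be real. There is a constant $c>0$, depending only on $k$, such that for all $0\le a\le1$ and all $\gamma$ with $|\gamma+\frac12|\le\frac18$: 1. for every $x\in\mathbb R$ the function $y\mapsto|K^a_\gamma(x,y)|\,w^a_i(y)$ is integrable and $$\int_{\mathbb R}|K^a_\gamma(x,y)|\,w^a_i(y)\,dy\le c\,w^a(x);$$ 2. for every measurable $f:\mathbb R\to\mathbb R$ with $\sup_x|f(x)|/w^a_i(x)<\infty$, the integral defining $T^a_\gamma f(x)$ converges absolutely for every $x$, and $$\sup_{x}\frac{|T^a_\gamma f(x)|}{w^a(x)}\le c\,\sup_x\frac{|f(x)|}{w^a_i(x)}.$$ -/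

import Mathlib

open MeasureTheory

noncomputable section

/-- The generalized Airy function
`Ai_γ(x) = (1/π) ∫_0^∞ σ^γ cos(σ³/3 + xσ - γπ/2) dσ`.
The integral is an improper one: the limit as `R → ∞` of the integrals over `[0, R]`
(which converges for `-1 < γ < 2`, but not absolutely). -/
def genAi (γ x : ℝ) : ℝ :=
  Real.pi⁻¹ * Filter.limUnder Filter.atTop (fun R : ℝ =>
    ∫ σ in (0 : ℝ)..R, σ ^ γ * Real.cos (σ ^ 3 / 3 + x * σ - γ * Real.pi / 2))

/-- The generalized Scorer function
`Gi_γ(x) = (1/π) ∫_0^∞ σ^γ sin(σ³/3 + xσ - γπ/2) dσ`, again an improper integral. -/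
def genGi (γ x : ℝ) : ℝ :=
  Real.pi⁻¹ * Filter.limUnder Filter.atTop (fun R : ℝ =>
    ∫ σ in (0 : ℝ)..R, σ ^ γ * Real.sin (σ ^ 3 / 3 + x * σ - γ * Real.pi / 2))

/-- The generalized Scorer function `Hi_γ(x) = (1/π) ∫_0^∞ σ^γ exp(-σ³/3 + σx) dσ`. -/
def genHi (γ x : ℝ) : ℝ :=
  Real.pi⁻¹ * ∫ σ in Set.Ioi (0 : ℝ), σ ^ γ * Real.exp (-(σ ^ 3 / 3) + σ * x)

/-- The rescaled variable `a^{1/3} (x + a⁻¹) = a^{-2/3} (1 + a x)`. -/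
def rescale (a x : ℝ) : ℝ := a ^ (1 / 3 : ℝ) * (x + a⁻¹)

/-- The integral kernel `K^a_γ(x,y)` of `T^a_γ`, the operator that maps `F` to the solution `u` of
`a ((1+γ) u + x u') - u''' + u' = F'`. For `a = 0` it is the kernel `exp(-|x-y|)/2` of the inverse
of `1 - d²/dx²`. The value on the diagonal is irrelevant. -/
def greenKernel (a γ x y : ℝ) : ℝ :=
  if a = 0 then Real.exp (-|x - y|) / 2
  else if x < y then
    Real.pi * a ^ (-(1 / 3) : ℝ) * (genAi (-γ) (rescale a y) * genHi γ (rescale a x))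
  else
    Real.pi * a ^ (-(1 / 3) : ℝ) *
      (genHi (-γ) (rescale a y) * genAi γ (rescale a x)
        - Real.sin (γ * Real.pi) *
            (genGi (-γ) (rescale a y) * genGi γ (rescale a x)
              + genAi (-γ) (rescale a y) * genAi γ (rescale a x))
        - Real.cos (γ * Real.pi) *
            (genAi (-γ) (rescale a y) * genGi γ (rescale a x)
              - genGi (-γ) (rescale a y) * genAi γ (rescale a x)))

/-- The rescaled Green's operator `T^a_γ f (x) = ∫ K^a_γ(x,y) f(y) dy`. -/
def greenOp (a γ : ℝ) (f : ℝ → ℝ) (x : ℝ) : ℝ :=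
  ∫ y, greenKernel a γ x y * f y

/-- The weight `w^a` (for the image), with parameters `k` and `γ`. -/
def weightOut (k a γ x : ℝ) : ℝ :=
  if a = 0 then (if x < 0 then Real.exp (-|x| / 2) else 1)
  else if x ≤ -a⁻¹ then
    Real.exp (-(1 / (3 * a))) * (1 + a ^ (-(2 / 3) : ℝ) * |1 + a * x|) ^ (-(3 / 8) : ℝ)
  else if x ≤ 0 then
    Real.exp (1 / (3 * a) * ((1 + a * x) ^ (3 / 2 : ℝ) - 1))
  else (1 + x) ^ k * (1 + a * x) ^ (-1 - γ - k)

/-- The weight `w_i^a` (for the argument), with parameters `k` and `γ`. -/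
def weightIn (k a γ x : ℝ) : ℝ :=
  if a = 0 then (if x < 0 then Real.exp (-(3 * |x|) / 4) else 1)
  else if x ≤ -a⁻¹ then
    Real.exp (-(1 / (2 * a))) * (1 + a ^ (-(2 / 3) : ℝ) * |1 + a * x|) ^ (-(3 / 2) : ℝ)
  else if x ≤ 0 then
    Real.exp (1 / (2 * a) * ((1 + a * x) ^ (3 / 2 : ℝ) - 1))
  else (1 + x) ^ k * (1 + a * x) ^ (-1 - γ - k)

end

/-! Both claims follow from one pointwise estimate: |K(x,y)| w_i(y) ≤ C w(x) m(x,y), where m is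
`kernelMajorant`, whose integral in y is bounded uniformly in a and x. The operator bound then
results from inserting |f| ≤ M w_i under the integral.

The kernel is built from products of generalized Airy and Scorer functions, so bounds for these,
uniform in the order δ = ±γ, come first. Ai and Gi are real and imaginary parts of e^{-iδπ/2} ∫ z^δ
exp(i(z³/3 + xz)) dz over the positive axis. The factor z^δ is singular at 0, so an explicit
primitive on the slit plane, `airyPrimitive`, replaces contour closing. Its limit along the real
axis can be read along a slanted path t + i(b + ct), since the vertical connection at abscissa R
costs only O(1/R). For |x| ≥ 1 the path passes through a saddle z² = -x: horizontally through i√x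
for x > 0, diagonally from -i√(-x) through √(-x) for x < 0. It contributes a Gaussian integral of
size |x|^{δ/2-1/4}, times exp(-(2/3) x^{3/2}) when x > 0. The column from 0 to ib contributes
O(|x|^{-1-δ}). For b > 0 this column is purely imaginary after the phase rotation, hence invisible
to Ai: Ai decays exponentially while Gi is only shown to decay algebraically. Hi is estimated by
Laplace's method.

To the right of the turning point x = -1/a, with θ = `decayExponent`, the kernel is at most powers
of `shiftedScale` times exp(-(2/3)|θ(x) - θ(y)|), plus an algebraic tail for y ≤ x. On [-1/a, 0] the
weights are w = exp(-θ/3) and w_i = exp(-θ/2); the gaps in 1/3 < 1/2 < 2/3 leave spare exponential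
decay that absorbs polynomial factors and, across the turning point, negative powers of a. For x, y
> 0 the weights vary slowly, and the algebraic tail has uniform mass after the substitution u = ay.
-/

noncomputable section

open Filter Topology Set

/-! ### A holomorphic primitive of the Airy integrand -/

/-- The exponential factor `exp (i (z³/3 + x z))` of the Airy integral. -/
def airyPhase (x : ℝ) (z : ℂ) : ℂ := Complex.exp (Complex.I * (z ^ 3 / 3 + x * z))

/-- The integrand `z^δ exp (i (z³/3 + x z))` of the generalized Airy integral. -/
def airyIntegrand (δ x : ℝ) (z : ℂ) : ℂ := z ^ (δ : ℂ) * airyPhase x z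

/-- The primitive of `airyIntegrand δ x` on the slit plane that vanishes at `0`. -/
def airyPrimitive (δ x : ℝ) (z : ℂ) : ℂ :=
  z ^ ((δ : ℂ) + 1) * ∫ u in (0 : ℝ)..1, ((u ^ δ : ℝ) : ℂ) * airyPhase x (u * z)

theorem hasDerivAt_airyPhase (x : ℝ) (z : ℂ) :
    HasDerivAt (airyPhase x) (airyPhase x z * (Complex.I * (z ^ 2 + x))) z := by
  have h : HasDerivAt (fun z : ℂ => Complex.I * (z ^ 3 / 3 + x * z))
      (Complex.I * (z ^ 2 + x)) z := by
    have h1 : HasDerivAt (fun z : ℂ => z ^ 3 / 3 + x * z) (3 * z ^ 2 / 3 + x * 1) z :=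
      ((hasDerivAt_pow 3 z).div_const 3).add ((hasDerivAt_id z).const_mul (x : ℂ))
    exact (h1.const_mul Complex.I).congr_deriv (by ring)
  exact h.cexp

theorem continuous_airyPhase (x : ℝ) : Continuous (airyPhase x) := by
  unfold airyPhase; fun_prop

theorem norm_airyPhase (x : ℝ) (z : ℂ) :
    ‖airyPhase x z‖ = Real.exp (-(z.re ^ 2 * z.im - z.im ^ 3 / 3 + x * z.im)) := by
  rw [airyPhase, Complex.norm_exp]
  congr 1
  have h : (z ^ 3 / 3).im = (z ^ 3).im / 3 := by
    rw [show z ^ 3 / 3 = z ^ 3 / ((3 : ℝ) : ℂ) by norm_num, Complex.div_ofReal_im]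
  simp only [Complex.mul_re, Complex.I_re, Complex.I_im, Complex.add_im, Complex.mul_im, h,
    Complex.ofReal_re, Complex.ofReal_im]
  simp [pow_succ]
  ring

theorem intervalIntegrable_ofReal {f : ℝ → ℝ} {a b : ℝ} (hf : IntervalIntegrable f volume a b) :
    IntervalIntegrable (fun u => (f u : ℂ)) volume a b :=
  ⟨hf.1.ofReal, hf.2.ofReal⟩

theorem intervalIntegrable_rpow_mul_airyPhase {δ : ℝ} (hδ : -1 < δ) (x : ℝ) (z : ℂ) (a b : ℝ) :
    IntervalIntegrable (fun u : ℝ => ((u ^ δ : ℝ) : ℂ) * airyPhase x (u * z)) volume a b := by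
  refine IntervalIntegrable.mul_continuousOn ?_ ?_
  · exact intervalIntegrable_ofReal (intervalIntegral.intervalIntegrable_rpow' hδ)
  · exact ((continuous_airyPhase x).comp (by fun_prop)).continuousOn

/-- Integration by parts identity behind the primitive. -/
theorem integral_rpow_mul_airyPhase_deriv {δ : ℝ} (hδ : -1 < δ) (x : ℝ) (z : ℂ) :
    ((δ : ℂ) + 1) * (∫ u in (0 : ℝ)..1, ((u ^ δ : ℝ) : ℂ) * airyPhase x (u * z)) +
      z * (∫ u in (0 : ℝ)..1, ((u ^ δ : ℝ) : ℂ) *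
        (airyPhase x (u * z) * (Complex.I * ((u * z) ^ 2 + x)) * u)) = airyPhase x z := by
  have hd : ∀ u ∈ Ioo (0 : ℝ) 1, HasDerivAt (fun u : ℝ => ((u ^ (δ + 1) : ℝ) : ℂ) *
      airyPhase x (u * z)) (((δ : ℂ) + 1) * (((u ^ δ : ℝ) : ℂ) * airyPhase x (u * z)) +
      z * (((u ^ δ : ℝ) : ℂ) *
        (airyPhase x (u * z) * (Complex.I * ((u * z) ^ 2 + x)) * u))) u := by
    intro u hu
    have h1 : HasDerivAt (fun u : ℝ => ((u ^ (δ + 1) : ℝ) : ℂ)) (((δ + 1) * u ^ δ : ℝ) : ℂ) u := by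
      have := (Real.hasDerivAt_rpow_const (x := u) (p := δ + 1) (Or.inl hu.1.ne')).ofReal_comp
      simpa using this
    have h2 : HasDerivAt (fun u : ℝ => (u : ℂ) * z) z u := by
      simpa using (Complex.ofRealCLM.hasDerivAt (x := u)).mul_const z
    have h3 := (hasDerivAt_airyPhase x (u * z)).comp u h2
    refine (h1.mul h3).congr_deriv ?_
    rw [Real.rpow_add_one hu.1.ne']
    simp only [Function.comp]
    push_cast
    ring
  have hi1 := intervalIntegrable_rpow_mul_airyPhase hδ x z 0 1
  have hi2 : IntervalIntegrable (fun u : ℝ => ((u ^ δ : ℝ) : ℂ) *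
        (airyPhase x (u * z) * (Complex.I * ((u * z) ^ 2 + x)) * u)) volume 0 1 := by
    refine IntervalIntegrable.mul_continuousOn
      (intervalIntegrable_ofReal (intervalIntegral.intervalIntegrable_rpow' hδ)) ?_
    have := continuous_airyPhase x
    exact Continuous.continuousOn (by fun_prop)
  have hc : ContinuousOn (fun u : ℝ => ((u ^ (δ + 1) : ℝ) : ℂ) * airyPhase x (u * z))
      (Icc 0 1) := by
    have := continuous_airyPhase x
    have h2 : Continuous fun u : ℝ => u ^ (δ + 1) :=
      Real.continuous_rpow_const (by linarith)
    exact Continuous.continuousOn (by fun_prop)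
  have := intervalIntegral.integral_eq_sub_of_hasDerivAt_of_le zero_le_one hc hd
    ((hi1.const_mul _).add (hi2.const_mul _))
  rw [intervalIntegral.integral_add (hi1.const_mul _) (hi2.const_mul _),
    intervalIntegral.integral_const_mul, intervalIntegral.integral_const_mul] at this
  rw [this]
  simp [Real.zero_rpow (show δ + 1 ≠ 0 by linarith)]

theorem hasDerivAt_integral_rpow_mul_airyPhase {δ : ℝ} (hδ : -1 < δ) (x : ℝ) (z : ℂ) :
    HasDerivAt (fun z : ℂ => ∫ u in (0 : ℝ)..1, ((u ^ δ : ℝ) : ℂ) * airyPhase x (u * z))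
      (∫ u in (0 : ℝ)..1, ((u ^ δ : ℝ) : ℂ) *
        (airyPhase x (u * z) * (Complex.I * ((u * z) ^ 2 + x)) * u)) z := by
  have hph := continuous_airyPhase x
  let G : ℂ × ℝ → ℂ := fun p =>
    airyPhase x (p.2 * p.1) * (Complex.I * ((p.2 * p.1) ^ 2 + x)) * p.2
  have hG : Continuous G := by fun_prop
  obtain ⟨C, hC⟩ := ((isCompact_closedBall z 1).prod (isCompact_Icc (a := (0 : ℝ)) (b := 1))
    ).exists_bound_of_continuousOn hG.continuousOn
  refine (intervalIntegral.hasDerivAt_integral_of_dominated_loc_of_deriv_le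
    (F := fun (z : ℂ) (u : ℝ) => ((u ^ δ : ℝ) : ℂ) * airyPhase x (u * z))
    (F' := fun (z : ℂ) (u : ℝ) => ((u ^ δ : ℝ) : ℂ) *
        (airyPhase x (u * z) * (Complex.I * ((u * z) ^ 2 + x)) * u))
    (s := Metric.closedBall z 1) (bound := fun u => u ^ δ * C)
    (Metric.closedBall_mem_nhds z one_pos) ?_ ?_ ?_ ?_ ?_ ?_).2
  · exact Eventually.of_forall fun w =>
      (intervalIntegrable_iff.1
        (intervalIntegrable_rpow_mul_airyPhase hδ x w 0 1)).aestronglyMeasurable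
  · exact intervalIntegrable_rpow_mul_airyPhase hδ x z 0 1
  · exact Measurable.aestronglyMeasurable (by have := hph.measurable; fun_prop)
  · refine Eventually.of_forall fun u hu w hw => ?_
    rw [uIoc_of_le zero_le_one] at hu
    rw [norm_mul, Complex.norm_real, Real.norm_of_nonneg (Real.rpow_nonneg hu.1.le _)]
    exact mul_le_mul_of_nonneg_left (hC (w, u) ⟨hw, hu.1.le, hu.2⟩) (Real.rpow_nonneg hu.1.le _)
  · exact (intervalIntegral.intervalIntegrable_rpow' hδ).mul_const C
  · refine Eventually.of_forall fun u hu w hw => ?_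
    have h2 : HasDerivAt (fun w : ℂ => (u : ℂ) * w) u w := by
      simpa using (hasDerivAt_id w).const_mul (u : ℂ)
    exact ((hasDerivAt_airyPhase x (u * w)).comp w h2).const_mul _

/-- The product rule yields z^δ times the left side of the integration by parts identity. No Cauchy
theorem near the branch point is needed. -/
theorem hasDerivAt_airyPrimitive {δ : ℝ} (hδ : -1 < δ) (x : ℝ) {z : ℂ}
    (hz : z ∈ Complex.slitPlane) :
    HasDerivAt (airyPrimitive δ x) (airyIntegrand δ x z) z := by
  have h1 : HasDerivAt (fun z : ℂ => z ^ ((δ : ℂ) + 1)) (((δ : ℂ) + 1) * z ^ (δ : ℂ)) z := by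
    have := (hasDerivAt_id z).cpow_const (c := (δ : ℂ) + 1) hz
    simpa using this
  refine (h1.mul (hasDerivAt_integral_rpow_mul_airyPhase hδ x z)).congr_deriv ?_
  rw [Complex.cpow_add _ _ (Complex.slitPlane_ne_zero hz), Complex.cpow_one, airyIntegrand,
    ← integral_rpow_mul_airyPhase_deriv hδ x z]
  ring

theorem airyPrimitive_ofReal (δ x : ℝ) {R : ℝ} (hR : 0 < R) :
    airyPrimitive δ x R = ∫ σ in (0 : ℝ)..R, ((σ ^ δ : ℝ) : ℂ) * airyPhase x σ := by
  have h' := intervalIntegral.smul_integral_comp_mul_left (a := 0) (b := 1)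
    (fun σ : ℝ => ((σ ^ δ : ℝ) : ℂ) * airyPhase x σ) R
  rw [mul_zero, mul_one] at h'
  rw [← h', airyPrimitive, Complex.cpow_add _ _ (by exact_mod_cast hR.ne'), Complex.cpow_one,
    ← Complex.ofReal_cpow hR.le, Complex.real_smul, mul_comm ((R ^ δ : ℝ) : ℂ), mul_assoc,
    ← intervalIntegral.integral_const_mul]
  congr 1
  refine intervalIntegral.integral_congr fun u hu => ?_
  rw [uIcc_of_le zero_le_one] at hu
  rw [Real.mul_rpow hR.le hu.1]
  push_cast
  rw [mul_comm (u : ℂ) R]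
  ring

/-! ### Moving the path of integration -/

theorem continuousOn_airyIntegrand (δ x : ℝ) :
    ContinuousOn (airyIntegrand δ x) Complex.slitPlane := by
  refine ContinuousOn.mul (fun z hz => ?_) (continuous_airyPhase x).continuousOn
  exact (continuousAt_id.cpow continuousAt_const hz).continuousWithinAt

/-- The fundamental theorem of calculus for `airyPrimitive` along a segment `p + q t`. -/
theorem integral_airyIntegrand_segment {δ : ℝ} (hδ : -1 < δ) (x : ℝ) (p q : ℂ) {T : ℝ}
    (hT : 0 ≤ T) (h : ∀ t ∈ Icc (0 : ℝ) T, p + q * t ∈ Complex.slitPlane) :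
    q * ∫ t in (0 : ℝ)..T, airyIntegrand δ x (p + q * t) =
      airyPrimitive δ x (p + q * T) - airyPrimitive δ x p := by
  rw [← intervalIntegral.integral_const_mul]
  have hd : ∀ t ∈ uIcc (0 : ℝ) T, HasDerivAt (fun t : ℝ => airyPrimitive δ x (p + q * t))
      (q * airyIntegrand δ x (p + q * t)) t := by
    intro t ht
    rw [uIcc_of_le hT] at ht
    have h2 : HasDerivAt (fun t : ℝ => p + q * (t : ℂ)) q t := by
      simpa using ((Complex.ofRealCLM.hasDerivAt (x := t)).const_mul q).const_add p
    have := (hasDerivAt_airyPrimitive hδ x (h t ht)).comp t h2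
    rwa [mul_comm] at this
  rw [intervalIntegral.integral_eq_sub_of_hasDerivAt hd]
  · simp
  · refine ContinuousOn.intervalIntegrable (ContinuousOn.mul continuousOn_const ?_)
    rw [uIcc_of_le hT]
    exact (continuousOn_airyIntegrand δ x).comp (by fun_prop) h

theorem norm_airyIntegrand (δ x : ℝ) {z : ℂ} (hz : z ≠ 0) : ‖airyIntegrand δ x z‖ =
    ‖z‖ ^ δ * Real.exp (-(z.re ^ 2 * z.im - z.im ^ 3 / 3 + x * z.im)) := by
  rw [airyIntegrand, norm_mul, norm_airyPhase]
  congr 1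
  rw [Complex.norm_cpow_of_ne_zero hz]
  simp

/-- The connection at infinity between the real axis and a path with 0 ≤ Im z ≤ Re z: on it the
integrand is at most 2R exp(-R² t/3), whose integral is at most 6/R. -/
theorem norm_airyPrimitive_vertical_sub_le {δ : ℝ} (hδ : -1 < δ) (hδ1 : δ ≤ 1) {x h R : ℝ}
    (hR : 1 ≤ R) (hx : 3 * |x| ≤ R ^ 2) (h0 : 0 ≤ h) (hhR : h ≤ R) :
    ‖airyPrimitive δ x (R + Complex.I * h) - airyPrimitive δ x R‖ ≤ 6 / R := by
  rw [← integral_airyIntegrand_segment hδ x R Complex.I h0]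
  · rw [norm_mul, Complex.norm_I, one_mul]
    have hR2 : 0 < R ^ 2 / 3 := by positivity
    have hcont : IntervalIntegrable (fun t => 2 * R * Real.exp (-(R ^ 2 / 3) * t)) volume 0 h :=
      (by fun_prop : Continuous _).intervalIntegrable _ _
    refine (intervalIntegral.norm_integral_le_of_norm_le h0
      (g := fun t => 2 * R * Real.exp (-(R ^ 2 / 3) * t)) ?_ hcont).trans ?_
    · refine Eventually.of_forall fun t ht => ?_
      have hre : ((R : ℂ) + Complex.I * t).re = R := by simp
      have him : ((R : ℂ) + Complex.I * t).im = t := by simp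
      have hn1 : 1 ≤ ‖(R : ℂ) + Complex.I * t‖ := by
        refine le_trans ?_ (Complex.abs_re_le_norm _)
        rw [hre]; exact hR.trans (le_abs_self R)
      have hn2 : ‖(R : ℂ) + Complex.I * t‖ ≤ 2 * R := by
        refine (norm_add_le _ _).trans ?_
        rw [norm_mul, Complex.norm_I, Complex.norm_real, Complex.norm_real,
          Real.norm_of_nonneg (by linarith), Real.norm_of_nonneg ht.1.le]
        linarith [ht.2]
      rw [norm_airyIntegrand _ _ (norm_pos_iff.1 (by linarith)), hre, him]
      gcongr
      · calc _ ≤ ‖(R : ℂ) + Complex.I * t‖ ^ (1 : ℝ) :=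
            Real.rpow_le_rpow_of_exponent_le hn1 hδ1
          _ ≤ _ := by rwa [Real.rpow_one]
      -- In the exponent R² t - t³/3 + x t, the bounds t² ≤ R² and 3x ≥ -R² each cost a third of R²
      -- t, which leaves the rate R²/3.
      · have h1 : t ^ 2 ≤ R ^ 2 := by
          have := ht.1; have := ht.2; gcongr; linarith
        have h2 := neg_abs_le x
        have h3 : 0 ≤ t * (R ^ 2 - t ^ 2 + (3 * x + R ^ 2)) :=
          mul_nonneg ht.1.le (by linarith)
        nlinarith
    · rw [intervalIntegral.integral_const_mul]
      have : ∫ t in (0 : ℝ)..h, Real.exp (-(R ^ 2 / 3) * t) ≤ 3 / R ^ 2 := by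
        rw [intervalIntegral.integral_comp_mul_left (fun t => Real.exp t) (by linarith)]
        rw [integral_exp, smul_eq_mul, mul_zero, Real.exp_zero]
        have := Real.exp_pos (-(R ^ 2 / 3) * h)
        rw [show (-(R ^ 2 / 3))⁻¹ * (Real.exp (-(R ^ 2 / 3) * h) - 1) =
          3 / R ^ 2 * (1 - Real.exp (-(R ^ 2 / 3) * h)) by field_simp; ring]
        exact mul_le_of_le_one_right (by positivity) (by linarith)
      calc _ ≤ 2 * R * (3 / R ^ 2) := by gcongr
        _ = 6 / R := by field_simp; ring
  · intro t ht
    exact Or.inl (by simp; linarith)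

/-- The limit of `∫_0^R` expressed through a path `t + i (b + c t)` in the plane. -/
theorem tendsto_airyPrimitive {δ : ℝ} (hδ : -1 < δ) (hδ1 : δ ≤ 1) (x : ℝ) {b c : ℝ} (hb : b ≠ 0)
    (hbc : ∀ᶠ R : ℝ in atTop, 0 ≤ b + c * R ∧ b + c * R ≤ R)
    (hint : IntegrableOn (fun t : ℝ =>
      airyIntegrand δ x (Complex.I * b + (1 + Complex.I * c) * t)) (Ioi 0)) :
    Tendsto (fun R : ℝ => airyPrimitive δ x R) atTop (𝓝 (airyPrimitive δ x (Complex.I * b) +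
      (1 + Complex.I * c) * ∫ t in Ioi (0 : ℝ),
        airyIntegrand δ x (Complex.I * b + (1 + Complex.I * c) * t))) := by
  have h1 := (intervalIntegral_tendsto_integral_Ioi 0 hint tendsto_id).const_mul
    (1 + Complex.I * c)
  have h2 : Tendsto (fun R : ℝ => airyPrimitive δ x (Complex.I * b + (1 + Complex.I * c) * R))
      atTop (𝓝 (airyPrimitive δ x (Complex.I * b) + (1 + Complex.I * c) * ∫ t in Ioi (0 : ℝ),
        airyIntegrand δ x (Complex.I * b + (1 + Complex.I * c) * t))) := by
    refine (h1.const_add (airyPrimitive δ x (Complex.I * b))).congr' ?_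
    filter_upwards [eventually_ge_atTop 0] with R hR
    rw [id, integral_airyIntegrand_segment hδ x _ _ hR]
    · ring
    · intro t ht
      rcases ht.1.eq_or_lt with h | h
      -- At t = 0 the path lies on the imaginary axis, and b ≠ 0 keeps it off the branch cut.
      · exact Or.inr (by simpa [← h] using hb)
      · exact Or.inl (by simpa using h)
  have h3 : Tendsto (fun R : ℝ => airyPrimitive δ x (Complex.I * b + (1 + Complex.I * c) * R) -
      airyPrimitive δ x R) atTop (𝓝 0) := by
    refine squeeze_zero_norm' (a := fun R : ℝ => 6 / R) ?_ (tendsto_const_nhds.div_atTop tendsto_id)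
    have hx : ∀ᶠ R : ℝ in atTop, 3 * |x| ≤ R ^ 2 :=
      (tendsto_pow_atTop (two_ne_zero)).eventually_ge_atTop _
    filter_upwards [hbc, hx, eventually_ge_atTop 1] with R hR1 hR2 hR3
    rw [show Complex.I * b + (1 + Complex.I * c) * R =
      (R : ℂ) + Complex.I * ((b + c * R : ℝ) : ℂ) by push_cast; ring]
    exact norm_airyPrimitive_vertical_sub_le hδ hδ1 hR3 hR2 hR1.1 hR1.2
  simpa using h2.sub h3

/-! ### Ai and Gi as real and imaginary parts of one complex limit -/

theorem ofReal_integral_cos_add_sin {δ : ℝ} (hδ : -1 < δ) (x : ℝ) {R : ℝ} (hR : 0 < R) :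
    Complex.exp (-(Complex.I * (δ * Real.pi / 2))) * airyPrimitive δ x R =
      ((∫ σ in (0 : ℝ)..R, σ ^ δ * Real.cos (σ ^ 3 / 3 + x * σ - δ * Real.pi / 2) : ℝ) : ℂ) +
      ((∫ σ in (0 : ℝ)..R, σ ^ δ * Real.sin (σ ^ 3 / 3 + x * σ - δ * Real.pi / 2) : ℝ) : ℂ) *
        Complex.I := by
  rw [airyPrimitive_ofReal _ _ hR, ← intervalIntegral.integral_ofReal,
    ← intervalIntegral.integral_ofReal, ← intervalIntegral.integral_mul_const,
    ← intervalIntegral.integral_const_mul, ← intervalIntegral.integral_add]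
  · refine intervalIntegral.integral_congr fun σ _ => ?_
    simp only [airyPhase]
    have := Complex.exp_mul_I (σ ^ 3 / 3 + x * σ - δ * Real.pi / 2)
    rw [mul_left_comm, ← Complex.exp_add]
    push_cast
    rw [show -(Complex.I * (δ * Real.pi / 2)) + Complex.I * (σ ^ 3 / 3 + x * σ) =
      (σ ^ 3 / 3 + x * σ - δ * Real.pi / 2) * Complex.I by ring, this]
    ring
  · refine intervalIntegrable_ofReal ((intervalIntegral.intervalIntegrable_rpow' hδ
      ).mul_continuousOn (Continuous.continuousOn (by fun_prop)))
  · refine IntervalIntegrable.mul_const (intervalIntegrable_ofReal (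
      (intervalIntegral.intervalIntegrable_rpow' hδ
      ).mul_continuousOn (Continuous.continuousOn (by fun_prop)))) _

theorem tendsto_integral_cos_of_tendsto {δ : ℝ} (hδ : -1 < δ) {x : ℝ} {L : ℂ}
    (hL : Tendsto (fun R : ℝ => airyPrimitive δ x R) atTop (𝓝 L)) :
    Tendsto (fun R : ℝ => ∫ σ in (0 : ℝ)..R,
      σ ^ δ * Real.cos (σ ^ 3 / 3 + x * σ - δ * Real.pi / 2)) atTop
      (𝓝 (Complex.exp (-(Complex.I * (δ * Real.pi / 2))) * L).re) := by
  refine ((Complex.continuous_re.tendsto _).comp (hL.const_mul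
    (Complex.exp (-(Complex.I * (δ * Real.pi / 2)))))).congr' ?_
  filter_upwards [eventually_gt_atTop 0] with R hR
  simp only [Function.comp]
  rw [ofReal_integral_cos_add_sin hδ x hR]
  simp [-Complex.ofReal_cos, -Complex.ofReal_sin]

theorem tendsto_integral_sin_of_tendsto {δ : ℝ} (hδ : -1 < δ) {x : ℝ} {L : ℂ}
    (hL : Tendsto (fun R : ℝ => airyPrimitive δ x R) atTop (𝓝 L)) :
    Tendsto (fun R : ℝ => ∫ σ in (0 : ℝ)..R,
      σ ^ δ * Real.sin (σ ^ 3 / 3 + x * σ - δ * Real.pi / 2)) atTop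
      (𝓝 (Complex.exp (-(Complex.I * (δ * Real.pi / 2))) * L).im) := by
  refine ((Complex.continuous_im.tendsto _).comp (hL.const_mul
    (Complex.exp (-(Complex.I * (δ * Real.pi / 2)))))).congr' ?_
  filter_upwards [eventually_gt_atTop 0] with R hR
  simp only [Function.comp]
  rw [ofReal_integral_cos_add_sin hδ x hR]
  simp [-Complex.ofReal_cos, -Complex.ofReal_sin]

theorem genAi_eq_of_tendsto {δ : ℝ} (hδ : -1 < δ) {x : ℝ} {L : ℂ}
    (hL : Tendsto (fun R : ℝ => airyPrimitive δ x R) atTop (𝓝 L)) :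
    genAi δ x = Real.pi⁻¹ * (Complex.exp (-(Complex.I * (δ * Real.pi / 2))) * L).re := by
  rw [genAi, (tendsto_integral_cos_of_tendsto hδ hL).limUnder_eq]

theorem genGi_eq_of_tendsto {δ : ℝ} (hδ : -1 < δ) {x : ℝ} {L : ℂ}
    (hL : Tendsto (fun R : ℝ => airyPrimitive δ x R) atTop (𝓝 L)) :
    genGi δ x = Real.pi⁻¹ * (Complex.exp (-(Complex.I * (δ * Real.pi / 2))) * L).im := by
  rw [genGi, (tendsto_integral_sin_of_tendsto hδ hL).limUnder_eq]

/-! ### The contribution of the imaginary axis -/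

theorem Gamma_le_max {δ : ℝ} (hδ : |δ| ≤ 5 / 8) :
    Real.Gamma (δ + 1) ≤ max (Real.Gamma (3 / 8)) (Real.Gamma (13 / 8)) := by
  have := abs_le.1 hδ
  exact Real.convexOn_Gamma.le_max_of_mem_Icc (by norm_num) (by norm_num)
    ⟨by linarith, by linarith⟩

/-- An upper bound for `Γ (1 + δ)`, uniform in `|δ| ≤ 5/8`. -/
def gammaBound : ℝ := max (Real.Gamma (3 / 8)) (Real.Gamma (13 / 8))

theorem gammaBound_pos : 0 < gammaBound :=
  lt_max_of_lt_left (Real.Gamma_pos_of_pos (by norm_num))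

theorem integral_rpow_mul_exp_le {δ r : ℝ} (hδ : |δ| ≤ 5 / 8) (hr : 0 < r) :
    ∫ t in Ioi (0 : ℝ), t ^ δ * Real.exp (-(r * t)) ≤ r ^ (-1 - δ) * gammaBound := by
  have := abs_le.1 hδ
  have h := Real.integral_rpow_mul_exp_neg_mul_Ioi (a := δ + 1) (by linarith) hr
  rw [add_sub_cancel_right] at h
  rw [h, one_div, Real.inv_rpow hr.le, ← Real.rpow_neg hr.le, show -(δ + 1) = -1 - δ by ring]
  exact mul_le_mul_of_nonneg_left (Gamma_le_max hδ) (Real.rpow_nonneg hr.le _)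

theorem integrableOn_rpow_mul_exp {δ r : ℝ} (hδ : -1 < δ) (hr : 0 < r) :
    IntegrableOn (fun t : ℝ => t ^ δ * Real.exp (-(r * t))) (Ioi 0) := by
  simpa using integrableOn_rpow_mul_exp_neg_mul_rpow hδ one_pos hr

/-- On the imaginary axis the phase is real, and a linear majorant of its exponent reduces the
integral to a Gamma integral. The powers of |b| cancel, so only the rate r remains. -/
theorem norm_airyPrimitive_I_mul_le {δ x b r M : ℝ} (hδ : |δ| ≤ 5 / 8) (hr : 0 < r) (hb : b ≠ 0)
    (h : ∀ u ∈ Ioc (0 : ℝ) 1, (u * b) ^ 3 / 3 - x * (u * b) ≤ M - r * (u * |b|)) :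
    ‖airyPrimitive δ x (Complex.I * b)‖ ≤ Real.exp M * (r ^ (-1 - δ) * gammaBound) := by
  have hδ' := abs_le.1 hδ
  have hb' : 0 < |b| := abs_pos.2 hb
  have hrb : 0 < r * |b| := mul_pos hr hb'
  have hz : Complex.I * (b : ℂ) ≠ 0 := mul_ne_zero Complex.I_ne_zero (by exact_mod_cast hb)
  have hnorm : ‖(Complex.I * (b : ℂ)) ^ ((δ : ℂ) + 1)‖ = |b| ^ (δ + 1) := by
    rw [Complex.norm_cpow_of_ne_zero hz]
    simp
  have hint := (integrableOn_rpow_mul_exp (δ := δ) (by linarith) hrb).const_mul (Real.exp M)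
  have h1 : ‖∫ u in (0 : ℝ)..1, ((u ^ δ : ℝ) : ℂ) * airyPhase x (u * (Complex.I * b))‖ ≤
      ∫ u in (0 : ℝ)..1, Real.exp M * (u ^ δ * Real.exp (-(r * |b| * u))) := by
    refine intervalIntegral.norm_integral_le_of_norm_le zero_le_one
      (Eventually.of_forall fun u hu => ?_) ?_
    · rw [norm_mul, Complex.norm_real, Real.norm_of_nonneg (Real.rpow_nonneg hu.1.le _),
        norm_airyPhase, mul_left_comm (Real.exp M), ← Real.exp_add]
      have := h u hu
      refine mul_le_mul_of_nonneg_left (Real.exp_le_exp.2 ?_) (Real.rpow_nonneg hu.1.le _)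
      simp
      linarith
    · rw [intervalIntegrable_iff_integrableOn_Ioc_of_le zero_le_one]
      exact IntegrableOn.mono_set hint Ioc_subset_Ioi_self
  have h2 : ∫ u in (0 : ℝ)..1, Real.exp M * (u ^ δ * Real.exp (-(r * |b| * u))) ≤
      Real.exp M * ((r * |b|) ^ (-1 - δ) * gammaBound) := by
    rw [intervalIntegral.integral_of_le zero_le_one]
    refine (setIntegral_mono_set hint ?_ Ioc_subset_Ioi_self.eventuallyLE).trans ?_
    · filter_upwards [ae_restrict_mem measurableSet_Ioi] with u hu
      have := Real.rpow_nonneg (le_of_lt hu) δ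
      simp only [Pi.zero_apply]
      positivity
    · rw [integral_const_mul]
      exact mul_le_mul_of_nonneg_left (integral_rpow_mul_exp_le hδ hrb) (Real.exp_pos _).le
  rw [airyPrimitive, norm_mul, hnorm]
  calc _ ≤ |b| ^ (δ + 1) * (Real.exp M * ((r * |b|) ^ (-1 - δ) * gammaBound)) := by
        gcongr; exact h1.trans h2
    _ = _ := by
        rw [Real.mul_rpow hr.le hb'.le]
        have : |b| ^ (δ + 1) * |b| ^ (-1 - δ) = 1 := by
          rw [← Real.rpow_add hb', show δ + 1 + (-1 - δ) = 0 by ring, Real.rpow_zero]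
        linear_combination (Real.exp M * r ^ (-1 - δ) * gammaBound) * this

/-- The primitive at a point of the positive imaginary axis contributes nothing to the real part
after the phase rotation. -/
theorem re_exp_mul_airyPrimitive_I_mul (δ x : ℝ) {s : ℝ} (hs : 0 < s) :
    (Complex.exp (-(Complex.I * (δ * Real.pi / 2))) *
      airyPrimitive δ x (Complex.I * s)).re = 0 := by
  have h1 : Complex.exp (-(Complex.I * (δ * Real.pi / 2))) *
      (Complex.I * (s : ℂ)) ^ ((δ : ℂ) + 1) = Complex.I * ((s ^ (δ + 1) : ℝ) : ℂ) := by
    have hI : Complex.exp (Real.pi / 2 * Complex.I) = Complex.I := by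
      rw [← Complex.log_I, Complex.exp_log Complex.I_ne_zero]
    have hs' : (s : ℂ) ≠ 0 := by exact_mod_cast hs.ne'
    rw [Complex.cpow_def_of_ne_zero (mul_ne_zero Complex.I_ne_zero hs'),
      Complex.log_mul_ofReal _ hs _ Complex.I_ne_zero, Complex.log_I, Complex.ofReal_cpow hs.le,
      Complex.cpow_def_of_ne_zero hs', ← Complex.ofReal_log hs.le, ← Complex.exp_add]
    conv_rhs => rw [← hI, ← Complex.exp_add]
    congr 1
    push_cast
    ring
  have h2 : ∫ u in (0 : ℝ)..1, ((u ^ δ : ℝ) : ℂ) * airyPhase x (u * (Complex.I * s)) =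
      ((∫ u in (0 : ℝ)..1, u ^ δ * Real.exp ((u * s) ^ 3 / 3 - x * (u * s)) : ℝ) : ℂ) := by
    rw [← intervalIntegral.integral_ofReal]
    refine intervalIntegral.integral_congr fun u _ => ?_
    simp only [airyPhase]
    push_cast
    congr 2
    linear_combination ((u * s) ^ 3 / 3 * (Complex.I ^ 2 - 1) + x * u * s) * Complex.I_sq
  rw [airyPrimitive, ← mul_assoc, h1, h2]
  rw [mul_assoc, ← Complex.ofReal_mul]
  simp

/-! ### Saddle point estimates -/

/-- A Gaussian bound on the path gives both convergence and the distance from the limit to the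
column contribution at ib. The factor 2 bounds |1 + ic|. -/
theorem exists_tendsto_airyPrimitive {δ x b c A β t₀ : ℝ} (hδ : |δ| ≤ 5 / 8) (hb : b ≠ 0)
    (hbc : ∀ᶠ R : ℝ in atTop, 0 ≤ b + c * R ∧ b + c * R ≤ R) (hc : |c| ≤ 1) (hβ : 0 < β)
    (hA : 0 ≤ A)
    (h : ∀ t : ℝ, 0 < t → ‖airyIntegrand δ x (Complex.I * b + (1 + Complex.I * c) * t)‖ ≤
      A * Real.exp (-β * (t - t₀) ^ 2)) :
    ∃ L : ℂ, Tendsto (fun R : ℝ => airyPrimitive δ x R) atTop (𝓝 L) ∧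
      ‖L - airyPrimitive δ x (Complex.I * b)‖ ≤ 2 * A * √(Real.pi / β) := by
  have hδ' := abs_le.1 hδ
  have hg : Integrable (fun t : ℝ => A * Real.exp (-β * (t - t₀) ^ 2)) :=
    ((integrable_exp_neg_mul_sq hβ).comp_sub_right t₀).const_mul A
  have hb' : ∀ᵐ t : ℝ ∂(volume.restrict (Ioi (0 : ℝ))),
      ‖airyIntegrand δ x (Complex.I * b + (1 + Complex.I * c) * t)‖ ≤
      A * Real.exp (-β * (t - t₀) ^ 2) := by
    filter_upwards [ae_restrict_mem measurableSet_Ioi] with t ht using h t ht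
  refine ⟨_, tendsto_airyPrimitive (by linarith) (by linarith) x hb hbc ?_, ?_⟩
  · refine hg.integrableOn.mono' ?_ hb'
    refine ContinuousOn.aestronglyMeasurable ?_ measurableSet_Ioi
    refine (continuousOn_airyIntegrand δ x).comp (by fun_prop) fun t ht => Or.inl ?_
    simpa using ht
  · rw [add_sub_cancel_left, norm_mul, mul_assoc]
    refine mul_le_mul ?_ ?_ (norm_nonneg _) zero_le_two
    · refine (norm_add_le _ _).trans ?_
      rw [norm_mul, Complex.norm_I, Complex.norm_real, norm_one, Real.norm_eq_abs]
      linarith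
    · refine (norm_integral_le_of_norm_le hg.integrableOn hb').trans ?_
      refine (setIntegral_le_integral hg (Eventually.of_forall fun t => by positivity)).trans ?_
      rw [integral_const_mul, integral_sub_right_eq_self (fun t : ℝ => Real.exp (-β * t ^ 2)),
        integral_gaussian]

theorem rpow_le_add_inv {q δ : ℝ} (hq : 0 < q) (hδ : |δ| ≤ 1) : q ^ δ ≤ q + q⁻¹ := by
  have := abs_le.1 hδ
  rcases le_total 1 q with h | h
  · calc q ^ δ ≤ q ^ (1 : ℝ) := Real.rpow_le_rpow_of_exponent_le h this.2
      _ ≤ _ := by rw [Real.rpow_one]; linarith [inv_pos.2 hq]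
  · calc q ^ δ ≤ q ^ (-1 : ℝ) := Real.rpow_le_rpow_of_exponent_ge hq h this.1
      _ ≤ _ := by rw [Real.rpow_neg_one]; linarith

/-- Absorbs the linear growth of |z|^δ by giving up part of the Gaussian rate, through 1 + t ≤ e^t.
-/
theorem linear_mul_exp_le {p q B y u v : ℝ} (h : p + q * y ≤ B * (1 + (u - v) * y ^ 2))
    (hB : 0 ≤ B) : (p + q * y) * Real.exp (-u * y ^ 2) ≤ B * Real.exp (-v * y ^ 2) := by
  have h1 := Real.add_one_le_exp ((u - v) * y ^ 2)
  calc _ ≤ (B * Real.exp ((u - v) * y ^ 2)) * Real.exp (-u * y ^ 2) := by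
        refine mul_le_mul_of_nonneg_right (h.trans ?_) (Real.exp_pos _).le
        exact mul_le_mul_of_nonneg_left (by linarith) hB
    _ = _ := by rw [mul_assoc, ← Real.exp_add]; congr 2; ring

/-- The line Im z = s passes through the saddle is in its steepest descent direction, where the
exponent has real part exactly -(2/3)s³ - s t². Half of the rate s pays for |z|^δ. -/
theorem exists_tendsto_airyPrimitive_sq {δ s : ℝ} (hδ : |δ| ≤ 5 / 8) (hs : 1 ≤ s) :
    ∃ L : ℂ, Tendsto (fun R : ℝ => airyPrimitive δ (s ^ 2) R) atTop (𝓝 L) ∧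
      ‖L - airyPrimitive δ (s ^ 2) (Complex.I * s)‖ ≤
        2 * (2 * s ^ δ * Real.exp (-(2 / 3 * s ^ 3))) * √(Real.pi / (s / 2)) := by
  have hδ' := abs_le.1 hδ
  have hs0 : 0 < s := by linarith
  refine exists_tendsto_airyPrimitive (c := 0) (t₀ := 0) hδ hs0.ne' ?_ (by simp) (by linarith)
    (by positivity) fun t ht => ?_
  · filter_upwards [eventually_ge_atTop s] with R hR
    exact ⟨by linarith, by linarith⟩
  · have hz : Complex.I * (s : ℂ) + (1 + Complex.I * ((0 : ℝ) : ℂ)) * t = t + Complex.I * s := by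
      push_cast; ring
    have hre : ((t : ℂ) + Complex.I * s).re = t := by simp
    have him : ((t : ℂ) + Complex.I * s).im = s := by simp
    rw [hz]
    set z := (t : ℂ) + Complex.I * s with hzdef
    have hn1 : s ≤ ‖z‖ := by
      refine le_trans ?_ (Complex.abs_im_le_norm z)
      rw [him]; exact le_abs_self s
    have hn2 : ‖z‖ ≤ s + t := by
      refine (Complex.norm_le_abs_re_add_abs_im z).trans ?_
      rw [hre, him, abs_of_pos ht, abs_of_pos hs0, add_comm]
    have hq : ‖z‖ ^ δ ≤ s ^ δ * (1 + √s * t) := by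
      have h1 : 1 ≤ ‖z‖ / s := (one_le_div hs0).2 hn1
      have h2 : ‖z‖ = s * (‖z‖ / s) := by field_simp
      rw [h2, Real.mul_rpow hs0.le (by positivity)]
      refine mul_le_mul_of_nonneg_left ?_ (by positivity)
      calc (‖z‖ / s) ^ δ ≤ (‖z‖ / s) ^ (1 : ℝ) :=
            Real.rpow_le_rpow_of_exponent_le h1 (by linarith)
        _ ≤ (s + t) / s := by rw [Real.rpow_one]; gcongr
        _ = 1 + t / s := by field_simp
        _ ≤ _ := by
          have h3 : t / s ≤ t := div_le_self ht.le hs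
          have h4 : 1 ≤ √s := Real.one_le_sqrt.2 hs
          nlinarith
    rw [norm_airyIntegrand _ _ (norm_pos_iff.1 (by linarith)), hre, him]
    have h5 : (√s * t) ^ 2 = s * t ^ 2 := by rw [mul_pow, Real.sq_sqrt hs0.le]
    have h6 := linear_mul_exp_le (p := 1) (q := 1) (B := 2) (y := √s * t) (u := 1) (v := 1 / 2)
      (by nlinarith [sq_nonneg (√s * t - 1)]) (by norm_num)
    rw [h5] at h6
    calc _ ≤ s ^ δ * (1 + √s * t) * Real.exp (-(t ^ 2 * s - s ^ 3 / 3 + s ^ 2 * s)) := by gcongr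
      _ = s ^ δ * Real.exp (-(2 / 3 * s ^ 3)) *
          ((1 + 1 * (√s * t)) * Real.exp (-1 * (s * t ^ 2))) := by
        rw [show -(t ^ 2 * s - s ^ 3 / 3 + s ^ 2 * s) = -(2 / 3 * s ^ 3) + -1 * (s * t ^ 2) by ring,
          Real.exp_add]
        ring
      _ ≤ s ^ δ * Real.exp (-(2 / 3 * s ^ 3)) * (2 * Real.exp (-(1 / 2) * (s * t ^ 2))) := by
        gcongr
      _ = _ := by
        rw [show -(1 / 2) * (s * t ^ 2) = -(s / 2) * (t - 0) ^ 2 by ring]; ring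

/-- The saddle s is now real and steepest descent crosses it at 45 degrees, so the path is the
diagonal t + i(t - s), which starts at -is. There is no exponential gain, only the Gaussian width
s^{-1/2}. -/
theorem exists_tendsto_airyPrimitive_neg_sq {δ s : ℝ} (hδ : |δ| ≤ 5 / 8) (hs : 1 ≤ s) :
    ∃ L : ℂ, Tendsto (fun R : ℝ => airyPrimitive δ (-s ^ 2) R) atTop (𝓝 L) ∧
      ‖L - airyPrimitive δ (-s ^ 2) (Complex.I * (-s : ℝ))‖ ≤
        2 * (4 * s ^ δ) * √(Real.pi / (s / 3)) := by
  have hδ' := abs_le.1 hδ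
  have hs0 : 0 < s := by linarith
  refine exists_tendsto_airyPrimitive (c := 1) (t₀ := s) hδ (by linarith) ?_ (by simp)
    (by linarith) (by positivity) fun t ht => ?_
  · filter_upwards [eventually_ge_atTop s] with R hR
    exact ⟨by linarith, by linarith⟩
  · have hz : Complex.I * ((-s : ℝ) : ℂ) + (1 + Complex.I * ((1 : ℝ) : ℂ)) * t =
        t + Complex.I * (t - s : ℝ) := by
      push_cast; ring
    have hre : ((t : ℂ) + Complex.I * (t - s : ℝ)).re = t := by simp
    have him : ((t : ℂ) + Complex.I * (t - s : ℝ)).im = t - s := by simp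
    rw [hz]
    set z := (t : ℂ) + Complex.I * (t - s : ℝ) with hzdef
    -- The real part t and |t - s| add up to at least s, so one of them is at least s/2. This
    -- controls negative powers of |z|.
    have hn1 : s / 2 ≤ ‖z‖ := by
      have h1 := Complex.abs_im_le_norm z
      have h2 := Complex.abs_re_le_norm z
      rw [hre] at h2
      rw [him] at h1
      have := neg_abs_le (t - s)
      have := le_abs_self t
      linarith
    have hn2 : ‖z‖ ≤ s + 2 * |t - s| := by
      refine (Complex.norm_le_abs_re_add_abs_im z).trans ?_
      rw [hre, him, abs_of_pos ht]
      have := le_abs_self (t - s)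
      linarith
    have hz0 : 0 < ‖z‖ := by linarith
    have h4 : 1 ≤ √s := Real.one_le_sqrt.2 hs
    have hq : ‖z‖ ^ δ ≤ s ^ δ * (3 + 2 * (√s * |t - s|)) := by
      have h2 : ‖z‖ = s * (‖z‖ / s) := by field_simp
      rw [h2, Real.mul_rpow hs0.le (by positivity)]
      refine mul_le_mul_of_nonneg_left ?_ (by positivity)
      refine (rpow_le_add_inv (by positivity) (by linarith)).trans ?_
      have h5 : (‖z‖ / s)⁻¹ ≤ 2 := by
        rw [inv_div, div_le_iff₀ hz0]; linarith
      have h6 : ‖z‖ / s ≤ 1 + 2 * |t - s| := by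
        rw [div_le_iff₀ hs0]
        nlinarith [abs_nonneg (t - s)]
      have h7 : |t - s| ≤ √s * |t - s| := le_mul_of_one_le_left (abs_nonneg _) h4
      linarith
    rw [norm_airyIntegrand _ _ (norm_pos_iff.1 hz0), hre, him]
    have h5 : (√s * |t - s|) ^ 2 = s * (t - s) ^ 2 := by
      rw [mul_pow, Real.sq_sqrt hs0.le, sq_abs]
    have h6 := linear_mul_exp_le (p := 3) (q := 2) (B := 4) (y := √s * |t - s|) (u := 4 / 3)
      (v := 1 / 3) (by nlinarith [sq_nonneg (√s * |t - s| - 1)]) (by norm_num)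
    rw [h5] at h6
    calc _ ≤ s ^ δ * (3 + 2 * (√s * |t - s|)) * Real.exp (-(4 / 3) * (s * (t - s) ^ 2)) := by
          gcongr
          -- The real part of the exponent is exactly -(4/3) s (t-s)² - (2/3) t (t-s)², and t > 0.
          nlinarith [mul_nonneg ht.le (sq_nonneg (t - s))]
      _ = s ^ δ * ((3 + 2 * (√s * |t - s|)) * Real.exp (-(4 / 3) * (s * (t - s) ^ 2))) := by ring
      _ ≤ s ^ δ * (4 * Real.exp (-(1 / 3) * (s * (t - s) ^ 2))) := by gcongr
      _ = _ := by
        rw [show -(1 / 3) * (s * (t - s) ^ 2) = -(s / 3) * (t - s) ^ 2 by ring]; ring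

theorem exists_tendsto_airyPrimitive_of_abs_le_one {δ x : ℝ} (hδ : |δ| ≤ 5 / 8) (hx : |x| ≤ 1) :
    ∃ L : ℂ, Tendsto (fun R : ℝ => airyPrimitive δ x R) atTop (𝓝 L) ∧
      ‖L‖ ≤ 2 * (2 * Real.exp 2) * √(Real.pi / (1 / 2)) + Real.exp 3 * gammaBound := by
  have hδ' := abs_le.1 hδ
  have hx' := abs_le.1 hx
  obtain ⟨L, hL, hL'⟩ := exists_tendsto_airyPrimitive (δ := δ) (x := x) (b := 1) (c := 0) (t₀ := 0)
    (β := 1 / 2) (A := 2 * Real.exp 2) hδ one_ne_zero (by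
      filter_upwards [eventually_ge_atTop 1] with R hR
      exact ⟨by linarith, by linarith⟩) (by simp) (by norm_num) (by positivity) (by
    intro t ht
    have hz : Complex.I * ((1 : ℝ) : ℂ) + (1 + Complex.I * ((0 : ℝ) : ℂ)) * t =
        t + Complex.I := by
      push_cast; ring
    have hre : ((t : ℂ) + Complex.I).re = t := by simp
    have him : ((t : ℂ) + Complex.I).im = 1 := by simp
    rw [hz]
    set z := (t : ℂ) + Complex.I with hzdef
    have hn1 : 1 ≤ ‖z‖ := by
      refine le_trans ?_ (Complex.abs_im_le_norm z)
      rw [him]; simp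
    have hn2 : ‖z‖ ≤ 1 + 1 * t := by
      refine (Complex.norm_le_abs_re_add_abs_im z).trans ?_
      rw [hre, him, abs_of_pos ht]; simp [add_comm]
    have hq : ‖z‖ ^ δ ≤ 1 + 1 * t := by
      calc ‖z‖ ^ δ ≤ ‖z‖ ^ (1 : ℝ) :=
            Real.rpow_le_rpow_of_exponent_le hn1 (by linarith)
        _ ≤ _ := by rwa [Real.rpow_one]
    rw [norm_airyIntegrand _ _ (norm_pos_iff.1 (by linarith)), hre, him]
    have h6 := linear_mul_exp_le (p := 1) (q := 1) (B := 2) (y := t) (u := 1) (v := 1 / 2)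
      (by nlinarith [sq_nonneg (t - 1)]) (by norm_num)
    calc _ ≤ (1 + 1 * t) * Real.exp (2 + -1 * t ^ 2) := by
          gcongr
          nlinarith
      _ = Real.exp 2 * ((1 + 1 * t) * Real.exp (-1 * t ^ 2)) := by
        rw [Real.exp_add]; ring
      _ ≤ Real.exp 2 * (2 * Real.exp (-(1 / 2) * t ^ 2)) := by gcongr
      _ = _ := by
        rw [sub_zero]; ring)
  refine ⟨L, hL, ?_⟩
  have h2 := norm_airyPrimitive_I_mul_le (x := x) (b := 1) (r := 1) (M := 3) hδ one_pos one_ne_zero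
    (by
      intro u hu
      have h1 : u ^ 3 ≤ 1 := pow_le_one₀ hu.1.le hu.2
      have h2 := hu.1
      have h3 := hu.2
      simp only [abs_one, mul_one]
      nlinarith)
  rw [Real.one_rpow, one_mul] at h2
  calc ‖L‖ = ‖(L - airyPrimitive δ x (Complex.I * (1 : ℝ))) +
        airyPrimitive δ x (Complex.I * (1 : ℝ))‖ := by rw [sub_add_cancel]
    _ ≤ _ := (norm_add_le _ _).trans (add_le_add hL' h2)

/-! ### Uniform bounds for Ai and Gi -/

theorem inv_pi_mul_le {y : ℝ} (hy : 0 ≤ y) : Real.pi⁻¹ * y ≤ y :=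
  mul_le_of_le_one_left hy (inv_le_one_of_one_le₀ (by linarith [Real.pi_gt_three]))

theorem norm_exp_phase_mul (δ : ℝ) (L : ℂ) :
    ‖Complex.exp (-(Complex.I * (δ * Real.pi / 2))) * L‖ = ‖L‖ := by
  rw [norm_mul, Complex.norm_exp]
  simp

theorem abs_genAi_le_norm {δ x : ℝ} {L : ℂ} (hδ : -1 < δ)
    (hL : Tendsto (fun R : ℝ => airyPrimitive δ x R) atTop (𝓝 L)) : |genAi δ x| ≤ ‖L‖ := by
  rw [genAi_eq_of_tendsto hδ hL, abs_mul, abs_of_pos (inv_pos.2 Real.pi_pos)]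
  refine (inv_pi_mul_le (abs_nonneg _)).trans ((Complex.abs_re_le_norm _).trans ?_)
  rw [norm_exp_phase_mul]

theorem abs_genGi_le_norm {δ x : ℝ} {L : ℂ} (hδ : -1 < δ)
    (hL : Tendsto (fun R : ℝ => airyPrimitive δ x R) atTop (𝓝 L)) : |genGi δ x| ≤ ‖L‖ := by
  rw [genGi_eq_of_tendsto hδ hL, abs_mul, abs_of_pos (inv_pos.2 Real.pi_pos)]
  refine (inv_pi_mul_le (abs_nonneg _)).trans ((Complex.abs_im_le_norm _).trans ?_)
  rw [norm_exp_phase_mul]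

/-- The column from 0 to is has zero real part after the phase rotation and may be subtracted for
free. This is what makes the decay of Ai exponential rather than algebraic. -/
theorem abs_genAi_le_norm_sub {δ x s : ℝ} {L : ℂ} (hδ : -1 < δ) (hs : 0 < s)
    (hL : Tendsto (fun R : ℝ => airyPrimitive δ x R) atTop (𝓝 L)) :
    |genAi δ x| ≤ ‖L - airyPrimitive δ x (Complex.I * s)‖ := by
  rw [genAi_eq_of_tendsto hδ hL, abs_mul, abs_of_pos (inv_pos.2 Real.pi_pos)]
  refine (inv_pi_mul_le (abs_nonneg _)).trans ?_
  rw [← norm_exp_phase_mul δ (L - _)]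
  refine le_trans (le_of_eq ?_) (Complex.abs_re_le_norm _)
  rw [mul_sub, Complex.sub_re, re_exp_mul_airyPrimitive_I_mul δ x hs, sub_zero]

theorem rpow_le_four_mul_one_add_rpow {x e : ℝ} (hx : 1 ≤ x) (he : |e| ≤ 2) :
    x ^ e ≤ 4 * (1 + x) ^ e := by
  have he' := abs_le.1 he
  rcases le_total 0 e with h | h
  · have h1 : x ^ e ≤ (1 + x) ^ e := by gcongr; linarith
    have h2 : 0 ≤ x ^ e := by positivity
    linarith
  · have h1 : (2 * x) ^ e ≤ (1 + x) ^ e :=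
      Real.rpow_le_rpow_of_nonpos (by linarith) (by linarith) h
    rw [Real.mul_rpow (by norm_num) (by linarith)] at h1
    have h2 : (1 / 4 : ℝ) ≤ 2 ^ e := by
      calc (1 / 4 : ℝ) = 2 ^ (-2 : ℝ) := by
            rw [Real.rpow_neg (by norm_num), Real.rpow_two]; norm_num
        _ ≤ _ := Real.rpow_le_rpow_of_exponent_le (by norm_num) he'.1
    have h3 : 0 ≤ x ^ e := by positivity
    nlinarith

theorem one_le_four_mul_one_add_rpow {x e : ℝ} (hx : 0 ≤ x) (hx1 : x ≤ 1) (he : |e| ≤ 2) :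
    1 ≤ 4 * (1 + x) ^ e := by
  have he' := abs_le.1 he
  rcases le_total 0 e with h | h
  · have := Real.one_le_rpow (show 1 ≤ 1 + x by linarith) h
    linarith
  · have h1 : (2 : ℝ) ^ e ≤ (1 + x) ^ e :=
      Real.rpow_le_rpow_of_nonpos (by linarith) (by linarith) h
    have h2 : (1 / 4 : ℝ) ≤ 2 ^ e := by
      calc (1 / 4 : ℝ) = 2 ^ (-2 : ℝ) := by
            rw [Real.rpow_neg (by norm_num), Real.rpow_two]; norm_num
        _ ≤ _ := Real.rpow_le_rpow_of_exponent_le (by norm_num) he'.1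
    linarith

theorem exp_two_thirds_bounds {x : ℝ} (hx : 0 ≤ x) (hx1 : x ≤ 1) :
    1 ≤ 3 * Real.exp (-(2 / 3 * x ^ (3 / 2 : ℝ))) := by
  have h1 : x ^ (3 / 2 : ℝ) ≤ 1 := Real.rpow_le_one hx hx1 (by norm_num)
  have h2 := Real.add_one_le_exp (-(2 / 3 * x ^ (3 / 2 : ℝ)))
  linarith

theorem sqrt_rpow_mul_sqrt {x δ c : ℝ} (hx : 0 < x) (hc : 0 < c) :
    √x ^ δ * √(Real.pi / (√x / c)) = √(c * Real.pi) * x ^ (δ / 2 - 1 / 4) := by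
  have h1 : √x = x ^ (1 / 2 : ℝ) := Real.sqrt_eq_rpow x
  rw [show Real.pi / (√x / c) = (c * Real.pi) / √x by
    have := Real.sqrt_pos.2 hx
    field_simp, Real.sqrt_div (by positivity), Real.sqrt_eq_rpow √x, h1, ← Real.rpow_mul hx.le,
    ← Real.rpow_mul hx.le, mul_div_left_comm, ← Real.rpow_sub hx]
  congr 2
  ring

theorem sqrt_pow_three {x : ℝ} (hx : 0 ≤ x) : √x ^ 3 = x ^ (3 / 2 : ℝ) := by
  rw [Real.sqrt_eq_rpow, ← Real.rpow_natCast, ← Real.rpow_mul hx]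
  norm_num

/-- The bound for the generalized Airy and Scorer functions on `[-1, 1]`. -/
def airyBoundNear : ℝ :=
  2 * (2 * Real.exp 2) * √(Real.pi / (1 / 2)) + Real.exp 3 * gammaBound

theorem airyBoundNear_pos : 0 < airyBoundNear := by
  have := gammaBound_pos
  unfold airyBoundNear
  positivity

theorem norm_sub_le_of_one_le {δ x : ℝ} (hδ : |δ| ≤ 5 / 8) (hx : 1 ≤ x) :
    ∃ L : ℂ, Tendsto (fun R : ℝ => airyPrimitive δ x R) atTop (𝓝 L) ∧
      ‖L - airyPrimitive δ x (Complex.I * (√x : ℝ))‖ ≤ 4 * √(2 * Real.pi) *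
        (x ^ (δ / 2 - 1 / 4) * Real.exp (-(2 / 3 * x ^ (3 / 2 : ℝ)))) := by
  have hx0 : 0 ≤ x := by linarith
  obtain ⟨L, hL, hL'⟩ := exists_tendsto_airyPrimitive_sq hδ (Real.one_le_sqrt.2 hx)
  rw [Real.sq_sqrt hx0] at hL hL'
  refine ⟨L, hL, hL'.trans (le_of_eq ?_)⟩
  rw [sqrt_pow_three hx0]
  linear_combination (4 * Real.exp (-(2 / 3 * x ^ (3 / 2 : ℝ)))) *
    sqrt_rpow_mul_sqrt (x := x) (δ := δ) (c := 2) (by linarith) two_pos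

theorem rpow_mul_exp_le_rpow {δ x : ℝ} (hδ : |δ| ≤ 5 / 8) (hx : 1 ≤ x) :
    x ^ (δ / 2 - 1 / 4) * Real.exp (-(2 / 3 * x ^ (3 / 2 : ℝ))) ≤ 9 * x ^ (-1 - δ) := by
  have hδ' := abs_le.1 hδ
  have hx0 : 0 < x := by linarith
  set y := x ^ (3 / 2 : ℝ) with hy
  have hy0 : 0 < y := by positivity
  have h1 : x ^ (δ / 2 - 1 / 4) ≤ x ^ (-1 - δ) * y ^ 2 := by
    rw [hy, ← Real.rpow_natCast, ← Real.rpow_mul hx0.le, ← Real.rpow_add hx0]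
    exact Real.rpow_le_rpow_of_exponent_le hx (by push_cast; linarith)
  have h2 : y ^ 2 * Real.exp (-(2 / 3 * y)) ≤ 9 := by
    have h3 := Real.add_one_le_exp (1 / 3 * y)
    have h4 : Real.exp (-(2 / 3 * y)) * (Real.exp (1 / 3 * y)) ^ 2 = 1 := by
      rw [← Real.exp_nat_mul, ← Real.exp_add]; ring_nf; exact Real.exp_zero
    have h5 : y ^ 2 ≤ 9 * Real.exp (1 / 3 * y) ^ 2 := by nlinarith
    calc _ ≤ 9 * Real.exp (1 / 3 * y) ^ 2 * Real.exp (-(2 / 3 * y)) := by gcongr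
      _ = 9 := by linear_combination 9 * h4
  calc _ ≤ x ^ (-1 - δ) * y ^ 2 * Real.exp (-(2 / 3 * y)) := by gcongr
    _ = x ^ (-1 - δ) * (y ^ 2 * Real.exp (-(2 / 3 * y))) := by ring
    _ ≤ x ^ (-1 - δ) * 9 := by gcongr
    _ = _ := by ring

/-- Since u³ ≤ u on (0, 1], the cubic term cancels at most a third of the linear one, which leaves
the rate r = 2x/3. -/
theorem norm_airyPrimitive_I_mul_sqrt_le {δ x : ℝ} (hδ : |δ| ≤ 5 / 8) (hx : 1 ≤ x) :
    ‖airyPrimitive δ x (Complex.I * (√x : ℝ))‖ ≤ 4 * gammaBound * x ^ (-1 - δ) := by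
  have hδ' := abs_le.1 hδ
  have hx0 : 0 < x := by linarith
  have hs := Real.sqrt_pos.2 hx0
  have hg := gammaBound_pos
  have h := norm_airyPrimitive_I_mul_le (δ := δ) (x := x) (b := √x) (r := 2 / 3 * x) (M := 0)
    hδ (by positivity) hs.ne' (by
      intro u hu
      rw [abs_of_pos hs]
      have h1 : √x ^ 2 = x := Real.sq_sqrt hx0.le
      have h2 : u ^ 3 ≤ u := by nlinarith [hu.1, hu.2, sq_nonneg u, mul_pos hu.1 hu.1]
      have h3 : 0 ≤ x * √x := by positivity
      have h4 : (u * √x) ^ 3 = u ^ 3 * (x * √x) := by rw [mul_pow, pow_succ √x, h1]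
      rw [h4]
      nlinarith)
  refine h.trans ?_
  rw [Real.exp_zero, one_mul, Real.mul_rpow (by norm_num) hx0.le]
  have h2 : (2 / 3 : ℝ) ^ (-1 - δ) ≤ 4 := by
    calc (2 / 3 : ℝ) ^ (-1 - δ) ≤ (2 / 3 : ℝ) ^ (-2 : ℝ) :=
          Real.rpow_le_rpow_of_exponent_ge (by norm_num) (by norm_num) (by linarith)
      _ ≤ 4 := by rw [Real.rpow_neg (by norm_num), Real.rpow_two]; norm_num
  calc _ ≤ 4 * x ^ (-1 - δ) * gammaBound := by gcongr
    _ = _ := by ring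

/-- The saddle gives |x|^{δ/2-1/4} and the column |x|^{-1-δ} ≤ 1. The exponent e stays free so that
one statement yields both e = 1/16 for every admissible δ and plain boundedness for δ ≤ 0. -/
theorem norm_le_of_le_neg_one {δ x e : ℝ} (hδ : |δ| ≤ 5 / 8) (hx : x ≤ -1) (he : 0 ≤ e)
    (he' : δ / 2 - 1 / 4 ≤ e) :
    ∃ L : ℂ, Tendsto (fun R : ℝ => airyPrimitive δ x R) atTop (𝓝 L) ∧
      ‖L‖ ≤ (8 * √(3 * Real.pi) + gammaBound) * (1 + -x) ^ e := by
  have hδ' := abs_le.1 hδ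
  have hx0 : 0 < -x := by linarith
  have hx1 : 1 ≤ -x := by linarith
  have hs := Real.sqrt_pos.2 hx0
  have hg := gammaBound_pos
  obtain ⟨L, hL, hL'⟩ := exists_tendsto_airyPrimitive_neg_sq hδ (Real.one_le_sqrt.2 hx1)
  rw [Real.sq_sqrt hx0.le, neg_neg] at hL hL'
  have h := norm_airyPrimitive_I_mul_le (δ := δ) (x := x) (b := -√(-x)) (r := -x) (M := 0)
    hδ hx0 (neg_ne_zero.2 hs.ne') (by
      intro u hu
      rw [abs_neg, abs_of_pos hs]
      have := hu.1
      have h3 : 0 ≤ (u * √(-x)) ^ 3 := by positivity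
      nlinarith)
  have h3 : 2 * (4 * √(-x) ^ δ) * √(Real.pi / (√(-x) / 3)) =
      8 * √(3 * Real.pi) * (-x) ^ (δ / 2 - 1 / 4) := by
    linear_combination 8 * sqrt_rpow_mul_sqrt (x := -x) (δ := δ) (c := 3) hx0 three_pos
  have h4 : (-x) ^ (δ / 2 - 1 / 4) ≤ (1 + -x) ^ e :=
    (Real.rpow_le_rpow_of_exponent_le hx1 he').trans
      (Real.rpow_le_rpow hx0.le (by linarith) he)
  have h5 : (-x) ^ (-1 - δ) ≤ (1 + -x) ^ e :=
    (Real.rpow_le_one_of_one_le_of_nonpos hx1 (by linarith)).trans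
      (Real.one_le_rpow (by linarith) he)
  refine ⟨L, hL, ?_⟩
  rw [h3] at hL'
  rw [Real.exp_zero, one_mul] at h
  calc ‖L‖ = ‖(L - airyPrimitive δ x (Complex.I * (-√(-x) : ℝ))) +
        airyPrimitive δ x (Complex.I * (-√(-x) : ℝ))‖ := by rw [sub_add_cancel]
    _ ≤ 8 * √(3 * Real.pi) * (-x) ^ (δ / 2 - 1 / 4) + (-x) ^ (-1 - δ) * gammaBound :=
        (norm_add_le _ _).trans (add_le_add hL' h)
    _ ≤ 8 * √(3 * Real.pi) * (1 + -x) ^ e + (1 + -x) ^ e * gammaBound := by gcongr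
    _ = _ := by ring

theorem exists_tendsto_airyPrimitive_limit {δ : ℝ} (hδ : |δ| ≤ 5 / 8) (x : ℝ) :
    ∃ L : ℂ, Tendsto (fun R : ℝ => airyPrimitive δ x R) atTop (𝓝 L) := by
  rcases le_total |x| 1 with h | h
  · exact (exists_tendsto_airyPrimitive_of_abs_le_one hδ h).imp fun _ h => h.1
  · rcases le_abs.1 h with h | h
    · exact (norm_sub_le_of_one_le hδ h).imp fun _ h => h.1
    · exact (norm_le_of_le_neg_one (e := 1) hδ (by linarith) zero_le_one
        (by linarith [(abs_le.1 hδ).2])).imp fun _ h => h.1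

/-- Exponential decay of `Ai_δ` on the positive half line. -/
theorem exists_abs_genAi_le : ∃ C : ℝ, 0 < C ∧ ∀ δ x : ℝ, |δ| ≤ 5 / 8 → 0 ≤ x →
    |genAi δ x| ≤ C * ((1 + x) ^ (δ / 2 - 1 / 4) * Real.exp (-(2 / 3 * x ^ (3 / 2 : ℝ)))) := by
  have hC := airyBoundNear_pos
  refine ⟨12 * airyBoundNear + 16 * √(2 * Real.pi), by positivity, fun δ x hδ hx => ?_⟩
  have hδ' := abs_le.1 hδ
  have he : |δ / 2 - 1 / 4| ≤ 2 := abs_le.2 ⟨by linarith, by linarith⟩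
  rcases le_total x 1 with h | h
  · obtain ⟨L, hL, hL'⟩ := exists_tendsto_airyPrimitive_of_abs_le_one hδ (x := x)
      (abs_le.2 ⟨by linarith, h⟩)
    have h1 := one_le_four_mul_one_add_rpow hx h he
    have h2 := exp_two_thirds_bounds hx h
    have h3 : 1 ≤ 12 * ((1 + x) ^ (δ / 2 - 1 / 4) *
        Real.exp (-(2 / 3 * x ^ (3 / 2 : ℝ)))) := by
      have := one_le_mul_of_one_le_of_one_le h1 h2
      linarith
    refine (abs_genAi_le_norm (by linarith) hL).trans (hL'.trans ?_)
    change airyBoundNear ≤ _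
    have h4 : 0 ≤ √(2 * Real.pi) := by positivity
    nlinarith
  · obtain ⟨L, hL, hL'⟩ := norm_sub_le_of_one_le hδ h
    refine (abs_genAi_le_norm_sub (by linarith) (Real.sqrt_pos.2 (by linarith)) hL).trans
      (hL'.trans ?_)
    calc _ ≤ 4 * √(2 * Real.pi) * (4 * (1 + x) ^ (δ / 2 - 1 / 4) *
          Real.exp (-(2 / 3 * x ^ (3 / 2 : ℝ)))) := by
          gcongr
          exact rpow_le_four_mul_one_add_rpow h he
      _ = 16 * √(2 * Real.pi) * ((1 + x) ^ (δ / 2 - 1 / 4) *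
          Real.exp (-(2 / 3 * x ^ (3 / 2 : ℝ)))) := by ring
      _ ≤ _ := by gcongr; linarith

/-- Algebraic decay of `Ai_δ` and `Gi_δ` on the positive half line. -/
theorem exists_abs_genAi_genGi_le_of_nonneg : ∃ C : ℝ, 0 < C ∧ ∀ δ x : ℝ, |δ| ≤ 5 / 8 → 0 ≤ x →
    |genAi δ x| ≤ C * (1 + x) ^ (-1 - δ) ∧ |genGi δ x| ≤ C * (1 + x) ^ (-1 - δ) := by
  have hC := airyBoundNear_pos
  have hg := gammaBound_pos
  refine ⟨4 * airyBoundNear + 16 * (9 * √(2 * Real.pi) + gammaBound), by positivity,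
    fun δ x hδ hx => ?_⟩
  have hδ' := abs_le.1 hδ
  have he : |-1 - δ| ≤ 2 := abs_le.2 ⟨by linarith, by linarith⟩
  obtain ⟨L, hL, hL'⟩ : ∃ L : ℂ, Tendsto (fun R : ℝ => airyPrimitive δ x R) atTop (𝓝 L) ∧
      ‖L‖ ≤ (4 * airyBoundNear + 16 * (9 * √(2 * Real.pi) + gammaBound)) *
        (1 + x) ^ (-1 - δ) := by
    rcases le_total x 1 with h | h
    · obtain ⟨L, hL, hL'⟩ := exists_tendsto_airyPrimitive_of_abs_le_one hδ (x := x)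
        (abs_le.2 ⟨by linarith, h⟩)
      have h1 := one_le_four_mul_one_add_rpow hx h he
      refine ⟨L, hL, hL'.trans ?_⟩
      calc airyBoundNear ≤ airyBoundNear * (4 * (1 + x) ^ (-1 - δ)) :=
            le_mul_of_one_le_right hC.le h1
        _ = 4 * airyBoundNear * (1 + x) ^ (-1 - δ) := by ring
        _ ≤ _ := by gcongr; exact le_add_of_nonneg_right (by positivity)
    · obtain ⟨L, hL, hL'⟩ := norm_sub_le_of_one_le hδ h
      refine ⟨L, hL, ?_⟩
      have h1 := rpow_le_four_mul_one_add_rpow h he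
      calc ‖L‖ = ‖(L - airyPrimitive δ x (Complex.I * (√x : ℝ))) +
            airyPrimitive δ x (Complex.I * (√x : ℝ))‖ := by rw [sub_add_cancel]
        _ ≤ 4 * √(2 * Real.pi) * (9 * x ^ (-1 - δ)) + 4 * gammaBound * x ^ (-1 - δ) := by
            refine (norm_add_le _ _).trans (add_le_add (hL'.trans ?_)
              (norm_airyPrimitive_I_mul_sqrt_le hδ h))
            exact mul_le_mul_of_nonneg_left (rpow_mul_exp_le_rpow hδ h) (by positivity)
        _ = 4 * (9 * √(2 * Real.pi) + gammaBound) * x ^ (-1 - δ) := by ring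
        _ ≤ 4 * (9 * √(2 * Real.pi) + gammaBound) * (4 * (1 + x) ^ (-1 - δ)) := by gcongr
        _ = 16 * (9 * √(2 * Real.pi) + gammaBound) * (1 + x) ^ (-1 - δ) := by ring
        _ ≤ _ := by gcongr; linarith
  exact ⟨(abs_genAi_le_norm (by linarith) hL).trans hL',
    (abs_genGi_le_norm (by linarith) hL).trans hL'⟩

/-- Bounds for `Ai_δ` and `Gi_δ` on the negative half line. -/
theorem exists_abs_genAi_genGi_le : ∃ C : ℝ, 0 < C ∧ ∀ δ x e : ℝ, |δ| ≤ 5 / 8 → x ≤ 0 → 0 ≤ e →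
    δ / 2 - 1 / 4 ≤ e → |genAi δ x| ≤ C * (1 + -x) ^ e ∧ |genGi δ x| ≤ C * (1 + -x) ^ e := by
  have hC := airyBoundNear_pos
  have hg := gammaBound_pos
  refine ⟨airyBoundNear + (8 * √(3 * Real.pi) + gammaBound), by positivity,
    fun δ x e hδ hx he he' => ?_⟩
  have hδ' := abs_le.1 hδ
  have h1 : 1 ≤ (1 + -x) ^ e := Real.one_le_rpow (by linarith) he
  obtain ⟨L, hL, hL'⟩ : ∃ L : ℂ, Tendsto (fun R : ℝ => airyPrimitive δ x R) atTop (𝓝 L) ∧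
      ‖L‖ ≤ (airyBoundNear + (8 * √(3 * Real.pi) + gammaBound)) * (1 + -x) ^ e := by
    rcases le_total (-1) x with h | h
    · obtain ⟨L, hL, hL'⟩ := exists_tendsto_airyPrimitive_of_abs_le_one hδ (x := x)
        (abs_le.2 ⟨h, by linarith⟩)
      refine ⟨L, hL, hL'.trans ?_⟩
      calc airyBoundNear ≤ airyBoundNear * (1 + -x) ^ e := le_mul_of_one_le_right hC.le h1
        _ ≤ _ := by gcongr; exact le_add_of_nonneg_right (by positivity)
    · obtain ⟨L, hL, hL'⟩ := norm_le_of_le_neg_one hδ h he he'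
      refine ⟨L, hL, hL'.trans ?_⟩
      exact mul_le_mul_of_nonneg_right (le_add_of_nonneg_left hC.le) (by linarith)
  exact ⟨(abs_genAi_le_norm (by linarith) hL).trans hL',
    (abs_genGi_le_norm (by linarith) hL).trans hL'⟩

/-! ### Measurability of the special functions -/

theorem measurable_intervalIntegral_of_measurable {F : ℝ → ℝ → ℝ}
    (hF : Measurable (Function.uncurry F)) {R : ℝ} (hR : 0 ≤ R) :
    Measurable fun x => ∫ σ in (0 : ℝ)..R, F x σ := by
  simp only [intervalIntegral.integral_of_le hR]
  exact (hF.stronglyMeasurable.integral_prod_right).measurable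

theorem measurable_genAi {δ : ℝ} (hδ : |δ| ≤ 5 / 8) : Measurable (genAi δ) := by
  have hδ' := abs_le.1 hδ
  refine Measurable.const_mul ?_ _
  refine measurable_of_tendsto_metrizable (f := fun (n : ℕ) x => ∫ σ in (0 : ℝ)..n,
    σ ^ δ * Real.cos (σ ^ 3 / 3 + x * σ - δ * Real.pi / 2)) (fun n => ?_) ?_
  · exact measurable_intervalIntegral_of_measurable (by unfold Function.uncurry; fun_prop)
      n.cast_nonneg
  · refine tendsto_pi_nhds.2 fun x => ?_
    obtain ⟨L, hL⟩ := exists_tendsto_airyPrimitive_limit hδ x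
    exact (tendsto_nhds_limUnder ⟨_, tendsto_integral_cos_of_tendsto (by linarith) hL⟩).comp
      tendsto_natCast_atTop_atTop

theorem measurable_genGi {δ : ℝ} (hδ : |δ| ≤ 5 / 8) : Measurable (genGi δ) := by
  have hδ' := abs_le.1 hδ
  refine Measurable.const_mul ?_ _
  refine measurable_of_tendsto_metrizable (f := fun (n : ℕ) x => ∫ σ in (0 : ℝ)..n,
    σ ^ δ * Real.sin (σ ^ 3 / 3 + x * σ - δ * Real.pi / 2)) (fun n => ?_) ?_
  · exact measurable_intervalIntegral_of_measurable (by unfold Function.uncurry; fun_prop)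
      n.cast_nonneg
  · refine tendsto_pi_nhds.2 fun x => ?_
    obtain ⟨L, hL⟩ := exists_tendsto_airyPrimitive_limit hδ x
    exact (tendsto_nhds_limUnder ⟨_, tendsto_integral_sin_of_tendsto (by linarith) hL⟩).comp
      tendsto_natCast_atTop_atTop

theorem measurable_genHi (δ : ℝ) : Measurable (genHi δ) := by
  refine Measurable.const_mul ?_ _
  have hF : Measurable (Function.uncurry fun x σ : ℝ =>
    σ ^ δ * Real.exp (-(σ ^ 3 / 3) + σ * x)) := by unfold Function.uncurry; fun_prop
  exact (hF.stronglyMeasurable.integral_prod_right).measurable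

/-! ### Laplace bounds for Hi -/

theorem genHi_nonneg (δ x : ℝ) : 0 ≤ genHi δ x := by
  refine mul_nonneg (inv_nonneg.2 Real.pi_pos.le) (setIntegral_nonneg measurableSet_Ioi ?_)
  intro σ hσ
  have := Real.rpow_nonneg (le_of_lt hσ) δ
  positivity

theorem genHi_le_integral {δ x : ℝ} {g : ℝ → ℝ} (hg : IntegrableOn g (Ioi 0))
    (h : ∀ σ : ℝ, 0 < σ → σ ^ δ * Real.exp (-(σ ^ 3 / 3) + σ * x) ≤ g σ) :
    genHi δ x ≤ ∫ σ in Ioi (0 : ℝ), g σ := by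
  have h0 : ∀ σ : ℝ, 0 < σ → 0 ≤ σ ^ δ * Real.exp (-(σ ^ 3 / 3) + σ * x) := fun σ hσ => by
    positivity
  refine (inv_pi_mul_le (setIntegral_nonneg measurableSet_Ioi h0)).trans ?_
  refine integral_mono_of_nonneg ?_ hg ?_
  · filter_upwards [ae_restrict_mem measurableSet_Ioi] with σ hσ using h0 σ hσ
  · filter_upwards [ae_restrict_mem measurableSet_Ioi] with σ hσ using h σ hσ

theorem genHi_le_of_le_one {δ x : ℝ} (hδ : |δ| ≤ 5 / 8) (hx : x ≤ 1) :
    genHi δ x ≤ Real.exp 2 * gammaBound := by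
  have hδ' := abs_le.1 hδ
  have hi := (integrableOn_rpow_mul_exp (δ := δ) (by linarith) one_pos).const_mul (Real.exp 2)
  refine (genHi_le_integral hi fun σ hσ => ?_).trans ?_
  · rw [mul_left_comm, ← Real.exp_add]
    refine mul_le_mul_of_nonneg_left (Real.exp_le_exp.2 ?_) (by positivity)
    -- The claim reduces to 2σ - σ³/3 ≤ 2; 10/7 approximates the maximiser √2.
    nlinarith [mul_nonneg hσ.le (sq_nonneg (σ - 10 / 7)), sq_nonneg (σ - 10 / 7),
      mul_le_mul_of_nonneg_left hx hσ.le]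
  · rw [integral_const_mul]
    gcongr
    simpa using integral_rpow_mul_exp_le hδ one_pos

/-- Algebraic decay of `Hi_δ` on the negative half line. -/
theorem exists_genHi_le_of_nonpos : ∃ C : ℝ, 0 < C ∧ ∀ δ x : ℝ, |δ| ≤ 5 / 8 → x ≤ 0 →
    genHi δ x ≤ C * (1 + -x) ^ (-(3 / 8) : ℝ) := by
  have hg := gammaBound_pos
  refine ⟨4 * Real.exp 2 * gammaBound, by positivity, fun δ x hδ hx => ?_⟩
  have hδ' := abs_le.1 hδ
  have he : |(-(3 / 8) : ℝ)| ≤ 2 := by rw [abs_neg, abs_of_pos] <;> norm_num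
  rcases le_total (-1) x with h | h
  · refine (genHi_le_of_le_one hδ (by linarith)).trans ?_
    have h1 := one_le_four_mul_one_add_rpow (x := -x) (by linarith) (by linarith) he
    calc _ ≤ Real.exp 2 * gammaBound * (4 * (1 + -x) ^ (-(3 / 8) : ℝ)) :=
          le_mul_of_one_le_right (by positivity) h1
      _ = _ := by ring
  · have hi := integrableOn_rpow_mul_exp (δ := δ) (r := -x) (by linarith) (by linarith)
    refine (genHi_le_integral hi fun σ hσ => ?_).trans
      ((integral_rpow_mul_exp_le hδ (by linarith)).trans ?_)
    · gcongr
      have : 0 ≤ σ ^ 3 := by positivity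
      linarith
    · have h1 := rpow_le_four_mul_one_add_rpow (x := -x) (by linarith) he
      have h2 : (-x) ^ (-1 - δ) ≤ (-x) ^ (-(3 / 8) : ℝ) :=
        Real.rpow_le_rpow_of_exponent_le (by linarith) (by linarith)
      have h3 : 1 ≤ Real.exp 2 := Real.one_le_exp (by norm_num)
      calc _ ≤ 4 * (1 + -x) ^ (-(3 / 8) : ℝ) * gammaBound := by gcongr; exact h2.trans h1
        _ ≤ 4 * (1 + -x) ^ (-(3 / 8) : ℝ) * gammaBound * Real.exp 2 :=
          le_mul_of_one_le_right (mul_nonneg (mul_nonneg (by norm_num)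
            (Real.rpow_nonneg (by linarith) _)) hg.le) h3
        _ = _ := by ring

theorem integral_rpow_neg_Ioc {s : ℝ} (hs : 0 < s) :
    ∫ σ in Ioc (0 : ℝ) s, (σ / s) ^ (-(5 / 8) : ℝ) = 8 / 3 * s := by
  rw [← intervalIntegral.integral_of_le hs.le,
    intervalIntegral.integral_comp_div (fun q => q ^ (-(5 / 8) : ℝ)) hs.ne',
    integral_rpow (Or.inl (by norm_num)), zero_div, div_self hs.ne', Real.one_rpow,
    Real.zero_rpow (by norm_num), smul_eq_mul]
  ring

/-- Laplace's method at σ = s: the exponent equals (2/3)s³ - (σ-s)²(σ+2s)/3, at most (2/3)s³ -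
(2/3)s(σ-s)². For σ ≥ s/2 the factor (σ/s)^δ is absorbed by the Gaussian. For σ ≤ s/2 the possible
singularity at 0 is kept as (σ/s)^{-5/8}, which is integrable and carries the small factor
exp(-s³/6). -/
theorem genHi_sq_le {δ s : ℝ} (hδ : |δ| ≤ 5 / 8) (hs : 1 ≤ s) :
    genHi δ (s ^ 2) ≤ (8 * √(3 * Real.pi) + 16) *
      (s ^ δ * √(s⁻¹) * Real.exp (2 / 3 * s ^ 3)) := by
  have hδ' := abs_le.1 hδ
  have hs0 : 0 < s := by linarith
  have hi1 : Integrable (fun σ : ℝ => 8 * Real.exp (-(s / 3) * (σ - s) ^ 2)) :=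
    ((integrable_exp_neg_mul_sq (show 0 < s / 3 by positivity)).comp_sub_right s).const_mul 8
  have hi2 : Integrable ((Ioc 0 s).indicator fun σ : ℝ =>
      Real.exp (-(s ^ 3 / 6)) * (σ / s) ^ (-(5 / 8) : ℝ)) := by
    rw [integrable_indicator_iff measurableSet_Ioc]
    refine Integrable.const_mul ?_ _
    have h1 : IntervalIntegrable (fun q : ℝ => q ^ (-(5 / 8) : ℝ)) volume 0 1 :=
      intervalIntegral.intervalIntegrable_rpow' (by norm_num)
    have h2 := h1.comp_mul_right (c := s⁻¹)
    rw [zero_div, one_div, inv_inv, intervalIntegrable_iff_integrableOn_Ioc_of_le hs0.le] at h2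
    exact h2
  have hn2 : ∀ σ, 0 ≤ (Ioc 0 s).indicator (fun σ : ℝ =>
      Real.exp (-(s ^ 3 / 6)) * (σ / s) ^ (-(5 / 8) : ℝ)) σ := by
    refine fun σ => indicator_nonneg (fun σ hσ => ?_) σ
    have := hσ.1
    positivity
  refine (genHi_le_integral (g := fun σ => s ^ δ * Real.exp (2 / 3 * s ^ 3) *
    (8 * Real.exp (-(s / 3) * (σ - s) ^ 2) + (Ioc 0 s).indicator (fun σ : ℝ =>
      Real.exp (-(s ^ 3 / 6)) * (σ / s) ^ (-(5 / 8) : ℝ)) σ))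
    ((hi1.add hi2).const_mul _).integrableOn fun σ hσ => ?_).trans ?_
  · have hq : 0 < σ / s := by positivity
    have hσs : σ ^ δ = s ^ δ * (σ / s) ^ δ := by
      rw [← Real.mul_rpow hs0.le hq.le]; congr 1; field_simp
    have hexp : Real.exp (-(σ ^ 3 / 3) + σ * s ^ 2) ≤
        Real.exp (2 / 3 * s ^ 3) * Real.exp (-(2 / 3) * (s * (σ - s) ^ 2)) := by
      rw [← Real.exp_add]
      refine Real.exp_le_exp.2 ?_
      nlinarith [mul_nonneg hσ.le (sq_nonneg (σ - s))]
    rw [hσs]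
    have key : (σ / s) ^ δ * Real.exp (-(2 / 3) * (s * (σ - s) ^ 2)) ≤
        8 * Real.exp (-(s / 3) * (σ - s) ^ 2) + (Ioc 0 s).indicator (fun σ : ℝ =>
      Real.exp (-(s ^ 3 / 6)) * (σ / s) ^ (-(5 / 8) : ℝ)) σ := by
      rcases le_total (σ / s) (1 / 2) with h | h
      · have h1 : σ ≤ s / 2 := by rw [div_le_iff₀ hs0] at h; linarith
        rw [indicator_of_mem (show σ ∈ Ioc 0 s from ⟨hσ, by linarith⟩)]
        refine le_add_of_nonneg_of_le (by positivity) ?_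
        rw [mul_comm]
        refine mul_le_mul (Real.exp_le_exp.2 ?_)
          (Real.rpow_le_rpow_of_exponent_ge hq (by linarith) (by linarith))
          (by positivity) (by positivity)
        -- The distance to the peak is at least s/2, and (2/3) s (s/2)² = s³/6.
        have h2 : (s / 2) ^ 2 ≤ (σ - s) ^ 2 := by nlinarith
        nlinarith
      · refine (le_add_of_nonneg_right (hn2 σ)).trans' ?_
        have h4 : 1 ≤ √s := Real.one_le_sqrt.2 hs
        have h5 : (√s * |σ - s|) ^ 2 = s * (σ - s) ^ 2 := by
          rw [mul_pow, Real.sq_sqrt hs0.le, sq_abs]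
        have h6 := linear_mul_exp_le (p := 3) (q := 1) (B := 8) (y := √s * |σ - s|) (u := 2 / 3)
          (v := 1 / 3) (by nlinarith [sq_nonneg (√s * |σ - s| - 1)]) (by norm_num)
        rw [h5] at h6
        have h7 : (σ / s) ^ δ ≤ 3 + 1 * (√s * |σ - s|) := by
          refine (rpow_le_add_inv hq (by linarith)).trans ?_
          have h8 : (σ / s)⁻¹ ≤ 2 := inv_le_of_inv_le₀ two_pos (by linarith)
          have h9 : σ / s ≤ 1 + |σ - s| := by
            rw [div_le_iff₀ hs0]
            nlinarith [abs_nonneg (σ - s), le_abs_self (σ - s)]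
          have h7 : |σ - s| ≤ √s * |σ - s| := le_mul_of_one_le_left (abs_nonneg _) h4
          linarith
        calc _ ≤ (3 + 1 * (√s * |σ - s|)) * Real.exp (-(2 / 3) * (s * (σ - s) ^ 2)) := by gcongr
          _ ≤ _ := h6
          _ = _ := by ring_nf
    calc _ ≤ s ^ δ * (σ / s) ^ δ * (Real.exp (2 / 3 * s ^ 3) *
          Real.exp (-(2 / 3) * (s * (σ - s) ^ 2))) := by gcongr
      _ = s ^ δ * Real.exp (2 / 3 * s ^ 3) *
          ((σ / s) ^ δ * Real.exp (-(2 / 3) * (s * (σ - s) ^ 2))) := by ring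
      _ ≤ _ := by gcongr
  · rw [integral_const_mul]
    have h1 : ∫ σ in Ioi (0 : ℝ), (8 * Real.exp (-(s / 3) * (σ - s) ^ 2) +
        (Ioc 0 s).indicator (fun σ : ℝ =>
          Real.exp (-(s ^ 3 / 6)) * (σ / s) ^ (-(5 / 8) : ℝ)) σ) ≤
        8 * √(Real.pi / (s / 3)) + Real.exp (-(s ^ 3 / 6)) * (8 / 3 * s) := by
      refine (setIntegral_le_integral (hi1.add hi2)
        (Eventually.of_forall fun σ => add_nonneg (by positivity) (hn2 σ))).trans (le_of_eq ?_)
      simp only [Pi.add_apply]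
      rw [integral_add hi1 hi2, integral_const_mul,
        integral_sub_right_eq_self (fun t : ℝ => Real.exp (-(s / 3) * t ^ 2)), integral_gaussian,
        integral_indicator measurableSet_Ioc, integral_const_mul, integral_rpow_neg_Ioc hs0]
    have h2 : √(Real.pi / (s / 3)) = √(3 * Real.pi) * √(s⁻¹) := by
      rw [← Real.sqrt_mul (by positivity)]; congr 1; field_simp
    have h3 : Real.exp (-(s ^ 3 / 6)) * (8 / 3 * s) ≤ 16 * √(s⁻¹) := by
      have h4 : s⁻¹ ≤ √(s⁻¹) := by
        refine Real.le_sqrt_of_sq_le ?_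
        have : s⁻¹ ≤ 1 := inv_le_one_of_one_le₀ hs
        have : 0 ≤ s⁻¹ := by positivity
        nlinarith
      have h5 := Real.add_one_le_exp (s ^ 3 / 6)
      have h6 : Real.exp (-(s ^ 3 / 6)) ≤ 6 / s ^ 3 := by
        rw [Real.exp_neg, inv_le_comm₀ (Real.exp_pos _) (by positivity), inv_div]
        linarith
      calc _ ≤ 6 / s ^ 3 * (8 / 3 * s) := by gcongr
        _ = 16 * (s⁻¹ * s⁻¹) := by field_simp; norm_num
        _ ≤ 16 * (√(s⁻¹) * 1) := by
          gcongr
          exact inv_le_one_of_one_le₀ hs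
        _ = _ := by ring
    calc _ ≤ s ^ δ * Real.exp (2 / 3 * s ^ 3) *
        (8 * (√(3 * Real.pi) * √(s⁻¹)) + 16 * √(s⁻¹)) := by
          gcongr
          exact h1.trans (by rw [h2]; gcongr)
      _ = _ := by ring

/-- Exponential growth bound for `Hi_δ` on the positive half line. -/
theorem exists_genHi_le_of_nonneg : ∃ C : ℝ, 0 < C ∧ ∀ δ x : ℝ, |δ| ≤ 5 / 8 → 0 ≤ x →
    genHi δ x ≤ C * ((1 + x) ^ (δ / 2 - 1 / 4) * Real.exp (2 / 3 * x ^ (3 / 2 : ℝ))) := by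
  have hg := gammaBound_pos
  refine ⟨4 * Real.exp 2 * gammaBound + 4 * (8 * √(3 * Real.pi) + 16), by positivity,
    fun δ x hδ hx => ?_⟩
  have hδ' := abs_le.1 hδ
  have he : |δ / 2 - 1 / 4| ≤ 2 := abs_le.2 ⟨by linarith, by linarith⟩
  rcases le_total x 1 with h | h
  · refine (genHi_le_of_le_one hδ h).trans ?_
    have h1 := one_le_four_mul_one_add_rpow hx h he
    have h2 : 1 ≤ Real.exp (2 / 3 * x ^ (3 / 2 : ℝ)) := Real.one_le_exp (by positivity)
    calc _ ≤ Real.exp 2 * gammaBound * (4 * (1 + x) ^ (δ / 2 - 1 / 4) *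
          Real.exp (2 / 3 * x ^ (3 / 2 : ℝ))) :=
          le_mul_of_one_le_right (by positivity) (one_le_mul_of_one_le_of_one_le h1 h2)
      _ = 4 * Real.exp 2 * gammaBound * ((1 + x) ^ (δ / 2 - 1 / 4) *
          Real.exp (2 / 3 * x ^ (3 / 2 : ℝ))) := by ring
      _ ≤ _ := by gcongr; exact le_add_of_nonneg_right (by positivity)
  · have h1 := genHi_sq_le hδ (Real.one_le_sqrt.2 h)
    have hx0 : 0 < x := by linarith
    have h2 : √x ^ δ * √((√x)⁻¹) = x ^ (δ / 2 - 1 / 4) := by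
      rw [Real.sqrt_eq_rpow x, Real.sqrt_eq_rpow (_⁻¹), ← Real.rpow_neg hx0.le,
        ← Real.rpow_mul hx0.le, ← Real.rpow_mul hx0.le, ← Real.rpow_add hx0]
      congr 1
      ring
    rw [Real.sq_sqrt hx, sqrt_pow_three hx, h2] at h1
    refine h1.trans ?_
    calc _ ≤ (8 * √(3 * Real.pi) + 16) * (4 * (1 + x) ^ (δ / 2 - 1 / 4) *
          Real.exp (2 / 3 * x ^ (3 / 2 : ℝ))) := by
          gcongr
          exact rpow_le_four_mul_one_add_rpow h he
      _ = 4 * (8 * √(3 * Real.pi) + 16) * ((1 + x) ^ (δ / 2 - 1 / 4) *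
          Real.exp (2 / 3 * x ^ (3 / 2 : ℝ))) := by ring
      _ ≤ _ := by gcongr; exact le_add_of_nonneg_left (by positivity)

/-- One constant for everything the kernel needs. The range |δ| ≤ 5/8 covers both γ and -γ; 1/16 is
the largest value of δ/2 - 1/4 on it, and 3/8 the smallest value of 1 + δ. -/
theorem exists_airy_bounds : ∃ C : ℝ, 0 < C ∧ ∀ δ : ℝ, |δ| ≤ 5 / 8 →
    (∀ x : ℝ, 0 ≤ x →
      |genAi δ x| ≤ C * ((1 + x) ^ (δ / 2 - 1 / 4) * Real.exp (-(2 / 3 * x ^ (3 / 2 : ℝ)))) ∧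
      genHi δ x ≤ C * ((1 + x) ^ (δ / 2 - 1 / 4) * Real.exp (2 / 3 * x ^ (3 / 2 : ℝ))) ∧
      |genAi δ x| + |genGi δ x| ≤ C * (1 + x) ^ (-1 - δ)) ∧
    (∀ x : ℝ, x ≤ 0 →
      genHi δ x ≤ C * (1 + -x) ^ (-(3 / 8) : ℝ) ∧
      |genAi δ x| + |genGi δ x| ≤ C * (1 + -x) ^ (1 / 16 : ℝ) ∧
      (δ ≤ 0 → |genAi δ x| + |genGi δ x| ≤ C)) := by
  obtain ⟨C₁, h₁, H₁⟩ := exists_abs_genAi_le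
  obtain ⟨C₂, h₂, H₂⟩ := exists_abs_genAi_genGi_le_of_nonneg
  obtain ⟨C₃, h₃, H₃⟩ := exists_abs_genAi_genGi_le
  obtain ⟨C₄, h₄, H₄⟩ := exists_genHi_le_of_nonpos
  obtain ⟨C₅, h₅, H₅⟩ := exists_genHi_le_of_nonneg
  have key : ∀ {c t u : ℝ}, t ≤ c * u → 0 ≤ u → c ≤ C₁ + 2 * C₂ + 2 * C₃ + C₄ + C₅ →
      t ≤ (C₁ + 2 * C₂ + 2 * C₃ + C₄ + C₅) * u := fun h hu hc =>
    h.trans (mul_le_mul_of_nonneg_right hc hu)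
  refine ⟨C₁ + 2 * C₂ + 2 * C₃ + C₄ + C₅, by positivity, fun δ hδ => ⟨fun x hx => ⟨?_, ?_, ?_⟩,
    fun x hx => ⟨?_, ?_, fun hδ0 => ?_⟩⟩⟩
  · exact key (H₁ δ x hδ hx) (by positivity) (by linarith)
  · exact key (H₅ δ x hδ hx) (by positivity) (by linarith)
  · refine key (c := 2 * C₂) ?_ (by positivity) (by linarith)
    have := H₂ δ x hδ hx
    linarith
  · exact key (H₄ δ x hδ hx) (Real.rpow_nonneg (by linarith) _) (by linarith)
  · refine key (c := 2 * C₃) ?_ (Real.rpow_nonneg (by linarith) _) (by linarith)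
    have := H₃ δ x (1 / 16) hδ hx (by norm_num) (by linarith [(abs_le.1 hδ).2])
    linarith
  · have := H₃ δ x 0 hδ hx le_rfl (by linarith)
    rw [Real.rpow_zero] at this
    linarith

/-! ### Pointwise bounds for the Green kernel -/

theorem abs_greenKernel_of_lt {a γ x y : ℝ} (ha : 0 < a) (h : x < y) :
    |greenKernel a γ x y| =
      Real.pi * a ^ (-(1 / 3) : ℝ) * (|genAi (-γ) (rescale a y)| * genHi γ (rescale a x)) := by
  rw [greenKernel, if_neg ha.ne', if_pos h, abs_mul,
    abs_of_pos (mul_pos Real.pi_pos (Real.rpow_pos_of_pos ha _)), abs_mul,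
    abs_of_nonneg (genHi_nonneg _ _)]

theorem abs_greenKernel_le_of_le {a γ x y : ℝ} (ha : 0 < a) (h : y ≤ x) :
    |greenKernel a γ x y| ≤
      Real.pi * a ^ (-(1 / 3) : ℝ) * (genHi (-γ) (rescale a y) * |genAi γ (rescale a x)| +
        (|genAi (-γ) (rescale a y)| + |genGi (-γ) (rescale a y)|) *
          (|genAi γ (rescale a x)| + |genGi γ (rescale a x)|)) := by
  rw [greenKernel, if_neg ha.ne', if_neg h.not_gt, abs_mul,
    abs_of_pos (mul_pos Real.pi_pos (Real.rpow_pos_of_pos ha _))]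
  refine mul_le_mul_of_nonneg_left ?_
    (mul_pos Real.pi_pos (Real.rpow_pos_of_pos ha _)).le
  set A := genAi (-γ) (rescale a y)
  set G := genGi (-γ) (rescale a y)
  set A' := genAi γ (rescale a x)
  set G' := genGi γ (rescale a x)
  have h1 : |genHi (-γ) (rescale a y) * A'| = genHi (-γ) (rescale a y) * |A'| := by
    rw [abs_mul, abs_of_nonneg (genHi_nonneg _ _)]
  have h2 : |Real.sin (γ * Real.pi) * (G * G' + A * A')| ≤ |G| * |G'| + |A| * |A'| := by
    rw [abs_mul]
    calc _ ≤ 1 * (|G * G'| + |A * A'|) := by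
          gcongr
          · exact Real.abs_sin_le_one _
          · exact abs_add_le _ _
      _ = _ := by rw [one_mul, abs_mul, abs_mul]
  have h3 : |Real.cos (γ * Real.pi) * (A * G' - G * A')| ≤ |A| * |G'| + |G| * |A'| := by
    rw [abs_mul]
    calc _ ≤ 1 * (|A * G'| + |G * A'|) := by
          gcongr
          · exact Real.abs_cos_le_one _
          · exact abs_sub _ _
      _ = _ := by rw [one_mul, abs_mul, abs_mul]
  calc _ ≤ |genHi (-γ) (rescale a y) * A'| + |Real.sin (γ * Real.pi) * (G * G' + A * A')| +
        |Real.cos (γ * Real.pi) * (A * G' - G * A')| :=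
        (abs_sub _ _).trans (add_le_add_left (abs_sub _ _) _)
    _ ≤ _ := by rw [h1]; linarith

theorem rescale_eq {a : ℝ} (ha : 0 < a) (x : ℝ) :
    rescale a x = a ^ (-(2 / 3) : ℝ) * (1 + a * x) := by
  have h : a ^ (1 / 3 : ℝ) = a ^ (-(2 / 3) : ℝ) * a := by
    rw [← Real.rpow_add_one ha.ne']; norm_num
  rw [rescale, h]
  field_simp
  ring

/-- The quantity `a^{2/3} (1 + x̂)`, which stays comparable to `1` near `x = 0`. -/
def shiftedScale (a x : ℝ) : ℝ := a ^ (2 / 3 : ℝ) + (1 + a * x)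

/-- The exponent `(1 - (1 + a x)^{3/2}) / a`; both weights are exponentials of multiples of it
on `[-1/a, 0]`. -/
def decayExponent (a x : ℝ) : ℝ := a⁻¹ * (1 - (1 + a * x) ^ (3 / 2 : ℝ))

theorem one_add_rescale {a : ℝ} (ha : 0 < a) (x : ℝ) :
    1 + rescale a x = a ^ (-(2 / 3) : ℝ) * shiftedScale a x := by
  rw [rescale_eq ha, shiftedScale, mul_add _ (a ^ (2 / 3 : ℝ)), ← Real.rpow_add ha]
  norm_num

theorem shiftedScale_pos {a x : ℝ} (ha : 0 < a) (hx : 0 ≤ 1 + a * x) : 0 < shiftedScale a x :=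
  add_pos_of_pos_of_nonneg (Real.rpow_pos_of_pos ha _) hx

theorem rescale_nonneg {a x : ℝ} (ha : 0 < a) (hx : 0 ≤ 1 + a * x) : 0 ≤ rescale a x := by
  rw [rescale_eq ha]; positivity

theorem rescale_nonpos {a x : ℝ} (ha : 0 < a) (hx : 1 + a * x ≤ 0) : rescale a x ≤ 0 := by
  rw [rescale_eq ha]
  exact mul_nonpos_of_nonneg_of_nonpos (by positivity) hx

/-- Airy exponents equal a multiple of 1/a up to θ = `decayExponent`. In a product Ai·Hi the large
1/a cancels and only a difference of values of θ survives. -/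
theorem rescale_rpow {a x : ℝ} (ha : 0 < a) (hx : 0 ≤ 1 + a * x) :
    rescale a x ^ (3 / 2 : ℝ) = a⁻¹ - decayExponent a x := by
  rw [rescale_eq ha, Real.mul_rpow (by positivity) hx, ← Real.rpow_mul ha.le, decayExponent,
    show (-(2 / 3) * (3 / 2) : ℝ) = -1 by norm_num, Real.rpow_neg_one]
  ring

theorem one_add_rescale_rpow {a x : ℝ} (ha : 0 < a) (hx : 0 ≤ 1 + a * x) (e : ℝ) :
    (1 + rescale a x) ^ e = a ^ (-(2 / 3) * e) * shiftedScale a x ^ e := by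
  rw [one_add_rescale ha, Real.mul_rpow (by positivity) (shiftedScale_pos ha hx).le,
    ← Real.rpow_mul ha.le]

theorem abs_le_of_abs_add_half_le {γ : ℝ} (hγ : |γ + 1 / 2| ≤ 1 / 8) :
    -(5 / 8) ≤ γ ∧ γ ≤ -(3 / 8) := by
  have := abs_le.1 hγ
  constructor <;> linarith

/-- Kernel bounds in the four configurations of `x`, `y` relative to the turning point `-1/a`. -/
theorem exists_greenKernel_bounds : ∃ C : ℝ, 0 < C ∧ ∀ a γ x y : ℝ, 0 < a → |γ + 1 / 2| ≤ 1 / 8 →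
    (0 ≤ 1 + a * x → 0 ≤ 1 + a * y → |greenKernel a γ x y| ≤
      C * (shiftedScale a x ^ (γ / 2 - 1 / 4) * shiftedScale a y ^ (-γ / 2 - 1 / 4) *
        Real.exp (-(2 / 3 * |decayExponent a x - decayExponent a y|)) +
        if y ≤ x then a * shiftedScale a x ^ (-1 - γ) * shiftedScale a y ^ (-1 + γ) else 0)) ∧
    (1 + a * x ≤ 0 → 1 + a * y ≤ 0 → |greenKernel a γ x y| ≤
      C * (a ^ (-(1 / 3) : ℝ) * (1 + -rescale a y) ^ (7 / 16 : ℝ) *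
        (1 + -rescale a x) ^ (-(3 / 8) : ℝ))) ∧
    (1 + a * x ≤ 0 → 0 < 1 + a * y → |greenKernel a γ x y| ≤
      C * (a ^ (-(1 / 3) : ℝ) * (1 + rescale a y) *
        Real.exp (-(2 / 3 * (a⁻¹ - decayExponent a y))) *
        (1 + -rescale a x) ^ (-(3 / 8) : ℝ))) ∧
    (0 < 1 + a * x → 1 + a * y ≤ 0 → |greenKernel a γ x y| ≤
      C * (a ^ (-(1 / 3) : ℝ) * (1 + -rescale a y) ^ (1 / 16 : ℝ) *
        (1 + rescale a x) ^ (-1 - γ))) := by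
  obtain ⟨C, hC, H⟩ := exists_airy_bounds
  refine ⟨8 * C ^ 2, by positivity, fun a γ x y ha hγ => ?_⟩
  have hγ' := abs_le_of_abs_add_half_le hγ
  obtain ⟨Hp, Hn⟩ := H γ (abs_le.2 ⟨by linarith, by linarith⟩)
  obtain ⟨Hp', Hn'⟩ := H (-γ) (abs_le.2 ⟨by linarith, by linarith⟩)
  have hpi : Real.pi ≤ 4 := Real.pi_le_four
  have ha3 : 0 < a ^ (-(1 / 3) : ℝ) := by positivity
  have hmono : ∀ {u v : ℝ}, u ≤ C ^ 2 * v → 0 ≤ v →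
      Real.pi * a ^ (-(1 / 3) : ℝ) * u ≤ 4 * C ^ 2 * (a ^ (-(1 / 3) : ℝ) * v) := by
    intro u v huv hv
    calc _ ≤ Real.pi * a ^ (-(1 / 3) : ℝ) * (C ^ 2 * v) := by gcongr
      _ ≤ 4 * a ^ (-(1 / 3) : ℝ) * (C ^ 2 * v) := by gcongr
      _ = _ := by ring
  have hmul : ∀ {u u' v v' : ℝ}, 0 ≤ u' → 0 ≤ v → u ≤ C * v → u' ≤ C * v' →
      u * u' ≤ C ^ 2 * (v * v') := by
    intro u u' v v' hu hv h h'
    calc u * u' ≤ (C * v) * (C * v') := mul_le_mul h h' hu (by positivity)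
      _ = _ := by ring
  refine ⟨fun hx hy => ?_, fun hx hy => ?_, fun hx hy => ?_, fun hx hy => ?_⟩
  · have hX := rescale_nonneg ha hx
    have hY := rescale_nonneg ha hy
    have hmx := shiftedScale_pos ha hx
    have hmy := shiftedScale_pos ha hy
    obtain ⟨hAx, hHx, hGx⟩ := Hp _ hX
    obtain ⟨hAy, hHy, hGy⟩ := Hp' _ hY
    rw [rescale_rpow ha hx] at hAx hHx
    rw [rescale_rpow ha hy] at hAy hHy
    -- The exponents of the two scales sum to -1/2, so their rescaling produces a^{1/3} and cancels
    -- the prefactor.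
    have hscale : a ^ (-(1 / 3) : ℝ) * ((1 + rescale a x) ^ (γ / 2 - 1 / 4) *
        (1 + rescale a y) ^ (-γ / 2 - 1 / 4)) =
        shiftedScale a x ^ (γ / 2 - 1 / 4) * shiftedScale a y ^ (-γ / 2 - 1 / 4) := by
      rw [one_add_rescale_rpow ha hx, one_add_rescale_rpow ha hy]
      have : a ^ (-(1 / 3) : ℝ) * (a ^ (-(2 / 3) * (γ / 2 - 1 / 4)) *
          a ^ (-(2 / 3) * (-γ / 2 - 1 / 4))) = 1 := by
        rw [← Real.rpow_add ha, ← Real.rpow_add ha]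
        ring_nf
        exact Real.rpow_zero a
      linear_combination (shiftedScale a x ^ (γ / 2 - 1 / 4) *
        shiftedScale a y ^ (-γ / 2 - 1 / 4)) * this
    -- Here the exponents sum to -2: the rescaling produces a^{4/3}, and one factor a is left.
    have hscale2 : a ^ (-(1 / 3) : ℝ) * ((1 + rescale a x) ^ (-1 - γ) *
        (1 + rescale a y) ^ (-1 - -γ)) =
        a * shiftedScale a x ^ (-1 - γ) * shiftedScale a y ^ (-1 + γ) := by
      rw [one_add_rescale_rpow ha hx, one_add_rescale_rpow ha hy, sub_neg_eq_add]
      have : a ^ (-(1 / 3) : ℝ) * (a ^ (-(2 / 3) * (-1 - γ)) *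
          a ^ (-(2 / 3) * (-1 + γ))) = a := by
        rw [← Real.rpow_add ha, ← Real.rpow_add ha]
        ring_nf
        exact Real.rpow_one a
      linear_combination (shiftedScale a x ^ (-1 - γ) *
        shiftedScale a y ^ (-1 + γ)) * this
    have hY0 : 0 ≤ 1 + rescale a y := by linarith
    have hX0 : 0 ≤ 1 + rescale a x := by linarith
    rcases lt_or_ge x y with h | h
    · rw [abs_greenKernel_of_lt ha h, if_neg h.not_ge, add_zero]
      have hθ : decayExponent a y ≤ decayExponent a x := by
        unfold decayExponent
        gcongr
      refine (hmono (hmul (genHi_nonneg _ _) (by positivity) hAy hHx) (by positivity)).trans ?_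
      rw [abs_of_nonneg (by linarith), ← hscale]
      have he : Real.exp (-(2 / 3 * (a⁻¹ - decayExponent a y))) *
          Real.exp (2 / 3 * (a⁻¹ - decayExponent a x)) =
          Real.exp (-(2 / 3 * (decayExponent a x - decayExponent a y))) := by
        rw [← Real.exp_add]; ring_nf
      rw [← he]
      refine le_of_le_of_eq (mul_le_mul_of_nonneg_right (show 4 * C ^ 2 ≤ 8 * C ^ 2 by nlinarith)
        (by positivity)) ?_
      ring
    · rw [if_pos h]
      have hθ : decayExponent a x ≤ decayExponent a y := by
        unfold decayExponent
        gcongr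
      refine (abs_greenKernel_le_of_le ha h).trans ?_
      have e1 := hmul (abs_nonneg _) (by positivity) hHy hAx
      have e2 := hmul (by positivity) (by positivity) hGy hGx
      refine (hmono ((add_le_add e1 e2).trans_eq (mul_add _ _ _).symm) (by positivity)).trans ?_
      rw [abs_of_nonpos (by linarith), ← hscale, ← hscale2]
      have he : Real.exp (2 / 3 * (a⁻¹ - decayExponent a y)) *
          Real.exp (-(2 / 3 * (a⁻¹ - decayExponent a x))) =
          Real.exp (-(2 / 3 * -(decayExponent a x - decayExponent a y))) := by
        rw [← Real.exp_add]; ring_nf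
      rw [← he]
      refine le_of_le_of_eq (mul_le_mul_of_nonneg_right (show 4 * C ^ 2 ≤ 8 * C ^ 2 by nlinarith)
        (by positivity)) ?_
      ring
  · have hX := rescale_nonpos ha hx
    have hY := rescale_nonpos ha hy
    obtain ⟨hHx, hGx, hGx0⟩ := Hn _ hX
    obtain ⟨hHy, hGy, -⟩ := Hn' _ hY
    have hX1 : 1 ≤ 1 + -rescale a x := by linarith
    have hY1 : 1 ≤ 1 + -rescale a y := by linarith
    have hX0 : 0 < 1 + -rescale a x := by linarith
    have hY0 : 0 < 1 + -rescale a y := by linarith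
    rcases lt_or_ge x y with h | h
    · rw [abs_greenKernel_of_lt ha h]
      refine (hmono (hmul (genHi_nonneg _ _) (by positivity) (le_trans
        (le_add_of_nonneg_right (abs_nonneg _)) hGy) hHx) (by positivity)).trans ?_
      have : (1 + -rescale a y) ^ (1 / 16 : ℝ) ≤ (1 + -rescale a y) ^ (7 / 16 : ℝ) :=
        Real.rpow_le_rpow_of_exponent_le hY1 (by norm_num)
      calc _ ≤ 8 * C ^ 2 * (a ^ (-(1 / 3) : ℝ) * ((1 + -rescale a y) ^ (7 / 16 : ℝ) *
            (1 + -rescale a x) ^ (-(3 / 8) : ℝ))) := by gcongr; norm_num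
        _ = _ := by ring
    · refine (abs_greenKernel_le_of_le ha h).trans ?_
      have hAx : |genAi γ (rescale a x)| ≤ C * 1 := by
        have := hGx0 (by linarith)
        have := abs_nonneg (genGi γ (rescale a x))
        linarith
      have hGx1 : |genAi γ (rescale a x)| + |genGi γ (rescale a x)| ≤ C * 1 := by
        rw [mul_one]; exact hGx0 (by linarith)
      have e1 := hmul (abs_nonneg _) (by positivity) hHy hAx
      have e2 := hmul (by positivity) (by positivity) hGy hGx1
      refine (hmono ((add_le_add e1 e2).trans_eq (mul_add _ _ _).symm) (by positivity)).trans ?_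
      -- Ai_γ and Gi_γ are merely bounded at x̂, but w demands decay of order 3/8. Since |ŷ| ≥ |x̂|,
      -- it is borrowed from y, which raises the power of y from 1/16 to 1/16 + 3/8 = 7/16.
      have hyx : 1 + -rescale a x ≤ 1 + -rescale a y := by
        rw [rescale_eq ha, rescale_eq ha]
        gcongr
      have i1 : (1 + -rescale a y) ^ (-(3 / 8) : ℝ) ≤ (1 + -rescale a y) ^ (1 / 16 : ℝ) :=
        Real.rpow_le_rpow_of_exponent_le hY1 (by norm_num)
      have i2 : (1 + -rescale a y) ^ (1 / 16 : ℝ) ≤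
          (1 + -rescale a y) ^ (7 / 16 : ℝ) * (1 + -rescale a x) ^ (-(3 / 8) : ℝ) := by
        calc (1 + -rescale a y) ^ (1 / 16 : ℝ) =
              (1 + -rescale a y) ^ (7 / 16 : ℝ) * (1 + -rescale a y) ^ (-(3 / 8) : ℝ) := by
              rw [← Real.rpow_add hY0]; norm_num
          _ ≤ _ := by
              refine mul_le_mul_of_nonneg_left ?_ (by positivity)
              exact Real.rpow_le_rpow_of_nonpos hX0 hyx (by norm_num)
      calc _ ≤ 4 * C ^ 2 * (a ^ (-(1 / 3) : ℝ) * (2 * ((1 + -rescale a y) ^ (7 / 16 : ℝ) *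
            (1 + -rescale a x) ^ (-(3 / 8) : ℝ)))) := by gcongr; linarith
        _ = _ := by ring
  · have hX := rescale_nonpos ha hx
    have hY := rescale_nonneg ha hy.le
    obtain ⟨hHx, -, -⟩ := Hn _ hX
    obtain ⟨hAy, -, -⟩ := Hp' _ hY
    rw [rescale_rpow ha hy.le] at hAy
    have hX0 : 0 < 1 + -rescale a x := by linarith
    have hY0 : 0 < 1 + rescale a y := by linarith
    have h : x < y := by
      by_contra! h
      have := mul_le_mul_of_nonneg_left h ha.le
      linarith
    rw [abs_greenKernel_of_lt ha h]
    refine (hmono (hmul (genHi_nonneg _ _) (by positivity) hAy hHx) (by positivity)).trans ?_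
    have : (1 + rescale a y) ^ (-γ / 2 - 1 / 4) ≤ 1 + rescale a y := by
      calc _ ≤ (1 + rescale a y) ^ (1 : ℝ) :=
            Real.rpow_le_rpow_of_exponent_le (by linarith) (by linarith)
        _ = _ := Real.rpow_one _
    calc _ ≤ 8 * C ^ 2 * (a ^ (-(1 / 3) : ℝ) * ((1 + rescale a y) *
          Real.exp (-(2 / 3 * (a⁻¹ - decayExponent a y))) *
          (1 + -rescale a x) ^ (-(3 / 8) : ℝ))) := by gcongr; norm_num
      _ = _ := by ring
  · have hX := rescale_nonneg ha hx.le
    have hY := rescale_nonpos ha hy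
    obtain ⟨-, -, hGx⟩ := Hp _ hX
    obtain ⟨hHy, hGy, -⟩ := Hn' _ hY
    have hX0 : 0 < 1 + rescale a x := by linarith
    have hY1 : 1 ≤ 1 + -rescale a y := by linarith
    have hY0 : 0 < 1 + -rescale a y := by linarith
    have h : y ≤ x := by
      by_contra! h
      have := mul_le_mul_of_nonneg_left h.le ha.le
      linarith
    refine (abs_greenKernel_le_of_le ha h).trans ?_
    have e1 := hmul (abs_nonneg _) (by positivity) hHy
      (le_trans (le_add_of_nonneg_right (abs_nonneg _)) hGx)
    have e2 := hmul (by positivity) (by positivity) hGy hGx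
    refine (hmono ((add_le_add e1 e2).trans_eq (mul_add _ _ _).symm) (by positivity)).trans ?_
    have i1 : (1 + -rescale a y) ^ (-(3 / 8) : ℝ) ≤ (1 + -rescale a y) ^ (1 / 16 : ℝ) :=
      Real.rpow_le_rpow_of_exponent_le hY1 (by norm_num)
    calc _ ≤ 4 * C ^ 2 * (a ^ (-(1 / 3) : ℝ) * ((1 + -rescale a y) ^ (1 / 16 : ℝ) *
          (1 + rescale a x) ^ (-1 - γ) + (1 + -rescale a y) ^ (1 / 16 : ℝ) *
          (1 + rescale a x) ^ (-1 - γ))) := by gcongr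
      _ = _ := by ring

/-! ### Absorption into exponentials, and the integrable majorant -/

theorem exists_one_add_rpow_le_exp {r c : ℝ} (hr : 0 ≤ r) (hc : 0 < c) :
    ∃ C : ℝ, 0 < C ∧ ∀ t : ℝ, 0 ≤ t → (1 + t) ^ r ≤ C * Real.exp (c * t) := by
  have hr1 : 0 < r + 1 := by linarith
  set μ := c / (r + 1) with hμ
  have hμ0 : 0 < μ := by positivity
  refine ⟨(1 + μ⁻¹) ^ (r + 1), by positivity, fun t ht => ?_⟩
  have h1 : 1 + t ≤ (1 + μ⁻¹) * Real.exp (μ * t) := by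
    have h2 := Real.add_one_le_exp (μ * t)
    have h3 : (1 + μ⁻¹) * (μ * t + 1) = 1 + t + (μ * t + μ⁻¹) := by field_simp; ring
    have h4 : 0 ≤ μ * t + μ⁻¹ := by positivity
    calc 1 + t ≤ (1 + μ⁻¹) * (μ * t + 1) := by linarith
      _ ≤ _ := by gcongr
  calc (1 + t) ^ r ≤ (1 + t) ^ (r + 1) :=
        Real.rpow_le_rpow_of_exponent_le (by linarith) (by linarith)
    _ ≤ ((1 + μ⁻¹) * Real.exp (μ * t)) ^ (r + 1) := by gcongr
    _ = _ := by
      rw [Real.mul_rpow (by positivity) (by positivity), ← Real.exp_mul]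
      congr 2
      rw [hμ]
      field_simp

/-- Keeps the bounds uniform as a → 0: any negative power of a is paid for by an exponential in 1/a.
-/
theorem exists_rpow_neg_mul_exp_le {r c : ℝ} (hr : 0 ≤ r) (hc : 0 < c) :
    ∃ C : ℝ, 0 < C ∧ ∀ a : ℝ, 0 < a → a ^ (-r) * Real.exp (-(c * a⁻¹)) ≤ C := by
  obtain ⟨C, hC, h⟩ := exists_one_add_rpow_le_exp hr hc
  refine ⟨C, hC, fun a ha => ?_⟩
  rw [Real.exp_neg, ← div_eq_mul_inv, div_le_iff₀ (Real.exp_pos _), Real.rpow_neg ha.le,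
    ← Real.inv_rpow ha.le]
  refine le_trans ?_ (h a⁻¹ (by positivity))
  gcongr
  linarith

/-- An integrable function that dominates the weighted kernel, up to the weight `weightOut`. -/
def kernelMajorant (a x y : ℝ) : ℝ :=
  Real.exp (-(1 / 2 * |x - y|)) + Real.exp (-(1 / 24 * |y|)) +
    a * (1 + |1 + a * y|) ^ (-(17 / 16) : ℝ)

theorem exp_dist_le_kernelMajorant {a : ℝ} (ha : 0 ≤ a) (x y : ℝ) :
    Real.exp (-(1 / 2 * |x - y|)) ≤ kernelMajorant a x y := by
  rw [kernelMajorant, add_assoc]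
  exact le_add_of_nonneg_right (by positivity)

theorem exp_abs_le_kernelMajorant {a : ℝ} (ha : 0 ≤ a) (x y : ℝ) :
    Real.exp (-(1 / 24 * |y|)) ≤ kernelMajorant a x y := by
  have h1 : 0 ≤ a * (1 + |1 + a * y|) ^ (-(17 / 16) : ℝ) := by positivity
  have h2 := Real.exp_pos (-(1 / 2 * |x - y|))
  rw [kernelMajorant]
  linarith

theorem rpow_le_kernelMajorant (a x y : ℝ) :
    a * (1 + |1 + a * y|) ^ (-(17 / 16) : ℝ) ≤ kernelMajorant a x y := by
  have h1 := Real.exp_pos (-(1 / 24 * |y|))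
  have h2 := Real.exp_pos (-(1 / 2 * |x - y|))
  rw [kernelMajorant]
  linarith

theorem kernelMajorant_nonneg {a : ℝ} (ha : 0 ≤ a) (x y : ℝ) : 0 ≤ kernelMajorant a x y :=
  (Real.exp_pos _).le.trans (exp_abs_le_kernelMajorant ha x y)

/-! ### The weights in the three zones x ≤ -1/a, -1/a < x ≤ 0, x > 0 -/

theorem le_neg_inv_iff {a x : ℝ} (ha : 0 < a) : x ≤ -a⁻¹ ↔ 1 + a * x ≤ 0 := by
  rw [le_neg, ← one_div, div_le_iff₀ ha]
  constructor <;> intro h <;> linarith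

theorem scaled_abs_eq {a x : ℝ} (ha : 0 < a) (hx : 1 + a * x ≤ 0) :
    a ^ (-(2 / 3) : ℝ) * |1 + a * x| = -rescale a x := by
  rw [rescale_eq ha, abs_of_nonpos hx]; ring

/-- Since 1/2 = 1/3 + 1/6, left of the turning point w_i carries the exponential factor of w and a
spare exp(-1/(6a)). -/
theorem exp_half_inv (a : ℝ) : Real.exp (-(1 / (2 * a))) =
    Real.exp (-(1 / (3 * a))) * Real.exp (-(1 / 6 * a⁻¹)) := by
  rw [← Real.exp_add]
  congr 1
  rw [one_div, one_div, mul_inv, mul_inv]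
  ring

theorem weightOut_of_nonpos {k a γ x : ℝ} (ha : 0 < a) (hx : 1 + a * x ≤ 0) :
    weightOut k a γ x =
      Real.exp (-(1 / (3 * a))) * (1 + -rescale a x) ^ (-(3 / 8) : ℝ) := by
  rw [weightOut, if_neg ha.ne', if_pos ((le_neg_inv_iff ha).2 hx), scaled_abs_eq ha hx]

theorem weightIn_of_nonpos {k a γ x : ℝ} (ha : 0 < a) (hx : 1 + a * x ≤ 0) :
    weightIn k a γ x =
      Real.exp (-(1 / (2 * a))) * (1 + -rescale a x) ^ (-(3 / 2) : ℝ) := by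
  rw [weightIn, if_neg ha.ne', if_pos ((le_neg_inv_iff ha).2 hx), scaled_abs_eq ha hx]

theorem weightOut_middle {k a γ x : ℝ} (ha : 0 < a) (hx : 0 < 1 + a * x) (hx0 : x ≤ 0) :
    weightOut k a γ x = Real.exp (-(1 / 3 * decayExponent a x)) := by
  rw [weightOut, if_neg ha.ne', if_neg (fun h => hx.not_ge ((le_neg_inv_iff ha).1 h)), if_pos hx0,
    decayExponent]
  congr 1
  rw [one_div, mul_inv]
  ring

theorem weightIn_middle {k a γ x : ℝ} (ha : 0 < a) (hx : 0 < 1 + a * x) (hx0 : x ≤ 0) :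
    weightIn k a γ x = Real.exp (-(1 / 2 * decayExponent a x)) := by
  rw [weightIn, if_neg ha.ne', if_neg (fun h => hx.not_ge ((le_neg_inv_iff ha).1 h)), if_pos hx0,
    decayExponent]
  congr 1
  rw [one_div, mul_inv]
  ring

theorem one_add_mul_pos_of_pos {a x : ℝ} (ha : 0 < a) (hx : 0 < x) : 0 < 1 + a * x := by
  positivity

theorem weightOut_of_pos {k a γ x : ℝ} (ha : 0 < a) (hx : 0 < x) :
    weightOut k a γ x = (1 + x) ^ k * (1 + a * x) ^ (-1 - γ - k) := by
  rw [weightOut, if_neg ha.ne',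
    if_neg (fun h => (one_add_mul_pos_of_pos ha hx).not_ge ((le_neg_inv_iff ha).1 h)),
    if_neg hx.not_ge]

theorem weightIn_of_pos {k a γ x : ℝ} (ha : 0 < a) (hx : 0 < x) :
    weightIn k a γ x = (1 + x) ^ k * (1 + a * x) ^ (-1 - γ - k) := by
  rw [weightIn, if_neg ha.ne',
    if_neg (fun h => (one_add_mul_pos_of_pos ha hx).not_ge ((le_neg_inv_iff ha).1 h)),
    if_neg hx.not_ge]

theorem weightOut_pos (k : ℝ) {a : ℝ} (ha : 0 ≤ a) (γ x : ℝ) : 0 < weightOut k a γ x := by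
  rcases ha.eq_or_lt with rfl | ha
  · rw [weightOut, if_pos rfl]
    split_ifs <;> positivity
  rcases le_or_gt (1 + a * x) 0 with h | h
  · rw [weightOut_of_nonpos ha h]
    have := rescale_nonpos ha h
    exact mul_pos (Real.exp_pos _) (Real.rpow_pos_of_pos (by linarith) _)
  · rcases le_or_gt x 0 with h0 | h0
    · rw [weightOut_middle ha h h0]; positivity
    · rw [weightOut_of_pos ha h0]; positivity

theorem weightIn_pos (k : ℝ) {a : ℝ} (ha : 0 ≤ a) (γ x : ℝ) : 0 < weightIn k a γ x := by
  rcases ha.eq_or_lt with rfl | ha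
  · rw [weightIn, if_pos rfl]
    split_ifs <;> positivity
  rcases le_or_gt (1 + a * x) 0 with h | h
  · rw [weightIn_of_nonpos ha h]
    have := rescale_nonpos ha h
    exact mul_pos (Real.exp_pos _) (Real.rpow_pos_of_pos (by linarith) _)
  · rcases le_or_gt x 0 with h0 | h0
    · rw [weightIn_middle ha h h0]; positivity
    · rw [weightIn_of_pos ha h0]; positivity

/-! ### Comparison of the exponent, the scale and the weights with |x| and |x - y| -/

section decayExponent

variable {a x y : ℝ}

theorem neg_le_decayExponent (ha : 0 < a) (hx : 0 ≤ 1 + a * x) (hx0 : x ≤ 0) :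
    -x ≤ decayExponent a x := by
  have h1 : 1 + a * x ≤ 1 := by nlinarith
  have h2 : (1 + a * x) ^ (3 / 2 : ℝ) ≤ 1 + a * x := by
    calc _ ≤ (1 + a * x) ^ (1 : ℝ) :=
          Real.rpow_le_rpow_of_exponent_ge_of_imp hx h1 (by norm_num) (by norm_num)
      _ = _ := Real.rpow_one _
  have h3 : -x = a⁻¹ * (1 - (1 + a * x)) := by field_simp; ring
  rw [h3, decayExponent]
  gcongr

theorem decayExponent_le_inv (ha : 0 < a) (hx : 0 ≤ 1 + a * x) : decayExponent a x ≤ a⁻¹ := by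
  rw [decayExponent]
  refine mul_le_of_le_one_right (by positivity) ?_
  have : 0 ≤ (1 + a * x) ^ (3 / 2 : ℝ) := by positivity
  linarith

/-- For x ≥ 0 the slope of θ is -(3/2)(1+ax)^{1/2} ≤ -3/2; Bernoulli's inequality replaces
differentiation. Hence exp(-(2/3)|θ(x) - θ(y)|) ≤ exp(-|x-y|) on the positive half line. -/
theorem sub_le_decayExponent_sub (ha : 0 < a) (hx : 0 ≤ x) (hxy : x ≤ y) :
    3 / 2 * (y - x) ≤ decayExponent a x - decayExponent a y := by
  have hp : 1 ≤ 1 + a * x := by nlinarith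
  have hp0 : 0 < 1 + a * x := by linarith
  set p := 1 + a * x with hpdef
  set s := a * (y - x) / p with hs
  have hs0 : 0 ≤ s := div_nonneg (mul_nonneg ha.le (by linarith)) hp0.le
  have h1 : 1 + a * y = p * (1 + s) := by rw [hs, hpdef]; field_simp; ring
  have h2 := one_add_mul_self_le_rpow_one_add (show -1 ≤ s by linarith)
    (show (1 : ℝ) ≤ 3 / 2 by norm_num)
  have h3 : p ≤ p ^ (3 / 2 : ℝ) := by
    calc p = p ^ (1 : ℝ) := (Real.rpow_one _).symm
      _ ≤ _ := Real.rpow_le_rpow_of_exponent_le hp (by norm_num)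
  have h4 : decayExponent a x - decayExponent a y =
      a⁻¹ * (p ^ (3 / 2 : ℝ) * ((1 + s) ^ (3 / 2 : ℝ) - 1)) := by
    rw [decayExponent, decayExponent, h1, Real.mul_rpow hp0.le (by linarith)]
    ring
  have h5 : 3 / 2 * (y - x) = a⁻¹ * (p * (3 / 2 * s)) := by rw [hs]; field_simp
  rw [h4, h5]
  have h6 : 0 ≤ 3 / 2 * s := by positivity
  have h7 : 3 / 2 * s ≤ (1 + s) ^ (3 / 2 : ℝ) - 1 := by linarith
  gcongr

theorem decayExponent_le_neg (ha : 0 < a) (hy : 0 ≤ y) : decayExponent a y ≤ -(3 / 2 * y) := by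
  have h := sub_le_decayExponent_sub ha le_rfl hy
  have h0 : decayExponent a 0 = 0 := by simp [decayExponent]
  linarith

end decayExponent

section shiftedScale

variable {a x y : ℝ}

/-- The summand a^{2/3} ≥ a keeps the scale positive at the turning point, so its negative powers
cost only polynomials in |x|, uniformly in a. -/
theorem inv_shiftedScale_le (ha : 0 < a) (ha1 : a ≤ 1) (hx : 0 ≤ 1 + a * x) (hx0 : x ≤ 0) :
    (shiftedScale a x)⁻¹ ≤ 1 + |x| := by
  have h1 : a ≤ a ^ (2 / 3 : ℝ) := by
    calc a = a ^ (1 : ℝ) := (Real.rpow_one _).symm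
      _ ≤ _ := Real.rpow_le_rpow_of_exponent_ge ha ha1 (by norm_num)
  have hm := shiftedScale_pos ha hx
  rw [abs_of_nonpos hx0, inv_le_iff_one_le_mul₀' hm]
  calc 1 ≤ (a + (1 + a * x)) * (1 + -x) := by nlinarith
    _ ≤ _ := by
      unfold shiftedScale
      gcongr
      linarith

theorem rpow_two_thirds_le_one (ha : 0 < a) (ha1 : a ≤ 1) : a ^ (2 / 3 : ℝ) ≤ 1 :=
  Real.rpow_le_one ha.le ha1 (by norm_num)

theorem one_add_le_shiftedScale (ha : 0 < a) (x : ℝ) : 1 + a * x ≤ shiftedScale a x :=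
  le_add_of_nonneg_left (by positivity)

theorem shiftedScale_le (ha : 0 < a) (ha1 : a ≤ 1) (x : ℝ) : shiftedScale a x ≤ 2 + |x| := by
  have h1 := rpow_two_thirds_le_one ha ha1
  have h2 : a * x ≤ |x| := by
    calc a * x ≤ a * |x| := by gcongr; exact le_abs_self x
      _ ≤ 1 * |x| := by gcongr
      _ = |x| := one_mul _
  unfold shiftedScale
  linarith

theorem rpow_le_pow_of_inv_le {m T e : ℝ} {n : ℕ} (hm : 0 < m) (hT : m⁻¹ ≤ T) (hT1 : 1 ≤ T)
    (he : e ≤ 0) (hn : -e ≤ n) : m ^ e ≤ T ^ n := by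
  calc m ^ e = (m⁻¹) ^ (-e) := by rw [Real.inv_rpow hm.le, ← Real.rpow_neg hm.le, neg_neg]
    _ ≤ T ^ (-e) := by
      have := inv_pos.2 hm
      gcongr
      linarith
    _ ≤ T ^ (n : ℝ) := Real.rpow_le_rpow_of_exponent_le hT1 hn
    _ = _ := Real.rpow_natCast _ _

theorem shiftedScale_rpow_le_pow {e : ℝ} {n : ℕ} (ha : 0 < a) (ha1 : a ≤ 1) (hx : 0 ≤ 1 + a * x)
    (hx0 : x ≤ 0) (he : e ≤ 0) (hn : -e ≤ n) : shiftedScale a x ^ e ≤ (1 + |x|) ^ n :=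
  rpow_le_pow_of_inv_le (shiftedScale_pos ha hx) (inv_shiftedScale_le ha ha1 hx hx0)
    (by linarith [abs_nonneg x]) he hn

theorem shiftedScale_rpow_le_of_middle {e : ℝ} (ha : 0 < a) (ha1 : a ≤ 1) (hx : 0 ≤ 1 + a * x)
    (hx0 : x ≤ 0) (he : |e| ≤ 1) : shiftedScale a x ^ e ≤ 3 * (1 + |x|) := by
  refine (rpow_le_add_inv (shiftedScale_pos ha hx) he).trans ?_
  have h1 := shiftedScale_le ha ha1 x
  have h2 := inv_shiftedScale_le ha ha1 hx hx0
  linarith [abs_nonneg x]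

theorem one_le_shiftedScale (ha : 0 < a) (hx : 0 ≤ x) : 1 ≤ shiftedScale a x := by
  have := one_add_le_shiftedScale ha x
  nlinarith

theorem shiftedScale_rpow_le_of_nonneg {e : ℝ} (ha : 0 < a) (ha1 : a ≤ 1)
    (hx : 0 ≤ x) (he : |e| ≤ 1) : shiftedScale a x ^ e ≤ 3 * (1 + |x|) := by
  have h0 := one_le_shiftedScale ha hx
  refine (rpow_le_add_inv (by linarith) he).trans ?_
  have h1 := shiftedScale_le ha ha1 x
  have h2 : (shiftedScale a x)⁻¹ ≤ 1 := inv_le_one_of_one_le₀ h0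
  linarith [abs_nonneg x]

theorem shiftedScale_le_mul (ha : 0 < a) (ha1 : a ≤ 1) (hx : 0 ≤ x) (y : ℝ) :
    shiftedScale a y ≤ shiftedScale a x * (1 + |x - y|) := by
  have h0 := one_le_shiftedScale ha hx
  have h1 : a * (y - x) ≤ |x - y| := by
    rw [abs_sub_comm]
    calc a * (y - x) ≤ a * |y - x| := by gcongr; exact le_abs_self _
      _ ≤ 1 * |y - x| := by gcongr
      _ = _ := one_mul _
  have h2 : shiftedScale a y = shiftedScale a x + a * (y - x) := by unfold shiftedScale; ring
  rw [h2]
  nlinarith [abs_nonneg (x - y)]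

end shiftedScale

section weightPos

variable {k a γ x y : ℝ}

theorem one_add_rpow_le_weight (ha : 0 < a) (ha1 : a ≤ 1) (hk : 0 ≤ k) (hx : 0 ≤ x) :
    (1 + a * x) ^ (-1 - γ) ≤ (1 + x) ^ k * (1 + a * x) ^ (-1 - γ - k) := by
  have hp : 0 < 1 + a * x := by positivity
  have h1 : 1 + a * x ≤ 1 + x := by nlinarith
  calc (1 + a * x) ^ (-1 - γ) = (1 + a * x) ^ k * (1 + a * x) ^ (-1 - γ - k) := by
        rw [← Real.rpow_add hp]; ring_nf
    _ ≤ _ := by gcongr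

theorem exp_neg_le_weight (ha : 0 < a) (ha1 : a ≤ 1) (hk : 0 ≤ k) (hγ : γ ≤ 0) (hx : 0 ≤ x) :
    Real.exp (-x) ≤ (1 + x) ^ k * (1 + a * x) ^ (-1 - γ - k) := by
  refine le_trans ?_ (one_add_rpow_le_weight ha ha1 hk hx)
  have hp : 1 ≤ 1 + a * x := by nlinarith
  have h1 : 1 + a * x ≤ Real.exp x := by nlinarith [Real.add_one_le_exp x]
  calc Real.exp (-x) = (Real.exp x)⁻¹ := Real.exp_neg x
    _ ≤ (1 + a * x)⁻¹ := by gcongr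
    _ = (1 + a * x) ^ (-1 : ℝ) := (Real.rpow_neg_one _).symm
    _ ≤ _ := Real.rpow_le_rpow_of_exponent_le hp (by linarith)

theorem weight_le_rpow (ha : 0 < a) (hk : 0 ≤ k) (hγ : -1 ≤ γ) (hx : 0 ≤ x) :
    (1 + x) ^ k * (1 + a * x) ^ (-1 - γ - k) ≤ (1 + x) ^ k := by
  have hp : 1 ≤ 1 + a * x := by nlinarith
  exact mul_le_of_le_one_right (by positivity)
    (Real.rpow_le_one_of_one_le_of_nonpos hp (by linarith))

/-- The weight varies slowly: 1+y ≤ (1+|x-y|)(1+x) handles the power k, and 1+ax ≤ (1+|x-y|)(1+ay)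
the remaining power, whose exponent is nonpositive. Replacing y by x then costs a polynomial in
|x-y|. -/
theorem weight_le_mul_weight (ha : 0 < a) (ha1 : a ≤ 1) (hk : 0 ≤ k) (hγ : -1 ≤ γ) (hγ0 : γ ≤ 0)
    (hx : 0 ≤ x) (hy : 0 ≤ y) :
    (1 + y) ^ k * (1 + a * y) ^ (-1 - γ - k) ≤
      (1 + |x - y|) ^ (2 * k + 1) * ((1 + x) ^ k * (1 + a * x) ^ (-1 - γ - k)) := by
  have hd := abs_nonneg (x - y)
  have hpx : 0 < 1 + a * x := by positivity
  have hpy : 0 < 1 + a * y := by positivity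
  have h1 : 1 + y ≤ (1 + |x - y|) * (1 + x) := by
    have := neg_abs_le (x - y)
    nlinarith
  have h2 : 1 + a * x ≤ (1 + |x - y|) * (1 + a * y) := by
    have h3 := le_abs_self (x - y)
    have h4 : a * (x - y) ≤ 1 * |x - y| := by nlinarith
    have h5 : 0 ≤ |x - y| * (a * y) := by positivity
    nlinarith
  have h3 : (1 + y) ^ k ≤ (1 + |x - y|) ^ k * (1 + x) ^ k := by
    rw [← Real.mul_rpow (by positivity) (by positivity)]
    gcongr
  have h4 : (1 + a * y) ^ (-1 - γ - k) ≤ (1 + |x - y|) ^ (k + 1) * (1 + a * x) ^ (-1 - γ - k) := by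
    have h5 : ((1 + |x - y|) * (1 + a * y)) ^ (-1 - γ - k) ≤ (1 + a * x) ^ (-1 - γ - k) :=
      Real.rpow_le_rpow_of_nonpos hpx h2 (by linarith)
    rw [Real.mul_rpow (by positivity) hpy.le] at h5
    have h6 : (1 + |x - y|) ^ (-(-1 - γ - k)) ≤ (1 + |x - y|) ^ (k + 1) :=
      Real.rpow_le_rpow_of_exponent_le (by linarith) (by linarith)
    have h7 : (1 + |x - y|) ^ (-(-1 - γ - k)) * (1 + |x - y|) ^ (-1 - γ - k) = 1 := by
      rw [← Real.rpow_add (by positivity), neg_add_cancel, Real.rpow_zero]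
    calc (1 + a * y) ^ (-1 - γ - k) = (1 + |x - y|) ^ (-(-1 - γ - k)) *
          ((1 + |x - y|) ^ (-1 - γ - k) * (1 + a * y) ^ (-1 - γ - k)) := by
          rw [← mul_assoc, h7, one_mul]
      _ ≤ _ := by gcongr
  calc _ ≤ ((1 + |x - y|) ^ k * (1 + x) ^ k) *
        ((1 + |x - y|) ^ (k + 1) * (1 + a * x) ^ (-1 - γ - k)) := by gcongr
    _ = _ := by
      rw [show 2 * k + 1 = k + (k + 1) by ring, Real.rpow_add (by positivity) k (k + 1)]
      ring

end weightPos

/-! ### The weighted kernel estimate, zone by zone -/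

/-- Writing a^{-1/3} = a^{-4/3}·a supplies the factor a that the majorant requires; the spare
exp(-1/(6a)) absorbs a^{-4/3}. -/
theorem exists_tail_le_kernelMajorant : ∃ C : ℝ, 0 < C ∧ ∀ a x y : ℝ, 0 < a → a ≤ 1 →
    1 + a * y ≤ 0 → a ^ (-(1 / 3) : ℝ) * Real.exp (-(1 / 6 * a⁻¹)) *
      (1 + -rescale a y) ^ (-(17 / 16) : ℝ) ≤ C * kernelMajorant a x y := by
  obtain ⟨C, hC, h⟩ := exists_rpow_neg_mul_exp_le (r := 4 / 3) (c := 1 / 6)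
    (by norm_num) (by norm_num)
  refine ⟨C, hC, fun a x y ha ha1 hy => ?_⟩
  have h1 : (1 + -rescale a y) ^ (-(17 / 16) : ℝ) ≤ (1 + |1 + a * y|) ^ (-(17 / 16) : ℝ) := by
    refine Real.rpow_le_rpow_of_nonpos (by positivity) ?_ (by norm_num)
    rw [← scaled_abs_eq ha hy]
    have : 1 ≤ a ^ (-(2 / 3) : ℝ) :=
      Real.one_le_rpow_of_pos_of_le_one_of_nonpos ha ha1 (by norm_num)
    have := le_mul_of_one_le_left (abs_nonneg (1 + a * y)) this
    linarith
  have h2 : a ^ (-(1 / 3) : ℝ) = a ^ (-(4 / 3) : ℝ) * a := by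
    rw [← Real.rpow_add_one ha.ne']; norm_num
  calc _ ≤ a ^ (-(1 / 3) : ℝ) * Real.exp (-(1 / 6 * a⁻¹)) *
        (1 + |1 + a * y|) ^ (-(17 / 16) : ℝ) := by gcongr
    _ = (a ^ (-(4 / 3) : ℝ) * Real.exp (-(1 / 6 * a⁻¹))) *
        (a * (1 + |1 + a * y|) ^ (-(17 / 16) : ℝ)) := by rw [h2]; ring
    _ ≤ C * kernelMajorant a x y := by
        refine mul_le_mul (h a ha) (rpow_le_kernelMajorant a x y) (by positivity) hC.le

/-- The kernel grows like the power 7/16 of 1 + |ŷ| and w_i decays like 3/2; the difference 17/16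
exceeds 1, so the tail is integrable. -/
theorem exists_weighted_le_left_left : ∃ C : ℝ, 0 < C ∧ ∀ k a γ x y : ℝ, 0 < a → a ≤ 1 →
    1 + a * x ≤ 0 → 1 + a * y ≤ 0 →
    a ^ (-(1 / 3) : ℝ) * (1 + -rescale a y) ^ (7 / 16 : ℝ) *
        (1 + -rescale a x) ^ (-(3 / 8) : ℝ) * weightIn k a γ y ≤
      C * (weightOut k a γ x * kernelMajorant a x y) := by
  obtain ⟨C, hC, h⟩ := exists_tail_le_kernelMajorant
  refine ⟨C, hC, fun k a γ x y ha ha1 hx hy => ?_⟩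
  have hX := rescale_nonpos ha hx
  have hY := rescale_nonpos ha hy
  have hX0 : 0 < 1 + -rescale a x := by linarith
  have hY0 : 0 < 1 + -rescale a y := by linarith
  rw [weightIn_of_nonpos ha hy, weightOut_of_nonpos ha hx, exp_half_inv]
  have h1 : (1 + -rescale a y) ^ (7 / 16 : ℝ) * (1 + -rescale a y) ^ (-(3 / 2) : ℝ) =
      (1 + -rescale a y) ^ (-(17 / 16) : ℝ) := by
    rw [← Real.rpow_add hY0]; norm_num
  calc _ = Real.exp (-(1 / (3 * a))) * (1 + -rescale a x) ^ (-(3 / 8) : ℝ) *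
        (a ^ (-(1 / 3) : ℝ) * Real.exp (-(1 / 6 * a⁻¹)) *
          ((1 + -rescale a y) ^ (7 / 16 : ℝ) * (1 + -rescale a y) ^ (-(3 / 2) : ℝ))) := by ring
    _ ≤ Real.exp (-(1 / (3 * a))) * (1 + -rescale a x) ^ (-(3 / 8) : ℝ) *
        (C * kernelMajorant a x y) := by
        rw [h1]
        exact mul_le_mul_of_nonneg_left (h a x y ha ha1 hy) (by positivity)
    _ = _ := by ring

theorem exp_neg_inv_third (a : ℝ) :
    Real.exp (-(1 / (3 * a))) = Real.exp (-(1 / 3 * a⁻¹)) := by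
  rw [one_div, mul_inv]; norm_num

theorem exists_weighted_le_left_middle : ∃ C : ℝ, 0 < C ∧ ∀ k a γ x y : ℝ, 0 < a → a ≤ 1 →
    1 + a * x ≤ 0 → 0 < 1 + a * y → y ≤ 0 →
    a ^ (-(1 / 3) : ℝ) * (1 + rescale a y) *
        Real.exp (-(2 / 3 * (a⁻¹ - decayExponent a y))) *
        (1 + -rescale a x) ^ (-(3 / 8) : ℝ) * weightIn k a γ y ≤
      C * (weightOut k a γ x * kernelMajorant a x y) := by
  obtain ⟨C, hC, h⟩ := exists_rpow_neg_mul_exp_le (r := 2) (c := 1 / 6)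
    (by norm_num) (by norm_num)
  refine ⟨8 * C, by positivity, fun k a γ x y ha ha1 hx hy hy0 => ?_⟩
  have hX := rescale_nonpos ha hx
  have hX0 : 0 < 1 + -rescale a x := by linarith
  have hθ := decayExponent_le_inv ha hy.le
  rw [weightIn_middle ha hy hy0, weightOut_of_nonpos ha hx, exp_neg_inv_third]
  have h1 : a ^ (-(1 / 3) : ℝ) * (1 + rescale a y) ≤ 2 * a ^ (-1 : ℝ) := by
    have h2 : shiftedScale a y ≤ 2 := by
      have := rpow_two_thirds_le_one ha ha1
      unfold shiftedScale
      nlinarith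
    rw [one_add_rescale ha, ← mul_assoc, ← Real.rpow_add ha, mul_comm]
    norm_num
    gcongr
  have h3 : a ^ (-1 : ℝ) = a ^ (-2 : ℝ) * a := by
    rw [← Real.rpow_add_one ha.ne']; norm_num
  -- In this zone 1 + ay ≤ 1, so the last term of the majorant is at least a/4, and a single factor
  -- a has to be gained.
  have h4 : (1 : ℝ) ≤ 4 * (1 + |1 + a * y|) ^ (-(17 / 16) : ℝ) := by
    rw [abs_of_pos hy]
    refine one_le_four_mul_one_add_rpow hy.le (by nlinarith) ?_
    rw [abs_neg, abs_of_pos] <;> norm_num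
  -- As θ(y) ≤ 1/a, the total rate (2/3)/a - θ(y)/6 is at least (1/2)/a = (1/3 + 1/6)/a.
  have h5 : Real.exp (-(2 / 3 * (a⁻¹ - decayExponent a y))) *
      Real.exp (-(1 / 2 * decayExponent a y)) ≤
      Real.exp (-(1 / 3 * a⁻¹)) * Real.exp (-(1 / 6 * a⁻¹)) := by
    rw [← Real.exp_add, ← Real.exp_add]
    exact Real.exp_le_exp.2 (by linarith)
  calc _ = a ^ (-(1 / 3) : ℝ) * (1 + rescale a y) * (1 + -rescale a x) ^ (-(3 / 8) : ℝ) *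
        (Real.exp (-(2 / 3 * (a⁻¹ - decayExponent a y))) *
        Real.exp (-(1 / 2 * decayExponent a y))) := by ring
    _ ≤ 2 * a ^ (-1 : ℝ) * (1 + -rescale a x) ^ (-(3 / 8) : ℝ) *
        (Real.exp (-(1 / 3 * a⁻¹)) * Real.exp (-(1 / 6 * a⁻¹))) := by gcongr
    _ = 2 * (Real.exp (-(1 / 3 * a⁻¹)) * (1 + -rescale a x) ^ (-(3 / 8) : ℝ)) *
        ((a ^ (-2 : ℝ) * Real.exp (-(1 / 6 * a⁻¹))) * (a * 1)) := by rw [h3]; ring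
    _ ≤ 2 * (Real.exp (-(1 / 3 * a⁻¹)) * (1 + -rescale a x) ^ (-(3 / 8) : ℝ)) *
        (C * (a * (4 * (1 + |1 + a * y|) ^ (-(17 / 16) : ℝ)))) := by
        gcongr
        exact h a ha
    _ = 8 * C * ((Real.exp (-(1 / 3 * a⁻¹)) * (1 + -rescale a x) ^ (-(3 / 8) : ℝ)) *
        (a * (1 + |1 + a * y|) ^ (-(17 / 16) : ℝ))) := by ring
    _ ≤ _ := by
        gcongr
        exact rpow_le_kernelMajorant a x y

theorem exists_weighted_le_left_right {k : ℝ} (hk : 0 ≤ k) :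
    ∃ C : ℝ, 0 < C ∧ ∀ a γ x y : ℝ, 0 < a → a ≤ 1 → |γ + 1 / 2| ≤ 1 / 8 →
    1 + a * x ≤ 0 → 0 < y →
    a ^ (-(1 / 3) : ℝ) * (1 + rescale a y) *
        Real.exp (-(2 / 3 * (a⁻¹ - decayExponent a y))) *
        (1 + -rescale a x) ^ (-(3 / 8) : ℝ) * weightIn k a γ y ≤
      C * (weightOut k a γ x * kernelMajorant a x y) := by
  obtain ⟨C, hC, h⟩ := exists_rpow_neg_mul_exp_le (r := 1) (c := 1 / 3)
    (by norm_num) (by norm_num)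
  obtain ⟨C', hC', h'⟩ := exists_one_add_rpow_le_exp (r := k + 1) (c := 23 / 24)
    (by linarith) (by norm_num)
  refine ⟨2 * C * C', by positivity, fun a γ x y ha ha1 hγ hx hy => ?_⟩
  have hγ' := abs_le_of_abs_add_half_le hγ
  have hX := rescale_nonpos ha hx
  have hX0 : 0 < 1 + -rescale a x := by linarith
  have hθ := decayExponent_le_neg ha hy.le
  have hw := weight_le_rpow (γ := γ) ha hk (by linarith) hy.le
  rw [weightIn_of_pos ha hy, weightOut_of_nonpos ha hx, exp_neg_inv_third]
  have h1 : a ^ (-(1 / 3) : ℝ) * (1 + rescale a y) ≤ a ^ (-1 : ℝ) * (2 * (1 + y)) := by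
    have h2 := shiftedScale_le ha ha1 y
    rw [abs_of_pos hy] at h2
    rw [one_add_rescale ha, ← mul_assoc, ← Real.rpow_add ha]
    norm_num
    gcongr
    linarith
  -- θ(y) ≤ -(3/2)y turns (2/3)(1/a - θ(y)) into at least (2/3)/a + y: one third of 1/a for w, one
  -- third for a^{-1}, and exp(-y) for the polynomial in y.
  have h5 : Real.exp (-(2 / 3 * (a⁻¹ - decayExponent a y))) ≤
      Real.exp (-(1 / 3 * a⁻¹)) * Real.exp (-(1 / 3 * a⁻¹)) * Real.exp (-y) := by
    rw [← Real.exp_add, ← Real.exp_add]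
    exact Real.exp_le_exp.2 (by linarith)
  have h6 : (1 + y) * (1 + y) ^ k * Real.exp (-y) ≤ C' * Real.exp (-(1 / 24 * |y|)) := by
    have h7 := h' y hy.le
    rw [Real.rpow_add_one (by positivity)] at h7
    calc _ ≤ (C' * Real.exp (23 / 24 * y)) * Real.exp (-y) := by
          refine mul_le_mul_of_nonneg_right ?_ (Real.exp_pos _).le
          linarith
      _ = _ := by
          rw [abs_of_pos hy, mul_assoc, ← Real.exp_add]
          ring_nf
  calc _ ≤ a ^ (-1 : ℝ) * (2 * (1 + y)) * (Real.exp (-(1 / 3 * a⁻¹)) *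
        Real.exp (-(1 / 3 * a⁻¹)) * Real.exp (-y)) *
        (1 + -rescale a x) ^ (-(3 / 8) : ℝ) * (1 + y) ^ k := by gcongr
    _ = 2 * (Real.exp (-(1 / 3 * a⁻¹)) * (1 + -rescale a x) ^ (-(3 / 8) : ℝ)) *
        ((a ^ (-1 : ℝ) * Real.exp (-(1 / 3 * a⁻¹))) *
        ((1 + y) * (1 + y) ^ k * Real.exp (-y))) := by ring
    _ ≤ 2 * (Real.exp (-(1 / 3 * a⁻¹)) * (1 + -rescale a x) ^ (-(3 / 8) : ℝ)) *
        (C * (C' * kernelMajorant a x y)) := by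
        have h7 : (1 + y) * (1 + y) ^ k * Real.exp (-y) ≤ C' * kernelMajorant a x y :=
          h6.trans (mul_le_mul_of_nonneg_left (exp_abs_le_kernelMajorant ha.le x y) hC'.le)
        exact mul_le_mul_of_nonneg_left (mul_le_mul (h a ha) h7 (by positivity) hC.le)
          (by positivity)
    _ = _ := by ring

theorem exists_weighted_le_right_of_left {k : ℝ} (hk : 0 ≤ k) :
    ∃ C : ℝ, 0 < C ∧ ∀ a γ x y : ℝ, 0 < a → a ≤ 1 → |γ + 1 / 2| ≤ 1 / 8 →
    0 < 1 + a * x → 1 + a * y ≤ 0 →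
    a ^ (-(1 / 3) : ℝ) * (1 + -rescale a y) ^ (1 / 16 : ℝ) *
        (1 + rescale a x) ^ (-1 - γ) * weightIn k a γ y ≤
      C * (weightOut k a γ x * kernelMajorant a x y) := by
  obtain ⟨C, hC, h⟩ := exists_tail_le_kernelMajorant
  refine ⟨C, hC, fun a γ x y ha ha1 hγ hx hy => ?_⟩
  have hγ' := abs_le_of_abs_add_half_le hγ
  have hX := rescale_nonneg ha hx.le
  have hY := rescale_nonpos ha hy
  have hY0 : 0 < 1 + -rescale a y := by linarith
  -- Two reasons: between the turning point and 0, θ(x) ≤ 1/a; for x > 0, 1 + x̂ ≥ 1 + ax with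
  -- exponent -1-γ < 0.
  have hw : Real.exp (-(1 / (3 * a))) * (1 + rescale a x) ^ (-1 - γ) ≤ weightOut k a γ x := by
    rcases le_or_gt x 0 with h0 | h0
    · rw [weightOut_middle ha hx h0, exp_neg_inv_third]
      have := decayExponent_le_inv ha hx.le
      exact (mul_le_of_le_one_right (Real.exp_pos _).le (Real.rpow_le_one_of_one_le_of_nonpos
        (by linarith) (by linarith))).trans (Real.exp_le_exp.2 (by linarith))
    · rw [weightOut_of_pos ha h0]
      refine le_trans ?_ (one_add_rpow_le_weight ha ha1 hk h0.le)
      refine (mul_le_of_le_one_left (by positivity) (Real.exp_le_one_iff.2 (by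
        rw [neg_nonpos]; positivity))).trans ?_
      refine Real.rpow_le_rpow_of_nonpos hx ?_ (by linarith)
      rw [rescale_eq ha]
      have h1 : 1 ≤ a ^ (-(2 / 3) : ℝ) :=
        Real.one_le_rpow_of_pos_of_le_one_of_nonpos ha ha1 (by norm_num)
      have := le_mul_of_one_le_left hx.le h1
      linarith
  rw [weightIn_of_nonpos ha hy, exp_half_inv]
  have h1 : (1 + -rescale a y) ^ (1 / 16 : ℝ) * (1 + -rescale a y) ^ (-(3 / 2) : ℝ) ≤
      (1 + -rescale a y) ^ (-(17 / 16) : ℝ) := by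
    rw [← Real.rpow_add hY0]
    exact Real.rpow_le_rpow_of_exponent_le (by linarith) (by norm_num)
  calc _ = Real.exp (-(1 / (3 * a))) * (1 + rescale a x) ^ (-1 - γ) *
        (a ^ (-(1 / 3) : ℝ) * Real.exp (-(1 / 6 * a⁻¹)) *
          ((1 + -rescale a y) ^ (1 / 16 : ℝ) * (1 + -rescale a y) ^ (-(3 / 2) : ℝ))) := by ring
    _ ≤ weightOut k a γ x * (a ^ (-(1 / 3) : ℝ) * Real.exp (-(1 / 6 * a⁻¹)) *
          (1 + -rescale a y) ^ (-(17 / 16) : ℝ)) := by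
        have := weightOut_pos k ha.le γ x
        gcongr
    _ ≤ weightOut k a γ x * (C * kernelMajorant a x y) :=
        mul_le_mul_of_nonneg_left (h a x y ha ha1 hy) (weightOut_pos k ha.le γ x).le
    _ = _ := by ring

theorem exists_poly_exp_abs : ∃ C : ℝ, 0 < C ∧ ∀ a x y : ℝ, 0 < a →
    (1 + |x|) * (1 + |y|) ^ 2 * Real.exp (-(1 / 12 * |x|)) * Real.exp (-(1 / 12 * |y|)) ≤
      C * kernelMajorant a x y := by
  obtain ⟨C, hC, h⟩ := exists_one_add_rpow_le_exp (r := 1) (c := 1 / 12) (by norm_num)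
    (by norm_num)
  obtain ⟨C', hC', h'⟩ := exists_one_add_rpow_le_exp (r := 2) (c := 1 / 24) (by norm_num)
    (by norm_num)
  refine ⟨C * C', by positivity, fun a x y ha => ?_⟩
  have h1 := h |x| (abs_nonneg x)
  have h2 := h' |y| (abs_nonneg y)
  rw [Real.rpow_one] at h1
  rw [Real.rpow_two] at h2
  calc _ ≤ (C * Real.exp (1 / 12 * |x|)) * (C' * Real.exp (1 / 24 * |y|)) *
        Real.exp (-(1 / 12 * |x|)) * Real.exp (-(1 / 12 * |y|)) := by gcongr
    _ = C * C' * (Real.exp (1 / 12 * |x|) * Real.exp (-(1 / 12 * |x|)) *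
        (Real.exp (1 / 24 * |y|) * Real.exp (-(1 / 12 * |y|)))) := by ring
    _ = C * C' * Real.exp (-(1 / 24 * |y|)) := by
        rw [← Real.exp_add, ← Real.exp_add, ← Real.exp_add]
        ring_nf
    _ ≤ _ := by
        gcongr
        exact exp_abs_le_kernelMajorant ha.le x y

/-- The bound of `exists_greenKernel_bounds` to the right of the turning point. -/
def kernelBoundRight (a γ x y : ℝ) : ℝ :=
  shiftedScale a x ^ (γ / 2 - 1 / 4) * shiftedScale a y ^ (-γ / 2 - 1 / 4) *
    Real.exp (-(2 / 3 * |decayExponent a x - decayExponent a y|)) +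
    if y ≤ x then a * shiftedScale a x ^ (-1 - γ) * shiftedScale a y ^ (-1 + γ) else 0

theorem add_ite_le {p : Prop} [Decidable p] {u v b B : ℝ} (h1 : u * b ≤ B)
    (hB : 0 ≤ B) (h2 : p → v * b ≤ B) : (u + if p then v else 0) * b ≤ 2 * B := by
  split_ifs with h
  · linarith [h2 h]
  · linarith

theorem exists_weighted_le_middle_middle : ∃ C : ℝ, 0 < C ∧ ∀ k a γ x y : ℝ, 0 < a → a ≤ 1 →
    |γ + 1 / 2| ≤ 1 / 8 → 0 < 1 + a * x → x ≤ 0 → 0 < 1 + a * y → y ≤ 0 →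
    kernelBoundRight a γ x y * weightIn k a γ y ≤
      C * (weightOut k a γ x * kernelMajorant a x y) := by
  obtain ⟨C, hC, h⟩ := exists_poly_exp_abs
  refine ⟨2 * (3 * C), by positivity, fun k a γ x y ha ha1 hγ hx hx0 hy hy0 => ?_⟩
  have hγ' := abs_le_of_abs_add_half_le hγ
  have hθx := neg_le_decayExponent ha hx.le hx0
  have hθy := neg_le_decayExponent ha hy.le hy0
  have hm1 : shiftedScale a x ^ (γ / 2 - 1 / 4) ≤ (1 + |x|) ^ 1 :=
    shiftedScale_rpow_le_pow ha ha1 hx.le hx0 (by linarith) (by push_cast; linarith)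
  have hm2 : shiftedScale a y ^ (-γ / 2 - 1 / 4) ≤ 3 * (1 + |y|) :=
    shiftedScale_rpow_le_of_middle ha ha1 hy.le hy0 (abs_le.2 ⟨by linarith, by linarith⟩)
  have hm3 : shiftedScale a x ^ (-1 - γ) ≤ (1 + |x|) ^ 1 :=
    shiftedScale_rpow_le_pow ha ha1 hx.le hx0 (by linarith) (by push_cast; linarith)
  have hm4 : shiftedScale a y ^ (-1 + γ) ≤ (1 + |y|) ^ 2 :=
    shiftedScale_rpow_le_pow ha ha1 hy.le hy0 (by linarith) (by push_cast; linarith)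
  have hmx := shiftedScale_pos ha hx.le
  have hmy := shiftedScale_pos ha hy.le
  have hM := kernelMajorant_nonneg ha.le x y
  rw [pow_one] at hm1 hm3
  have hy1 : 1 + |y| ≤ (1 + |y|) ^ 2 := by nlinarith [abs_nonneg y]
  rw [weightIn_middle ha hy hy0, weightOut_middle ha hx hx0, kernelBoundRight, mul_assoc 2]
  refine add_ite_le ?_ (by positivity) fun hyx => ?_
  -- Use (2/3)|d| ≥ (5/12)d for d = θ(x) - θ(y): the rate is at least (5/12)θ(x) + θ(y)/12, that is
  -- θ(x)/3 plus one twelfth of θ(x) and of θ(y).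
  · have h5 : Real.exp (-(2 / 3 * |decayExponent a x - decayExponent a y|)) *
        Real.exp (-(1 / 2 * decayExponent a y)) ≤
        Real.exp (-(1 / 3 * decayExponent a x)) *
          (Real.exp (-(1 / 12 * |x|)) * Real.exp (-(1 / 12 * |y|))) := by
      rw [← Real.exp_add, ← Real.exp_add, ← Real.exp_add, abs_of_nonpos hx0, abs_of_nonpos hy0]
      refine Real.exp_le_exp.2 ?_
      have := le_abs_self (decayExponent a x - decayExponent a y)
      have := neg_abs_le (decayExponent a x - decayExponent a y)
      linarith
    calc _ = shiftedScale a x ^ (γ / 2 - 1 / 4) * shiftedScale a y ^ (-γ / 2 - 1 / 4) *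
          (Real.exp (-(2 / 3 * |decayExponent a x - decayExponent a y|)) *
          Real.exp (-(1 / 2 * decayExponent a y))) := by ring
      _ ≤ (1 + |x|) * (3 * (1 + |y|) ^ 2) * (Real.exp (-(1 / 3 * decayExponent a x)) *
          (Real.exp (-(1 / 12 * |x|)) * Real.exp (-(1 / 12 * |y|)))) := by
          gcongr
          exact hm2.trans (by linarith)
      _ = 3 * Real.exp (-(1 / 3 * decayExponent a x)) * ((1 + |x|) * (1 + |y|) ^ 2 *
          Real.exp (-(1 / 12 * |x|)) * Real.exp (-(1 / 12 * |y|))) := by ring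
      _ ≤ 3 * Real.exp (-(1 / 3 * decayExponent a x)) * (C * kernelMajorant a x y) := by
          exact mul_le_mul_of_nonneg_left (h a x y ha) (by positivity)
      _ = _ := by ring
  · have hθ : decayExponent a x ≤ decayExponent a y := by
      unfold decayExponent
      gcongr
    have h5 : Real.exp (-(1 / 2 * decayExponent a y)) ≤
        Real.exp (-(1 / 3 * decayExponent a x)) *
          (Real.exp (-(1 / 12 * |x|)) * Real.exp (-(1 / 12 * |y|))) := by
      rw [← Real.exp_add, ← Real.exp_add, abs_of_nonpos hx0, abs_of_nonpos hy0]
      exact Real.exp_le_exp.2 (by linarith)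
    calc _ ≤ 1 * (1 + |x|) * (1 + |y|) ^ 2 * (Real.exp (-(1 / 3 * decayExponent a x)) *
          (Real.exp (-(1 / 12 * |x|)) * Real.exp (-(1 / 12 * |y|)))) := by gcongr
      _ = 1 * Real.exp (-(1 / 3 * decayExponent a x)) * ((1 + |x|) * (1 + |y|) ^ 2 *
          Real.exp (-(1 / 12 * |x|)) * Real.exp (-(1 / 12 * |y|))) := by ring
      _ ≤ 3 * Real.exp (-(1 / 3 * decayExponent a x)) * (C * kernelMajorant a x y) := by
          exact mul_le_mul (by gcongr; norm_num) (h a x y ha) (by positivity) (by positivity)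
      _ = _ := by ring

theorem exists_weighted_le_middle_right {k : ℝ} (hk : 0 ≤ k) :
    ∃ C : ℝ, 0 < C ∧ ∀ a γ x y : ℝ, 0 < a → a ≤ 1 →
    |γ + 1 / 2| ≤ 1 / 8 → 0 < 1 + a * x → x ≤ 0 → 0 < y →
    kernelBoundRight a γ x y * weightIn k a γ y ≤
      C * (weightOut k a γ x * kernelMajorant a x y) := by
  obtain ⟨C, hC, h⟩ := exists_one_add_rpow_le_exp (r := 1) (c := 1 / 3) (by norm_num)
    (by norm_num)
  obtain ⟨C', hC', h'⟩ := exists_one_add_rpow_le_exp (r := k + 1) (c := 23 / 24)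
    (by linarith) (by norm_num)
  refine ⟨3 * C * C', by positivity, fun a γ x y ha ha1 hγ hx hx0 hy => ?_⟩
  have hγ' := abs_le_of_abs_add_half_le hγ
  have hθx := neg_le_decayExponent ha hx.le hx0
  have hθy := decayExponent_le_neg ha hy.le
  have hm1 : shiftedScale a x ^ (γ / 2 - 1 / 4) ≤ (1 + |x|) ^ 1 :=
    shiftedScale_rpow_le_pow ha ha1 hx.le hx0 (by linarith) (by push_cast; linarith)
  have hm2 : shiftedScale a y ^ (-γ / 2 - 1 / 4) ≤ 3 * (1 + |y|) :=
    shiftedScale_rpow_le_of_nonneg ha ha1 hy.le (abs_le.2 ⟨by linarith, by linarith⟩)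
  have hmx := shiftedScale_pos ha hx.le
  have hmy := shiftedScale_pos ha (one_add_mul_pos_of_pos ha hy).le
  have hw := weight_le_rpow (γ := γ) ha hk (by linarith) hy.le
  have h1 := h |x| (abs_nonneg x)
  have h2 := h' |y| (abs_nonneg y)
  rw [Real.rpow_one] at h1
  rw [pow_one] at hm1
  rw [Real.rpow_add_one (by positivity)] at h2
  rw [kernelBoundRight, if_neg (by linarith), add_zero, weightIn_of_pos ha hy,
    weightOut_middle ha hx hx0]
  have h5 : Real.exp (-(2 / 3 * |decayExponent a x - decayExponent a y|)) ≤
      Real.exp (-(1 / 3 * decayExponent a x)) *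
        (Real.exp (-(1 / 3 * |x|)) * Real.exp (-|y|)) := by
    rw [← Real.exp_add, ← Real.exp_add, abs_of_nonpos hx0, abs_of_pos hy]
    refine Real.exp_le_exp.2 ?_
    have := le_abs_self (decayExponent a x - decayExponent a y)
    linarith
  have hyy : (1 + y) ^ k = (1 + |y|) ^ k := by rw [abs_of_pos hy]
  rw [hyy] at hw
  calc _ ≤ (1 + |x|) * (3 * (1 + |y|)) * (Real.exp (-(1 / 3 * decayExponent a x)) *
        (Real.exp (-(1 / 3 * |x|)) * Real.exp (-|y|))) * (1 + |y|) ^ k := by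
        rw [hyy]
        gcongr
    _ = 3 * Real.exp (-(1 / 3 * decayExponent a x)) * ((1 + |x|) * Real.exp (-(1 / 3 * |x|))) *
        ((1 + |y|) ^ k * (1 + |y|) * Real.exp (-|y|)) := by ring
    _ ≤ 3 * Real.exp (-(1 / 3 * decayExponent a x)) *
        ((C * Real.exp (1 / 3 * |x|)) * Real.exp (-(1 / 3 * |x|))) *
        ((C' * Real.exp (23 / 24 * |y|)) * Real.exp (-|y|)) := by gcongr
    _ = 3 * C * C' * (Real.exp (-(1 / 3 * decayExponent a x)) *
        (Real.exp (1 / 3 * |x|) * Real.exp (-(1 / 3 * |x|)) *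
          (Real.exp (23 / 24 * |y|) * Real.exp (-|y|)))) := by ring
    _ = 3 * C * C' * (Real.exp (-(1 / 3 * decayExponent a x)) *
        Real.exp (-(1 / 24 * |y|))) := by
        congr 2
        rw [← Real.exp_add, ← Real.exp_add, ← Real.exp_add]
        ring_nf
    _ ≤ _ := by
        gcongr
        exact exp_abs_le_kernelMajorant ha.le x y

/-- Decay in y comes from w_i alone. In x, the exponential part is below exp(-x), hence below w, and
the algebraic part has the power -1-γ of 1 + ax, again below w. -/
theorem exists_weighted_le_right_middle {k : ℝ} (hk : 0 ≤ k) :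
    ∃ C : ℝ, 0 < C ∧ ∀ a γ x y : ℝ, 0 < a → a ≤ 1 →
    |γ + 1 / 2| ≤ 1 / 8 → 0 < x → 0 < 1 + a * y → y ≤ 0 →
    kernelBoundRight a γ x y * weightIn k a γ y ≤
      C * (weightOut k a γ x * kernelMajorant a x y) := by
  obtain ⟨C, hC, h⟩ := exists_one_add_rpow_le_exp (r := 2) (c := 11 / 24) (by norm_num)
    (by norm_num)
  refine ⟨2 * (3 * C), by positivity, fun a γ x y ha ha1 hγ hx hy hy0 => ?_⟩
  have hγ' := abs_le_of_abs_add_half_le hγ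
  have hθy := neg_le_decayExponent ha hy.le hy0
  have hθx := decayExponent_le_neg ha hx.le
  have hm1 : shiftedScale a x ^ (γ / 2 - 1 / 4) ≤ 1 :=
    Real.rpow_le_one_of_one_le_of_nonpos (one_le_shiftedScale ha hx.le) (by linarith)
  have hm2 : shiftedScale a y ^ (-γ / 2 - 1 / 4) ≤ 3 * (1 + |y|) :=
    shiftedScale_rpow_le_of_middle ha ha1 hy.le hy0 (abs_le.2 ⟨by linarith, by linarith⟩)
  have hm3 : shiftedScale a x ^ (-1 - γ) ≤ (1 + a * x) ^ (-1 - γ) :=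
    Real.rpow_le_rpow_of_nonpos (by positivity) (one_add_le_shiftedScale ha x) (by linarith)
  have hm4 : shiftedScale a y ^ (-1 + γ) ≤ (1 + |y|) ^ 2 :=
    shiftedScale_rpow_le_pow ha ha1 hy.le hy0 (by linarith) (by push_cast; linarith)
  have hmx := shiftedScale_pos ha (one_add_mul_pos_of_pos ha hx).le
  have hmy := shiftedScale_pos ha hy.le
  have hM := kernelMajorant_nonneg ha.le x y
  have hy1 : 1 + |y| ≤ (1 + |y|) ^ 2 := by nlinarith [abs_nonneg y]
  have hw1 := exp_neg_le_weight (γ := γ) ha ha1 hk (by linarith) hx.le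
  have hw2 := one_add_rpow_le_weight (γ := γ) ha ha1 hk hx.le
  rw [weightIn_middle ha hy hy0, weightOut_of_pos ha hx, kernelBoundRight, mul_assoc 2]
  set w := (1 + x) ^ k * (1 + a * x) ^ (-1 - γ - k)
  have hw0 : 0 < w := (Real.exp_pos _).trans_le hw1
  have hexp : Real.exp (-(1 / 2 * decayExponent a y)) ≤ Real.exp (-(1 / 2 * |y|)) := by
    rw [abs_of_nonpos hy0]
    exact Real.exp_le_exp.2 (by linarith)
  have hpoly : (1 + |y|) ^ 2 * Real.exp (-(1 / 2 * |y|)) ≤ C * kernelMajorant a x y := by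
    have h1 := h |y| (abs_nonneg y)
    rw [Real.rpow_two] at h1
    calc _ ≤ (C * Real.exp (11 / 24 * |y|)) * Real.exp (-(1 / 2 * |y|)) := by gcongr
      _ = C * Real.exp (-(1 / 24 * |y|)) := by
          rw [mul_assoc, ← Real.exp_add]; ring_nf
      _ ≤ _ := by
          gcongr
          exact exp_abs_le_kernelMajorant ha.le x y
  refine add_ite_le ?_ (by positivity) fun hyx => ?_
  · have h5 : Real.exp (-(2 / 3 * |decayExponent a x - decayExponent a y|)) ≤ w := by
      refine le_trans (Real.exp_le_exp.2 ?_) hw1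
      have := neg_abs_le (decayExponent a x - decayExponent a y)
      linarith
    calc _ ≤ 1 * (3 * (1 + |y|) ^ 2) * w * Real.exp (-(1 / 2 * |y|)) := by
          gcongr
          exact hm2.trans (by linarith)
      _ = 3 * w * ((1 + |y|) ^ 2 * Real.exp (-(1 / 2 * |y|))) := by ring
      _ ≤ 3 * w * (C * kernelMajorant a x y) := by gcongr
      _ = _ := by ring
  · calc _ ≤ 1 * w * (1 + |y|) ^ 2 * Real.exp (-(1 / 2 * |y|)) := by
          gcongr
          exact hm3.trans hw2
      _ = 1 * w * ((1 + |y|) ^ 2 * Real.exp (-(1 / 2 * |y|))) := by ring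
      _ ≤ 3 * w * (C * kernelMajorant a x y) := by
          gcongr
          norm_num
      _ = _ := by ring

/-- In the exponential term, the scale ratio and the weight ratio are polynomial in |x-y| and lose
to exp(-|x-y|). In the algebraic term the powers of 1 + ay combine so that γ drops out, leaving
a(1+ay)^{-2}. -/
theorem exists_weighted_le_right_right {k : ℝ} (hk : 0 ≤ k) :
    ∃ C : ℝ, 0 < C ∧ ∀ a γ x y : ℝ, 0 < a → a ≤ 1 →
    |γ + 1 / 2| ≤ 1 / 8 → 0 < x → 0 < y →
    kernelBoundRight a γ x y * weightIn k a γ y ≤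
      C * (weightOut k a γ x * kernelMajorant a x y) := by
  obtain ⟨C, hC, h⟩ := exists_one_add_rpow_le_exp (r := 2 * k + 2) (c := 1 / 2) (by linarith)
    (by norm_num)
  refine ⟨2 * (2 * C + 4), by positivity, fun a γ x y ha ha1 hγ hx hy => ?_⟩
  have hγ' := abs_le_of_abs_add_half_le hγ
  have hpx := one_add_mul_pos_of_pos ha hx
  have hpy := one_add_mul_pos_of_pos ha hy
  have hmx1 := one_le_shiftedScale ha hx.le
  have hmy1 := one_le_shiftedScale ha hy.le
  have hmx := shiftedScale_pos ha hpx.le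
  have hmy := shiftedScale_pos ha hpy.le
  have hM := kernelMajorant_nonneg ha.le x y
  have hd := abs_nonneg (x - y)
  have hw := weight_le_mul_weight (γ := γ) ha ha1 hk (by linarith) (by linarith) hx.le hy.le
  rw [weightIn_of_pos ha hy, weightOut_of_pos ha hx, kernelBoundRight, mul_assoc 2]
  refine add_ite_le ?_ (by positivity) fun hyx => ?_
  · have h1 : shiftedScale a x ^ (γ / 2 - 1 / 4) * shiftedScale a y ^ (-γ / 2 - 1 / 4) ≤
        2 * (1 + |x - y|) := by
      have h2 : shiftedScale a x ^ (γ / 2 - 1 / 4) ≤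
          (shiftedScale a x ^ (-γ / 2 - 1 / 4))⁻¹ := by
        rw [← Real.rpow_neg hmx.le]
        exact Real.rpow_le_rpow_of_exponent_le hmx1 (by linarith)
      have h3 : shiftedScale a y / shiftedScale a x ≤ 1 + |x - y| := by
        rw [div_le_iff₀ hmx, mul_comm]
        exact shiftedScale_le_mul ha ha1 hx.le y
      have h4 : (shiftedScale a y / shiftedScale a x)⁻¹ ≤ 1 + |x - y| := by
        rw [inv_div, div_le_iff₀ hmy, mul_comm, abs_sub_comm]
        exact shiftedScale_le_mul ha ha1 hy.le x
      calc _ ≤ (shiftedScale a x ^ (-γ / 2 - 1 / 4))⁻¹ *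
            shiftedScale a y ^ (-γ / 2 - 1 / 4) := by gcongr
        _ = (shiftedScale a y / shiftedScale a x) ^ (-γ / 2 - 1 / 4) := by
            rw [Real.div_rpow hmy.le hmx.le]; ring
        _ ≤ _ := rpow_le_add_inv (by positivity) (abs_le.2 ⟨by linarith, by linarith⟩)
        _ ≤ _ := by linarith
    have h5 : Real.exp (-(2 / 3 * |decayExponent a x - decayExponent a y|)) ≤
        Real.exp (-|x - y|) := by
      refine Real.exp_le_exp.2 ?_
      rcases le_total x y with hxy | hxy
      · have := sub_le_decayExponent_sub ha hx.le hxy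
        have := le_abs_self (decayExponent a x - decayExponent a y)
        rw [abs_of_nonpos (by linarith : x - y ≤ 0)]
        linarith
      · have := sub_le_decayExponent_sub ha hy.le hxy
        have := neg_abs_le (decayExponent a x - decayExponent a y)
        rw [abs_of_nonneg (by linarith : 0 ≤ x - y)]
        linarith
    set w := (1 + x) ^ k * (1 + a * x) ^ (-1 - γ - k)
    have hw0 : 0 < w := by positivity
    have h6 : (1 + |x - y|) * (1 + |x - y|) ^ (2 * k + 1) * Real.exp (-|x - y|) ≤
        C * kernelMajorant a x y := by
      have h7 := h |x - y| hd
      rw [show 2 * k + 2 = (2 * k + 1) + 1 by ring, Real.rpow_add_one (by positivity)] at h7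
      calc _ ≤ (C * Real.exp (1 / 2 * |x - y|)) * Real.exp (-|x - y|) := by
            refine mul_le_mul_of_nonneg_right ?_ (Real.exp_pos _).le
            linarith
        _ = C * Real.exp (-(1 / 2 * |x - y|)) := by
            rw [mul_assoc, ← Real.exp_add]; ring_nf
        _ ≤ _ := by
            gcongr
            exact exp_dist_le_kernelMajorant ha.le x y
    calc _ ≤ (2 * (1 + |x - y|)) * Real.exp (-|x - y|) *
          ((1 + |x - y|) ^ (2 * k + 1) * w) := by gcongr
      _ = 2 * w * ((1 + |x - y|) * (1 + |x - y|) ^ (2 * k + 1) * Real.exp (-|x - y|)) := by ring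
      _ ≤ 2 * w * (C * kernelMajorant a x y) := by gcongr
      _ = 2 * C * (w * kernelMajorant a x y) := by ring
      _ ≤ _ := by gcongr; linarith
  · have h1 : shiftedScale a x ^ (-1 - γ) ≤ (1 + a * x) ^ (-1 - γ) :=
      Real.rpow_le_rpow_of_nonpos hpx (one_add_le_shiftedScale ha x) (by linarith)
    have h2 : shiftedScale a y ^ (-1 + γ) ≤ (1 + a * y) ^ (-1 + γ) :=
      Real.rpow_le_rpow_of_nonpos hpy (one_add_le_shiftedScale ha y) (by linarith)
    have h3 : (1 + a * y) ^ (-1 + γ) * (1 + a * y) ^ (-1 - γ - k) =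
        (1 + a * y) ^ (-2 : ℝ) * (1 + a * y) ^ (-k) := by
      rw [← Real.rpow_add hpy, ← Real.rpow_add hpy]; ring_nf
    -- For a ≤ 1 the quotient (1+y)/(1+ay) increases in y, and the algebraic term occurs only for y
    -- ≤ x.
    have h4 : (1 + y) ^ k * (1 + a * y) ^ (-k) ≤ (1 + x) ^ k * (1 + a * x) ^ (-k) := by
      rw [Real.rpow_neg hpy.le, Real.rpow_neg hpx.le, ← div_eq_mul_inv, ← div_eq_mul_inv,
        ← Real.div_rpow (by positivity) hpy.le, ← Real.div_rpow (by positivity) hpx.le]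
      gcongr ?_ ^ k
      rw [div_le_div_iff₀ hpy hpx]
      nlinarith
    have h5 : (1 + a * y) ^ (-2 : ℝ) ≤ 4 * (1 + |1 + a * y|) ^ (-(17 / 16) : ℝ) := by
      rw [abs_of_pos hpy]
      have hay : 1 ≤ 1 + a * y := by nlinarith
      refine (Real.rpow_le_rpow_of_exponent_le hay (by norm_num)).trans
        (rpow_le_four_mul_one_add_rpow hay ?_)
      rw [abs_neg, abs_of_pos] <;> norm_num
    have h6 : (1 + a * x) ^ (-1 - γ) * (1 + a * x) ^ (-k) = (1 + a * x) ^ (-1 - γ - k) := by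
      rw [← Real.rpow_add hpx]; ring_nf
    calc _ ≤ a * (1 + a * x) ^ (-1 - γ) * (1 + a * y) ^ (-1 + γ) *
          ((1 + y) ^ k * (1 + a * y) ^ (-1 - γ - k)) := by gcongr
      _ = a * (1 + a * x) ^ (-1 - γ) * (1 + a * y) ^ (-2 : ℝ) *
          ((1 + y) ^ k * (1 + a * y) ^ (-k)) := by
          linear_combination (a * (1 + a * x) ^ (-1 - γ) * (1 + y) ^ k) * h3
      _ ≤ a * (1 + a * x) ^ (-1 - γ) * (4 * (1 + |1 + a * y|) ^ (-(17 / 16) : ℝ)) *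
          ((1 + x) ^ k * (1 + a * x) ^ (-k)) := by gcongr
      _ = 4 * ((1 + x) ^ k * (1 + a * x) ^ (-1 - γ - k)) *
          (a * (1 + |1 + a * y|) ^ (-(17 / 16) : ℝ)) := by
          rw [← h6]; ring
      _ ≤ (2 * C + 4) * ((1 + x) ^ k * (1 + a * x) ^ (-1 - γ - k)) * kernelMajorant a x y := by
          gcongr
          · linarith
          · exact rpow_le_kernelMajorant a x y
      _ = _ := by ring

theorem exists_abs_greenKernel_mul_weightIn_le {k : ℝ} (hk : 0 ≤ k) :
    ∃ C : ℝ, 0 < C ∧ ∀ a γ x y : ℝ, 0 < a → a ≤ 1 → |γ + 1 / 2| ≤ 1 / 8 →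
      |greenKernel a γ x y| * weightIn k a γ y ≤
        C * (weightOut k a γ x * kernelMajorant a x y) := by
  obtain ⟨C, hC, hK⟩ := exists_greenKernel_bounds
  obtain ⟨C₁, h₁, H₁⟩ := exists_weighted_le_left_left
  obtain ⟨C₂, h₂, H₂⟩ := exists_weighted_le_left_middle
  obtain ⟨C₃, h₃, H₃⟩ := exists_weighted_le_left_right hk
  obtain ⟨C₄, h₄, H₄⟩ := exists_weighted_le_right_of_left hk
  obtain ⟨C₅, h₅, H₅⟩ := exists_weighted_le_middle_middle
  obtain ⟨C₆, h₆, H₆⟩ := exists_weighted_le_middle_right hk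
  obtain ⟨C₇, h₇, H₇⟩ := exists_weighted_le_right_middle hk
  obtain ⟨C₈, h₈, H₈⟩ := exists_weighted_le_right_right hk
  set S := C₁ + C₂ + C₃ + C₄ + C₅ + C₆ + C₇ + C₈ with hS
  refine ⟨C * S, by positivity, fun a γ x y ha ha1 hγ => ?_⟩
  obtain ⟨K₁, K₂, K₃, K₄⟩ := hK a γ x y ha hγ
  have hwi := weightIn_pos k ha.le γ y
  have hwM := mul_nonneg (weightOut_pos k ha.le γ x).le (kernelMajorant_nonneg ha.le x y)
  have key : ∀ {B c : ℝ}, |greenKernel a γ x y| ≤ C * B →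
      B * weightIn k a γ y ≤ c * (weightOut k a γ x * kernelMajorant a x y) → c ≤ S →
      |greenKernel a γ x y| * weightIn k a γ y ≤
        C * S * (weightOut k a γ x * kernelMajorant a x y) := by
    intro B c h h' hc
    calc _ ≤ C * B * weightIn k a γ y := by gcongr
      _ = C * (B * weightIn k a γ y) := by ring
      _ ≤ C * (c * (weightOut k a γ x * kernelMajorant a x y)) := by gcongr
      _ ≤ C * (S * (weightOut k a γ x * kernelMajorant a x y)) := by gcongr
      _ = _ := by ring
  rcases le_or_gt (1 + a * x) 0 with hx | hx
  · rcases le_or_gt (1 + a * y) 0 with hy | hy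
    · exact key (K₂ hx hy) (H₁ k a γ x y ha ha1 hx hy) (by linarith)
    · rcases le_or_gt y 0 with hy0 | hy0
      · exact key (K₃ hx hy) (H₂ k a γ x y ha ha1 hx hy hy0) (by linarith)
      · exact key (K₃ hx hy) (H₃ a γ x y ha ha1 hγ hx hy0) (by linarith)
  · rcases le_or_gt (1 + a * y) 0 with hy | hy
    · exact key (K₄ hx hy) (H₄ a γ x y ha ha1 hγ hx hy) (by linarith)
    · have hK₁ := K₁ hx.le hy.le
      rw [← kernelBoundRight] at hK₁
      rcases le_or_gt x 0 with hx0 | hx0 <;> rcases le_or_gt y 0 with hy0 | hy0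
      · exact key hK₁ (H₅ k a γ x y ha ha1 hγ hx hx0 hy hy0) (by linarith)
      · exact key hK₁ (H₆ a γ x y ha ha1 hγ hx hx0 hy0) (by linarith)
      · exact key hK₁ (H₇ a γ x y ha ha1 hγ hx0 hy hy0) (by linarith)
      · exact key hK₁ (H₈ a γ x y ha ha1 hγ hx0 hy0) (by linarith)

/-! ### The limit case a = 0, uniform integrability and measurability -/

/-- Half of |x-y| is kept for the majorant; the other half, by the triangle inequality, turns the
decay 3/4 or 0 in y into the decay 1/2 or 0 in x. -/
theorem abs_greenKernel_zero_mul_weightIn_le (k γ x y : ℝ) :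
    |greenKernel 0 γ x y| * weightIn k 0 γ y ≤ weightOut k 0 γ x * kernelMajorant 0 x y := by
  have hw := (weightOut_pos k le_rfl γ x).le
  refine le_trans ?_ (mul_le_mul_of_nonneg_left (exp_dist_le_kernelMajorant le_rfl x y) hw)
  have hK : |greenKernel 0 γ x y| ≤ Real.exp (-|x - y|) := by
    rw [greenKernel, if_pos rfl, abs_of_pos (by positivity)]
    have := Real.exp_pos (-|x - y|)
    linarith
  refine (mul_le_mul_of_nonneg_right hK (weightIn_pos k le_rfl γ y).le).trans ?_
  have hd := abs_nonneg (x - y)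
  rw [weightIn, if_pos rfl, weightOut, if_pos rfl]
  split_ifs with hy hx hx
  · rw [← Real.exp_add, ← Real.exp_add]
    refine Real.exp_le_exp.2 ?_
    have := abs_sub_abs_le_abs_sub x y
    have := abs_nonneg y
    linarith
  · rw [one_mul, ← Real.exp_add]
    refine Real.exp_le_exp.2 ?_
    have := abs_nonneg y
    linarith
  · rw [mul_one, ← Real.exp_add]
    refine Real.exp_le_exp.2 ?_
    rw [abs_of_neg hx, abs_of_neg (by linarith : x - y < 0)]
    linarith
  · rw [mul_one, one_mul]
    exact Real.exp_le_exp.2 (by linarith)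

theorem integrable_exp_neg_mul_abs {c : ℝ} (hc : 0 < c) :
    Integrable fun u : ℝ => Real.exp (-(c * |u|)) := by
  obtain ⟨C, hC, h⟩ := exists_one_add_rpow_le_exp (r := 2) zero_le_two hc
  have hi : Integrable fun u : ℝ => C * (1 + ‖u‖) ^ (-(2 : ℝ)) :=
    (integrable_one_add_norm (by simp)).const_mul C
  refine hi.mono' (Continuous.aestronglyMeasurable (by fun_prop))
    (Eventually.of_forall fun u => ?_)
  have h1 := h |u| (abs_nonneg u)
  rw [Real.norm_of_nonneg (Real.exp_pos _).le, Real.exp_neg, Real.norm_eq_abs,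
    Real.rpow_neg (by positivity), ← div_eq_mul_inv, inv_le_comm₀ (Real.exp_pos _) (by positivity),
    inv_div, div_le_iff₀ hC]
  linarith

/-- Only the last term depends on a; for a > 0 the substitution u = ay removes a from its integral,
and at a = 0 it vanishes. The first term is a translate, so x drops out too. -/
theorem exists_integral_kernelMajorant_le : ∃ C : ℝ, 0 < C ∧ ∀ a x : ℝ, 0 ≤ a →
    Integrable (kernelMajorant a x) ∧ ∫ y, kernelMajorant a x y ≤ C := by
  have h1 := integrable_exp_neg_mul_abs (c := 1 / 2) (by norm_num)
  have h2 := integrable_exp_neg_mul_abs (c := 1 / 24) (by norm_num)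
  have h3 : Integrable fun u : ℝ => (1 + |u|) ^ (-(17 / 16) : ℝ) := by
    simpa using integrable_one_add_norm (E := ℝ) (r := 17 / 16) (μ := volume) (by norm_num)
  set I₁ := ∫ u : ℝ, Real.exp (-(1 / 2 * |u|))
  set I₂ := ∫ u : ℝ, Real.exp (-(1 / 24 * |u|))
  set I₃ := ∫ u : ℝ, (1 + |u|) ^ (-(17 / 16) : ℝ)
  have hI₁ : 0 ≤ I₁ := integral_nonneg fun u => by positivity
  have hI₂ : 0 ≤ I₂ := integral_nonneg fun u => by positivity
  have hI₃ : 0 ≤ I₃ := integral_nonneg fun u => by positivity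
  refine ⟨I₁ + I₂ + I₃ + 1, by positivity, fun a x ha => ?_⟩
  have e1 : Integrable fun y : ℝ => Real.exp (-(1 / 2 * |x - y|)) := h1.comp_sub_left x
  have e1' : ∫ y : ℝ, Real.exp (-(1 / 2 * |x - y|)) = I₁ :=
    integral_sub_left_eq_self (fun u : ℝ => Real.exp (-(1 / 2 * |u|))) volume x
  have e3 : Integrable (fun y : ℝ => a * (1 + |1 + a * y|) ^ (-(17 / 16) : ℝ)) ∧
      ∫ y : ℝ, a * (1 + |1 + a * y|) ^ (-(17 / 16) : ℝ) ≤ I₃ := by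
    rcases ha.eq_or_lt with rfl | ha
    · simpa using hI₃
    have h4 : Integrable fun u : ℝ => (1 + |1 + u|) ^ (-(17 / 16) : ℝ) := h3.comp_add_left 1
    refine ⟨(h4.comp_mul_left' ha.ne').const_mul a, le_of_eq ?_⟩
    rw [integral_const_mul,
      Measure.integral_comp_mul_left (fun u : ℝ => (1 + |1 + u|) ^ (-(17 / 16) : ℝ)) a,
      integral_add_left_eq_self (fun u : ℝ => (1 + |u|) ^ (-(17 / 16) : ℝ)) 1,
      abs_of_pos (inv_pos.2 ha), smul_eq_mul, mul_inv_cancel_left₀ ha.ne']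
  have e12 : Integrable fun y : ℝ =>
      Real.exp (-(1 / 2 * |x - y|)) + Real.exp (-(1 / 24 * |y|)) := e1.add h2
  refine ⟨e12.add e3.1, ?_⟩
  have : ∫ y, kernelMajorant a x y = (I₁ + I₂) +
      ∫ y : ℝ, a * (1 + |1 + a * y|) ^ (-(17 / 16) : ℝ) := by
    simp only [kernelMajorant]
    rw [integral_add e12 e3.1, integral_add e1 h2, e1']
  linarith [e3.2]

theorem measurable_greenKernel {a γ : ℝ} (hγ : |γ + 1 / 2| ≤ 1 / 8) (x : ℝ) :
    Measurable (greenKernel a γ x) := by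
  have hγ' := abs_le_of_abs_add_half_le hγ
  have hδ : |-γ| ≤ 5 / 8 := abs_le.2 ⟨by linarith, by linarith⟩
  have hr : Measurable (rescale a) := by unfold rescale; fun_prop
  have hA := (measurable_genAi hδ).comp hr
  have hG := (measurable_genGi hδ).comp hr
  have hH := (measurable_genHi (-γ)).comp hr
  simp only [Function.comp_def] at hA hG hH
  unfold greenKernel
  by_cases ha : a = 0
  · simp only [ha, if_true]
    fun_prop
  · simp only [ha, if_false]
    refine Measurable.ite measurableSet_Ioi (by fun_prop) (by fun_prop)

theorem measurable_weightIn (k a γ : ℝ) : Measurable (weightIn k a γ) := by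
  unfold weightIn
  by_cases ha : a = 0
  · simp only [ha, if_true]
    exact Measurable.ite measurableSet_Iio (by fun_prop) (by fun_prop)
  · simp only [ha, if_false]
    exact Measurable.ite measurableSet_Iic (by fun_prop)
      (Measurable.ite measurableSet_Iic (by fun_prop) (by fun_prop))

end

theorem proposition6p1 (k : ℝ) (hk : 0 ≤ k) :
    ∃ c : ℝ, 0 < c ∧ ∀ a γ : ℝ, 0 ≤ a → a ≤ 1 → |γ + 1 / 2| ≤ 1 / 8 →
      (∀ x : ℝ,
        Integrable (fun y => |greenKernel a γ x y| * weightIn k a γ y) volume ∧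
        (∫ y, |greenKernel a γ x y| * weightIn k a γ y) ≤ c * weightOut k a γ x) ∧
      (∀ (f : ℝ → ℝ) (M : ℝ), AEStronglyMeasurable f volume →
        (∀ x : ℝ, |f x| / weightIn k a γ x ≤ M) →
        ∀ x : ℝ,
          Integrable (fun y => greenKernel a γ x y * f y) volume ∧
          |greenOp a γ f x| / weightOut k a γ x ≤ c * M) := by
  obtain ⟨C, hC, hK⟩ := exists_abs_greenKernel_mul_weightIn_le hk
  obtain ⟨J, hJ, hI⟩ := exists_integral_kernelMajorant_le
  -- C serves a > 0 and the added 1 serves a = 0, where the domination holds with constant 1.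
  refine ⟨(C + 1) * J, by positivity, fun a γ ha ha1 hγ => ?_⟩
  have hdom : ∀ x y, |greenKernel a γ x y| * weightIn k a γ y ≤
      (C + 1) * weightOut k a γ x * kernelMajorant a x y := by
    intro x y
    have hwM := mul_nonneg (weightOut_pos k ha γ x).le (kernelMajorant_nonneg ha x y)
    rcases ha.eq_or_lt with rfl | ha
    · have := abs_greenKernel_zero_mul_weightIn_le k γ x y
      nlinarith
    · have := hK a γ x y ha ha1 hγ
      nlinarith
  have hKm := measurable_greenKernel (a := a) hγ
  have hint : ∀ x, Integrable (fun y => |greenKernel a γ x y| * weightIn k a γ y) := fun x => by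
    refine ((hI a x ha).1.const_mul ((C + 1) * weightOut k a γ x)).mono'
      (((hKm x).abs.mul (measurable_weightIn k a γ)).aestronglyMeasurable)
      (Filter.Eventually.of_forall fun y => ?_)
    rw [Real.norm_of_nonneg (mul_nonneg (abs_nonneg _) (weightIn_pos k ha γ y).le)]
    exact hdom x y
  have hle : ∀ x, ∫ y, |greenKernel a γ x y| * weightIn k a γ y ≤
      (C + 1) * J * weightOut k a γ x := fun x => by
    have hw := weightOut_pos k ha γ x
    calc _ ≤ ∫ y, (C + 1) * weightOut k a γ x * kernelMajorant a x y :=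
          integral_mono (hint x) ((hI a x ha).1.const_mul _) (hdom x)
      _ = (C + 1) * weightOut k a γ x * ∫ y, kernelMajorant a x y := integral_const_mul _ _
      _ ≤ (C + 1) * weightOut k a γ x * J := by
          gcongr
          exact (hI a x ha).2
      _ = _ := by ring
  refine ⟨fun x => ⟨hint x, hle x⟩, fun f M hf hfM x => ?_⟩
  have hM : 0 ≤ M := (div_nonneg (abs_nonneg _) (weightIn_pos k ha γ 0).le).trans (hfM 0)
  have hb : ∀ y, ‖greenKernel a γ x y * f y‖ ≤
      M * (|greenKernel a γ x y| * weightIn k a γ y) := fun y => by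
    have h1 := (div_le_iff₀ (weightIn_pos k ha γ y)).1 (hfM y)
    rw [Real.norm_eq_abs, abs_mul]
    calc _ ≤ |greenKernel a γ x y| * (M * weightIn k a γ y) := by gcongr
      _ = _ := by ring
  refine ⟨((hint x).const_mul M).mono' ((hKm x).aestronglyMeasurable.mul hf)
    (Filter.Eventually.of_forall hb), ?_⟩
  rw [div_le_iff₀ (weightOut_pos k ha γ x), greenOp, ← Real.norm_eq_abs]
  calc _ ≤ ∫ y, M * (|greenKernel a γ x y| * weightIn k a γ y) :=
        norm_integral_le_of_norm_le ((hint x).const_mul M) (Filter.Eventually.of_forall hb)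
    _ = M * ∫ y, |greenKernel a γ x y| * weightIn k a γ y := integral_const_mul _ _
    _ ≤ M * ((C + 1) * J * weightOut k a γ x) := by gcongr; exact hle x
    _ = _ := by ring
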